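/- A stable set of a finite simple undirected graph $G=(V,E)$ is a set of pairwise non-adjacent vertices; it is a maximal stable set if no other stable set contains it. For a positive integer $k$, the graph $G$ is called $k$-equistable if there are a positive integer $t$ and a function $w\colon V\to\{1,\dots,k\}$ such that, for every $S\subseteq V$, $S$ is a maximal stable set of $G$ if and only if $\sum_{x\in S}w(x)=t$. The problem $k$-Equistability has as input a graph $G$ and a positive integer $k$ (the parameter) and asks whether $G$ is $k$-equistable. Algorithms run on a word RAM in which every elementary operation costs one step and, on an input graph with $n$ vertices and $m$ edges and parameter $k$, words have $O(\log(n+m+k+2))$ bits; graphs are given by adjacency lists, and $k$ is given as one word. All constants hidden in $O(\cdot)$ are absolute; in particular they do not depend on $k$. Theorem. (a) The problem $k$-Equistability has a kernel with $O(k^5)$ vertices that can be computed in linear time: there are an algorithm and a function $h\colon\mathbb N\to\mathbb N$ such that, for every graph $G$ with $n$ vertices and $m$ edges and every positive integer $k$, the algorithm computes from $(G,k)$ in time $O(n+m+1)$ a graph $G'$ with $O(k^5)$ vertices and a positive integer $k'\le h(k)$ such that $G'$ is $k'$-equistable if and only if $G$ is $k$-equistable. (b) There is an algorithm that, given a graph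 $G$ with $n$ vertices and $m$ edges and a positive integer $k$, decides in time $O(k^{9k+1}+m+n)$ whether $G$ is $k$-equistable. (c) Consequently, $k$-Equistability is fixed-parameter tractable: for some function $f$ and some constant $d$, it can be decided in time at most $f(k)\cdot(n+m+1)^{d}$. -/

import Mathlib

namespace Equistability

/-! ### Equistable graphs -/

/-- `S` is a maximal stable (independent) set of `G`: a stable set that is not contained in any
other stable set. -/
def IsMaximalStable {V : Type*} (G : SimpleGraph V) (S : Set V) : Prop :=
  Maximal (fun T : Set V => G.IsIndepSet T) S

/-- `(w, t)` is an equistable structure of `G`: `t` is a positive integer, `w` is a function from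
the vertices to the positive integers, and the maximal stable sets of `G` are exactly the vertex
sets of total weight `t`. -/
structure IsEquistableStructure {V : Type*} (G : SimpleGraph V) (w : V → ℕ) (t : ℕ) :
    Prop where
  target_pos : 0 < t
  weight_pos : ∀ v, 0 < w v
  maximal_iff : ∀ S : Finset V, IsMaximalStable G (S : Set V) ↔ ∑ v ∈ S, w v = t

/-- `G` is `k`-equistable: it has an equistable structure whose weights lie in `{1, …, k}`. -/
def IsKEquistable {V : Type*} (G : SimpleGraph V) (k : ℕ) : Prop :=
  ∃ (w : V → ℕ) (t : ℕ), IsEquistableStructure G w t ∧ ∀ v, w v ≤ k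

/-! ### Word random access machine

Programs work on registers and on arrays of natural numbers. A program is a finite object and thus
mentions only finitely many registers and arrays. Every access to a register or an array cell, every
arithmetic operation, every constant, every assignment and every test costs one step. No number
that occurs in a computation may exceed the bound `W` (the largest number that fits into a
machine word). -/

/-- The contents of the registers and of the arrays. -/
structure Store where
  reg : ℕ → ℕ
  arr : ℕ → ℕ → ℕ

/-- The arithmetic operations and comparisons of the machine. -/
inductive Op
  | add | sub | mul | div | lt | eq

/-- The value of an operation: subtraction is truncated at `0`, division rounds down (and gives `0`
for divisor `0`), and comparisons yield `1` for true and `0` for false. -/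
def Op.eval : Op → ℕ → ℕ → ℕ
  | .add, a, b => a + b
  | .sub, a, b => a - b
  | .mul, a, b => a * b
  | .div, a, b => a / b
  | .lt, a, b => if a < b then 1 else 0
  | .eq, a, b => if a = b then 1 else 0

/-- Expressions: constants, registers, cells of an array (with a computed index), operations. -/
inductive Expr
  | const (c : ℕ)
  | reg (r : ℕ)
  | get (a : ℕ) (i : Expr)
  | bin (o : Op) (x y : Expr)

/-- The value of an expression in a store. -/
def Expr.eval (s : Store) : Expr → ℕ
  | .const c => c
  | .reg r => s.reg r
  | .get a i => s.arr a (i.eval s)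
  | .bin o x y => o.eval (x.eval s) (y.eval s)

/-- The number of steps needed to evaluate an expression. -/
def Expr.cost : Expr → ℕ
  | .const _ => 1
  | .reg _ => 1
  | .get _ i => i.cost + 1
  | .bin _ x y => x.cost + y.cost + 1

/-- All numbers that occur in the evaluation of an expression are at most `W`. -/
def Expr.Fits (W : ℕ) (s : Store) : Expr → Prop
  | .const c => c ≤ W
  | .reg r => s.reg r ≤ W
  | .get a i => i.Fits W s ∧ s.arr a (i.eval s) ≤ W
  | .bin o x y => x.Fits W s ∧ y.Fits W s ∧ o.eval (x.eval s) (y.eval s) ≤ W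

/-- Programs: do nothing, assign to a register (`reg r := e`), write to an array cell
(`arr a i := e`), sequential composition, branching (on `e ≠ 0`), and repetition of a body as long
as `e ≠ 0`. -/
inductive Prog
  | nop
  | assign (r : ℕ) (e : Expr)
  | write (a : ℕ) (i e : Expr)
  | seq (p q : Prog)
  | branch (e : Expr) (p q : Prog)
  | loop (e : Expr) (p : Prog)

/-- The store after an assignment to a register. -/
def Store.setReg (s : Store) (r x : ℕ) : Store :=
  { s with reg := Function.update s.reg r x }

/-- The store after an assignment to an array cell. -/
def Store.setArr (s : Store) (a i x : ℕ) : Store :=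
  { s with arr := Function.update s.arr a (Function.update (s.arr a) i x) }

/-- `Exec W p s t s'`: with word bound `W`, the program `p` started in the store `s` halts after
`t` steps in the store `s'`. There is no such `t` and `s'` if the program runs forever or if a number
exceeding `W` occurs. -/
inductive Exec (W : ℕ) : Prog → Store → ℕ → Store → Prop
  | nop (s : Store) : Exec W .nop s 1 s
  | assign (s : Store) (r : ℕ) (e : Expr) (he : e.Fits W s) :
      Exec W (.assign r e) s (e.cost + 1) (s.setReg r (e.eval s))
  | write (s : Store) (a : ℕ) (i e : Expr) (hi : i.Fits W s) (he : e.Fits W s) :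
      Exec W (.write a i e) s (i.cost + e.cost + 1) (s.setArr a (i.eval s) (e.eval s))
  | seq {p q : Prog} {s s₁ s₂ : Store} {t₁ t₂ : ℕ}
      (hp : Exec W p s t₁ s₁) (hq : Exec W q s₁ t₂ s₂) :
      Exec W (.seq p q) s (t₁ + t₂) s₂
  | branch_true {e : Expr} {p q : Prog} {s s₁ : Store} {t : ℕ}
      (he : e.Fits W s) (h : e.eval s ≠ 0) (hp : Exec W p s t s₁) :
      Exec W (.branch e p q) s (e.cost + 1 + t) s₁
  | branch_false {e : Expr} {p q : Prog} {s s₁ : Store} {t : ℕ}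
      (he : e.Fits W s) (h : e.eval s = 0) (hq : Exec W q s t s₁) :
      Exec W (.branch e p q) s (e.cost + 1 + t) s₁
  | loop_stop {e : Expr} {p : Prog} {s : Store}
      (he : e.Fits W s) (h : e.eval s = 0) :
      Exec W (.loop e p) s (e.cost + 1) s
  | loop_step {e : Expr} {p : Prog} {s s₁ s₂ : Store} {t₁ t₂ : ℕ}
      (he : e.Fits W s) (h : e.eval s ≠ 0)
      (hp : Exec W p s t₁ s₁) (hl : Exec W (.loop e p) s₁ t₂ s₂) :
      Exec W (.loop e p) s (e.cost + 1 + t₁ + t₂) s₂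

/-! ### Instances, running times and kernels -/

/-- A parameterized graph problem: a set of pairs of a finite graph, with vertices numbered
`0, …, n - 1`, and a parameter. -/
abbrev GraphProblem := (n : ℕ) → SimpleGraph (Fin n) → ℕ → Prop

/-- The problem whose instances are a graph `G` and a positive integer `k`, and whose question is
whether `G` is `k`-equistable. -/
def kEquistability : GraphProblem := fun _ G k => IsKEquistable G k

/-- The number of edges. -/
noncomputable def numEdges {n : ℕ} (G : SimpleGraph (Fin n)) : ℕ := G.edgeSet.ncard

/-- `off` and `nbr` form an adjacency list representation of `G`: the neighbours of the vertex `v`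
are listed, each of them once and in any order, in the cells `off v, …, off (v + 1) - 1` of `nbr`. -/
structure IsAdjacencyList {n : ℕ} (G : SimpleGraph (Fin n)) (off nbr : ℕ → ℕ) : Prop where
  off_zero : off 0 = 0
  off_le : ∀ v : Fin n, off (v : ℕ) ≤ off ((v : ℕ) + 1)
  bijOn : ∀ v : Fin n,
    Set.BijOn nbr (Set.Ico (off (v : ℕ)) (off ((v : ℕ) + 1))) (Fin.val '' G.neighborSet v)

/-- The store contains the instance `(G, k)`: register `0` holds the number of vertices,
register `1` holds `k`, and the arrays `0` and `1` hold `G` as adjacency lists. -/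
structure Holds (s : Store) {n : ℕ} (G : SimpleGraph (Fin n)) (k : ℕ) : Prop where
  reg_zero : s.reg 0 = n
  reg_one : s.reg 1 = k
  adj : IsAdjacencyList G (s.arr 0) (s.arr 1)

/-- The store is an initial store for the instance `(G, k)`: it contains the instance and zeros
everywhere else. -/
structure IsInput (s : Store) {n : ℕ} (G : SimpleGraph (Fin n)) (k : ℕ) : Prop
    extends Holds s G k where
  reg_rest : ∀ r, 2 ≤ r → s.reg r = 0
  arr_zero_rest : ∀ i, n < i → s.arr 0 i = 0
  arr_one_rest : ∀ i, s.arr 0 n ≤ i → s.arr 1 i = 0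
  arr_rest : ∀ a, 2 ≤ a → ∀ i, s.arr a i = 0

/-- The word bound on an instance with `n` vertices, `m` edges and parameter `k`, with `c` as the
constant in the word length of `O(log (n + m + k))` bits. -/
def wordBound (c n m k : ℕ) : ℕ := (n + m + k + 2) ^ c

/-- Some program decides the problem `P` within `T n m k` steps on the instances with `n` vertices,
`m` edges and parameter `k`, leaving the answer (`1` for yes, `0` for no) in register `0`. -/
def DecidableInTime (P : GraphProblem) (T : ℕ → ℕ → ℕ → ℕ) : Prop :=
  ∃ (p : Prog) (c : ℕ), ∀ (n : ℕ) (G : SimpleGraph (Fin n)) (k : ℕ), 0 < k →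
    ∀ s : Store, IsInput s G k →
      ∃ (t : ℕ) (s' : Store), Exec (wordBound c n (numEdges G) k) p s t s' ∧
        t ≤ T n (numEdges G) k ∧
        (P n G k → s'.reg 0 = 1) ∧ (¬ P n G k → s'.reg 0 = 0)

/-- The problem `P` is fixed-parameter tractable: it can be decided in time `f(k) · N ^ O(1)`,
where `N` is the size of the input graph. -/
def FixedParameterTractable (P : GraphProblem) : Prop :=
  ∃ (f : ℕ → ℕ) (d : ℕ), DecidableInTime P (fun n m k => f k * (n + m + 1) ^ d)

/-- The problem `P` has a kernel with at most `g k` vertices that can be computed in linear time: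
some program transforms every instance `(G, k)`, within `O(n + m)` steps, into an equivalent instance
`(G', k')` of the same problem such that `G'` has at most `g k` vertices and `k'` is bounded by
a function of `k`. -/
def HasLinearTimeKernel (P : GraphProblem) (g : ℕ → ℕ) : Prop :=
  ∃ (p : Prog) (c C : ℕ) (h : ℕ → ℕ), ∀ (n : ℕ) (G : SimpleGraph (Fin n)) (k : ℕ), 0 < k →
    ∀ s : Store, IsInput s G k →
      ∃ (t : ℕ) (s' : Store) (n' : ℕ) (G' : SimpleGraph (Fin n')) (k' : ℕ),
        Exec (wordBound c n (numEdges G) k) p s t s' ∧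
        t ≤ C * (n + numEdges G + 1) ∧
        Holds s' G' k' ∧ 0 < k' ∧
        (P n' G' k' ↔ P n G k) ∧
        n' ≤ g k ∧ k' ≤ h k

end Equistability

/-!
Two facts carry the proof. In a graph `G` with an equistable structure `(w, t)`, vertices of equal
weight are twins (`IsStructureOn.twin`): if `x` is adjacent to `u` but not to `v`, a maximal stable
set through `x` and `v` would stay maximal stable after trading `v` for `u`, as its weight does not
change. So a `k`-equistable graph has at most `k` classes of twins. Secondly, a vertex `v` with more
than `2 k ^ 3` twins of the same kind in the rest of the graph can be removed.

* True twins have equal weight. If there are more than `k` of them, the target is at most `2 k ^ 2`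
  (`IsStructureOn.target_le`). Otherwise a maximal stable set `S` through one of them, of weight `a`,
  contains `2 a - 1` other vertices; by the theorem of Erdős, Ginzburg and Ziv some of these have a
  total weight `a q` with `1 ≤ q ≤ k`, and could be traded for `q` of the twins, which are adjacent to
  the one in `S`. Therefore `v` can be added with the weight of its twins: a set that contains all of
  them is too heavy, and otherwise `v` may be exchanged for a twin outside the set.
* False twins with a common neighbour and in that number rule out any structure, by the same kind of
  trade (`IsStructureOn.card_falseTwin_le`).
* Isolated vertices lie in all maximal stable sets; among many of them, many have the same weight
  `a`, and a trade shows that the total weight is close to the target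
  (`IsStructureOn.sum_sdiff_le`). Therefore `v` can be added with weight `a` and target `t + a`.

Keeping at most `3 k ^ 3` vertices of each class of false twins and of true twins leaves an equivalent
graph (`kEquistableOn_iff_of_twinDense`) with at most `6 k ^ 4` vertices, unless the graph has too many
classes and the answer is no (`KEquistableOn.card_le`). The classes of both kinds of twins are found
in linear time by partition refinement (`runs_refine`), and the kernel is written over the input in
linear time (`runs_kernel`).

On the kernel the answer is found by exhaustive search. A graph with `n` vertices needs to be
tested only for weight functions that are nondecreasing along each class of twins, thus given by the
last vertex of each of the `k` weights, and only for sets that contain the first few vertices of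
each weight, thus given by `k` numbers (`kEquistableOn_range_iff`). Both are vectors of `k` digits in
base `n + 1`, through which two nested odometers run (`Runs.odometer`). With `n = O(k ^ 4)` this
takes time `k ^ (8 k + O(1))` up to a factor `c ^ k`, and `k ^ k` absorbs what exceeds `k ^ (8 k + 1)`
(`exists_searchTime_le`).

Programs are verified with `Runs W p s T Q`, total correctness within a time bound: weakest
preconditions for code without loops (`Runs.of_wp`), an invariant rule with amortized cost for loops
(`Runs.loop`), and `Frame` for everything that a program does not touch.
-/

namespace Equistability

/-! ### Equistability relative to a set of vertices -/

/-- `S` is a maximal stable set of the subgraph of `G` induced by `U`: a vertex of `U` belongs to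
`S` if and only if it has no neighbour in `S`. -/
def MaxStableOn {V : Type*} (G : SimpleGraph V) (U S : Finset V) : Prop :=
  S ⊆ U ∧ ∀ v ∈ U, (v ∈ S ↔ ∀ u ∈ S, ¬ G.Adj v u)

/-- `(w, t)` is an equistable structure, with weights at most `k`, of the subgraph of `G` induced
by `U`. The weights outside `U` are irrelevant. -/
structure IsStructureOn {V : Type*} (G : SimpleGraph V) (U : Finset V) (k : ℕ) (w : V → ℕ)
    (t : ℕ) : Prop where
  target_pos : 0 < t
  weight : ∀ v ∈ U, 0 < w v ∧ w v ≤ k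
  max_iff : ∀ S ⊆ U, (MaxStableOn G U S ↔ ∑ v ∈ S, w v = t)

/-- The subgraph of `G` induced by `U` is `k`-equistable. -/
def KEquistableOn {V : Type*} (G : SimpleGraph V) (U : Finset V) (k : ℕ) : Prop :=
  ∃ w t, IsStructureOn G U k w t

section Graph

variable {V : Type*} {G : SimpleGraph V} {U S T : Finset V} {k t : ℕ} {w : V → ℕ} {u v : V}

theorem isMaximalStable_iff {S : Set V} :
    IsMaximalStable G S ↔ ∀ v, (v ∈ S ↔ ∀ u ∈ S, ¬ G.Adj v u) := by
  constructor
  · intro h v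
    constructor
    · intro hv u hu huv
      exact h.1 hv hu huv.ne huv
    · intro hv
      have hi : G.IsIndepSet (insert v S) := by
        intro x hx y hy hxy
        rcases hx with rfl | hx <;> rcases hy with rfl | hy
        · exact absurd rfl hxy
        · exact hv y hy
        · exact fun h' => hv x hx h'.symm
        · exact h.1 hx hy hxy
      exact h.2 hi (Set.subset_insert v S) (Set.mem_insert v S)
  · intro h
    refine ⟨fun x hx y hy _ => (h x).1 hx y hy, ?_⟩
    intro T hT hST x hx
    refine (h x).2 fun u hu hxu => hT hx (hST hu) hxu.ne hxu

theorem isMaximalStable_comap_iff {X : Type*} [Fintype X] (e : X ↪ V) (S : Finset X) :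
    IsMaximalStable (G.comap e) (S : Set X) ↔
      MaxStableOn G (Finset.univ.map e) (S.map e) := by
  rw [isMaximalStable_iff]
  simp [MaxStableOn, Finset.map_subset_map]

/-- Equistability of a graph that is given by an embedding into a larger graph. -/
theorem isKEquistable_comap_iff {X : Type*} [Fintype X] (e : X ↪ V) :
    IsKEquistable (G.comap e) k ↔ KEquistableOn G (Finset.univ.map e) k := by
  constructor
  · rintro ⟨w, t, h, hk⟩
    have hw : ∀ x, Function.extend e w (fun _ => 0) (e x) = w x :=
      fun x => e.injective.extend_apply w _ x
    refine ⟨Function.extend e w (fun _ => 0), t, h.target_pos, ?_, ?_⟩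
    · simp only [Finset.mem_map, Finset.mem_univ, true_and, forall_exists_index,
        forall_apply_eq_imp_iff, hw]
      exact fun x => ⟨h.weight_pos x, hk x⟩
    · intro S hS
      obtain ⟨S, -, rfl⟩ := Finset.subset_map_iff.1 hS
      rw [← isMaximalStable_comap_iff, h.maximal_iff, Finset.sum_map]
      simp only [hw]
  · rintro ⟨w, t, h⟩
    refine ⟨fun x => w (e x), t, ⟨h.target_pos, fun x => (h.weight (e x) (by simp)).1, ?_⟩,
      fun x => (h.weight (e x) (by simp)).2⟩
    intro S
    rw [isMaximalStable_comap_iff, h.max_iff _ (Finset.map_subset_map.2 (Finset.subset_univ S)),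
      Finset.sum_map]

theorem exists_maxStableOn (hS : S ⊆ U) (hst : ∀ x ∈ S, ∀ y ∈ S, ¬ G.Adj x y) :
    ∃ M, MaxStableOn G U M ∧ S ⊆ M := by
  classical
  have hfin : {M : Finset V | M ⊆ U ∧ ∀ x ∈ M, ∀ y ∈ M, ¬ G.Adj x y}.Finite :=
    (Finset.finite_toSet U.powerset).subset fun M hM => by simpa using hM.1
  obtain ⟨M, hSM, hM⟩ := hfin.exists_le_maximal (a := S) ⟨hS, hst⟩
  refine ⟨M, ⟨hM.1.1, fun v hv => ⟨fun hvM u hu => hM.1.2 v hvM u hu, fun hn => ?_⟩⟩, hSM⟩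
  have : insert v M ⊆ U ∧ ∀ x ∈ insert v M, ∀ y ∈ insert v M, ¬ G.Adj x y := by
    refine ⟨Finset.insert_subset hv hM.1.1, ?_⟩
    intro x hx y hy
    rcases Finset.mem_insert.1 hx with rfl | hxM <;>
      rcases Finset.mem_insert.1 hy with rfl | hyM
    · exact G.irrefl
    · exact hn y hyM
    · exact fun h' => hn x hxM h'.symm
    · exact hM.1.2 x hxM y hyM
  exact hM.2 this (Finset.subset_insert v M) (Finset.mem_insert_self v M)

theorem exists_maxStableOn_mem (hv : v ∈ U) : ∃ M, MaxStableOn G U M ∧ v ∈ M := by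
  obtain ⟨M, hM, h⟩ := exists_maxStableOn (G := G) (S := {v}) (by simpa using hv) (by simp)
  exact ⟨M, hM, h (by simp)⟩

theorem MaxStableOn.not_adj (h : MaxStableOn G U S) (hu : u ∈ S) (hv : v ∈ S) : ¬ G.Adj u v :=
  (h.2 u (h.1 hu)).1 hu v hv

/-! ### Twins -/

/-- `u` and `v` have the same open neighbourhood. -/
def FalseTwin (G : SimpleGraph V) (u v : V) : Prop :=
  ∀ x, G.Adj u x ↔ G.Adj v x

/-- `u` and `v` have the same closed neighbourhood. -/
def TrueTwin (G : SimpleGraph V) (u v : V) : Prop :=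
  ∀ x, (G.Adj u x ∨ u = x) ↔ (G.Adj v x ∨ v = x)

/-- No vertex other than `u` and `v` distinguishes `u` from `v`. -/
def Twin (G : SimpleGraph V) (u v : V) : Prop :=
  ∀ x, x ≠ u → x ≠ v → (G.Adj u x ↔ G.Adj v x)

theorem FalseTwin.twin (h : FalseTwin G u v) : Twin G u v := fun x _ _ => h x

theorem TrueTwin.twin (h : TrueTwin G u v) : Twin G u v := by
  intro x hu hv
  have := h x
  simpa [hu.symm, hv.symm] using this

theorem Twin.symm (h : Twin G u v) : Twin G v u := fun x hu hv => (h x hv hu).symm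

theorem Twin.trans {x : V} (h : Twin G u v) (h' : Twin G v x) : Twin G u x := by
  intro y hyu hyx
  by_cases hyv : y = v
  · subst hyv
    by_cases hux : u = x
    · rw [hux]
    · rw [G.adj_comm u y, h' u hyu.symm hux, G.adj_comm x u, h x (Ne.symm hux) hyx.symm,
        G.adj_comm]
  · exact (h y hyu hyv).trans (h' y hyv hyx)

theorem twin_iff : Twin G u v ↔ FalseTwin G u v ∨ TrueTwin G u v := by
  refine ⟨fun h => ?_, fun h => h.elim FalseTwin.twin TrueTwin.twin⟩
  by_cases huv : G.Adj u v
  · refine Or.inr fun x => ?_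
    by_cases hu : x = u
    · subst hu; simp [huv.symm]
    by_cases hv : x = v
    · subst hv; simp [huv]
    simp [Ne.symm hu, Ne.symm hv, h x hu hv]
  · refine Or.inl fun x => ?_
    by_cases hu : x = u
    · subst hu; simp [G.adj_comm v x, huv]
    by_cases hv : x = v
    · subst hv; simp [huv]
    exact h x hu hv

theorem FalseTwin.mem_of_mem (htw : FalseTwin G u v) (hu : u ∈ U) (h : MaxStableOn G U S)
    (hv : v ∈ S) : u ∈ S := by
  rw [h.2 u hu]
  intro y hy
  rw [htw y]
  exact h.not_adj hv hy

/-- By the theorem of Erdős, Ginzburg and Ziv, a set of `2 a - 1` weights contains a nonempty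
subset whose sum is a multiple of `a`. -/
theorem exists_sum_eq_mul {D : Finset V} {a : ℕ} (ha : 0 < a)
    (hw : ∀ x ∈ D, 0 < w x ∧ w x ≤ k) (hD : 2 * a ≤ D.card + 1) :
    ∃ E ⊆ D, ∃ q, 0 < q ∧ q ≤ k ∧ ∑ x ∈ E, w x = a * q := by
  obtain ⟨E, hE, hcard, hdvd⟩ := Int.erdos_ginzburg_ziv (n := a) (s := D) (fun x => (w x : ℤ))
    (by omega)
  have hdvd' : a ∣ ∑ x ∈ E, w x := by exact_mod_cast hdvd
  obtain ⟨q, hq⟩ := hdvd'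
  have hne : E.Nonempty := Finset.card_pos.1 (by omega)
  have hpos : 0 < ∑ x ∈ E, w x := Finset.sum_pos (fun x hx => (hw x (hE hx)).1) hne
  have hle : ∑ x ∈ E, w x ≤ a * k := by
    calc ∑ x ∈ E, w x ≤ ∑ _x ∈ E, k := Finset.sum_le_sum fun x hx => (hw x (hE hx)).2
      _ = a * k := by rw [Finset.sum_const, hcard, smul_eq_mul]
  rw [hq] at hpos hle
  exact ⟨E, hE, q, Nat.pos_of_mul_pos_left hpos, Nat.le_of_mul_le_mul_left hle ha, hq⟩

theorem IsStructureOn.card_le_sum (h : IsStructureOn G U k w t) (hS : S ⊆ U) :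
    S.card ≤ ∑ x ∈ S, w x := by
  rw [Finset.card_eq_sum_ones]
  exact Finset.sum_le_sum fun x hx => (h.weight x (hS hx)).1

theorem IsStructureOn.sum_le (h : IsStructureOn G U k w t) (hS : S ⊆ U) :
    ∑ x ∈ S, w x ≤ S.card * k := by
  rw [← smul_eq_mul, ← Finset.sum_const]
  exact Finset.sum_le_sum fun x hx => (h.weight x (hS hx)).2

theorem IsStructureOn.exists_popular {N : ℕ} (h : IsStructureOn G U k w t) (hTU : T ⊆ U)
    (hcard : k * N < T.card) : ∃ a, 0 < a ∧ a ≤ k ∧ N < (T.filter fun x => w x = a).card := by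
  obtain ⟨a, ha, hN⟩ := Finset.exists_lt_card_fiber_of_mul_lt_card_of_maps_to
    (s := T) (t := Finset.Icc 1 k) (f := w) (n := N)
    (fun x hx => Finset.mem_Icc.2 (h.weight x (hTU hx))) (by simpa using hcard)
  exact ⟨a, (Finset.mem_Icc.1 ha).1, (Finset.mem_Icc.1 ha).2, hN⟩

variable [DecidableEq V]

/-- Exchanging a vertex for a twin of it keeps a set maximal stable. -/
theorem MaxStableOn.exchange (htw : Twin G u v) (hu : u ∈ U) (huS : u ∉ S) (hvS : v ∈ S)
    (h : MaxStableOn G U S) : MaxStableOn G U (insert u (S.erase v)) := by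
  have hne : u ≠ v := fun h' => huS (h' ▸ hvS)
  have hvU := h.1 hvS
  refine ⟨Finset.insert_subset hu ((Finset.erase_subset v S).trans h.1), fun x hx => ?_⟩
  by_cases hxu : x = u
  · subst hxu
    simp only [Finset.mem_insert, true_or, Finset.mem_erase, true_iff]
    rintro y (rfl | ⟨hyv, hy⟩)
    · exact G.irrefl
    · rw [htw y (fun h' => huS (h' ▸ hy)) hyv]
      exact h.not_adj hvS hy
  by_cases hxv : x = v
  · subst hxv
    have hnot := fun h' => huS ((h.2 u hu).2 h')
    have hxS : x ∉ insert u (S.erase x) := by simp [hxu]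
    refine ⟨fun h' => absurd h' hxS, fun h' => absurd ?_ hnot⟩
    intro y hy
    by_cases hyx : y = x
    · subst hyx
      exact fun h1 => h' u (by simp) h1.symm
    · rw [htw y (fun h1 => huS (h1 ▸ hy)) hyx]
      exact h' y (by simp [hy, hyx])
  · have h1 : x ∈ insert u (S.erase v) ↔ x ∈ S := by simp [hxu, hxv]
    rw [h1, h.2 x hx]
    have h2 : G.Adj x u ↔ G.Adj x v := by
      rw [G.adj_comm x u, G.adj_comm x v]; exact htw x hxu hxv
    constructor
    · intro hS y hy
      rcases Finset.mem_insert.1 hy with rfl | hy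
      · rw [h2]; exact hS v hvS
      · exact hS y (Finset.mem_of_mem_erase hy)
    · intro hS y hy
      by_cases hyv : y = v
      · subst hyv; rw [← h2]; exact hS u (by simp)
      · exact hS y (by simp [hy, hyv])

theorem maxStableOn_exchange_iff (htw : Twin G u v) (hu : u ∈ U) (hv : v ∈ U) (huS : u ∉ S)
    (hvS : v ∈ S) : MaxStableOn G U (insert u (S.erase v)) ↔ MaxStableOn G U S := by
  have hne : u ≠ v := fun h' => huS (h' ▸ hvS)
  refine ⟨fun h => ?_, MaxStableOn.exchange htw hu huS hvS⟩
  have := h.exchange (u := v) (v := u) htw.symm hv (by simp [hne.symm]) (by simp)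
  rwa [Finset.erase_insert (by simp [huS]), Finset.insert_erase hvS] at this

theorem sum_exchange (w : V → ℕ) (huS : u ∉ S) (hvS : v ∈ S) :
    ∑ x ∈ insert u (S.erase v), w x + w v = ∑ x ∈ S, w x + w u := by
  rw [Finset.sum_insert (by simp [huS]), ← Finset.sum_erase_add S w hvS]
  ring

/-- Vertices of equal weight are twins. -/
theorem IsStructureOn.twin (h : IsStructureOn G U k w t) (hU : ∀ x y, G.Adj x y → y ∈ U)
    (hu : u ∈ U) (hv : v ∈ U) (hw : w u = w v) : Twin G u v := by
  have key : ∀ u ∈ U, ∀ v ∈ U, w u = w v → ∀ x, x ≠ u → x ≠ v → G.Adj u x → G.Adj v x := by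
    intro u hu v hv hw x hxu hxv hux
    by_contra hvx
    -- a maximal stable set through `x` and `v` would stay maximal stable with `u` in place of `v`
    obtain ⟨M, hM, hsub⟩ := exists_maxStableOn (G := G) (U := U) (S := {x, v})
      (by
        intro y hy
        rcases Finset.mem_insert.1 hy with rfl | hy
        · exact hU _ _ hux
        · rw [Finset.mem_singleton.1 hy]; exact hv)
      (by
        intro y hy z hz
        simp only [Finset.mem_insert, Finset.mem_singleton] at hy hz
        rcases hy with rfl | rfl <;> rcases hz with rfl | rfl
        · exact G.irrefl
        · exact fun h' => hvx h'.symm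
        · exact hvx
        · exact G.irrefl)
    have hxM : x ∈ M := hsub (by simp)
    have hvM : v ∈ M := hsub (by simp)
    have huM : u ∉ M := fun huM => hM.not_adj huM hxM hux
    have hs := sum_exchange w huM hvM
    rw [hw] at hs
    have hM' : MaxStableOn G U (insert u (M.erase v)) :=
      (h.max_iff _ (Finset.insert_subset hu ((Finset.erase_subset v M).trans hM.1))).2
        ((Nat.add_right_cancel hs).trans ((h.max_iff M hM.1).1 hM))
    exact hM'.not_adj (u := u) (v := x) (by simp) (by simp [hxM, hxv]) hux
  exact fun x hxu hxv => ⟨key u hu v hv hw x hxu hxv, key v hv u hu hw.symm x hxv hxu⟩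

/-- True twins have equal weight. -/
theorem IsStructureOn.weight_eq (h : IsStructureOn G U k w t) (htw : TrueTwin G u v)
    (hu : u ∈ U) (hv : v ∈ U) : w u = w v := by
  by_cases hne : u = v
  · rw [hne]
  obtain ⟨M, hM, hvM⟩ := exists_maxStableOn_mem (G := G) hv
  have hadj : G.Adj u v := ((htw v).2 (Or.inr rfl)).resolve_right hne
  have huM : u ∉ M := fun huM => hM.not_adj huM hvM hadj
  have h1 := (h.max_iff M hM.1).1 hM
  have h2 := (h.max_iff _ (Finset.insert_subset hu ((Finset.erase_subset v M).trans hM.1))).1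
    (hM.exchange htw.twin hu huM hvM)
  have := sum_exchange w huM hvM
  omega

/-! ### Zero-sum exchanges -/

/-- If `S` has the target weight and at least `2 a - 1` of its elements may be dropped, then some of
them can be traded for vertices of weight `a` from any set `T` of `k` such vertices. -/
theorem IsStructureOn.exists_trade {D : Finset V} {a : ℕ} (h : IsStructureOn G U k w t)
    (hS : S ⊆ U) (hSt : ∑ x ∈ S, w x = t) (hDS : D ⊆ S) (hD : 2 * a ≤ D.card + 1) (ha : 0 < a)
    (hTU : T ⊆ U) (hTS : Disjoint T S) (hTa : ∀ x ∈ T, w x = a) (hT : k ≤ T.card) :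
    ∃ E ⊆ D, ∃ Q ⊆ T, Q.Nonempty ∧ Q.card ≤ k ∧ MaxStableOn G U (S \ E ∪ Q) := by
  obtain ⟨E, hE, q, hq0, hqk, hsum⟩ := exists_sum_eq_mul (w := w) (k := k) ha
    (fun x hx => h.weight x (hS (hDS hx))) hD
  obtain ⟨Q, hQT, hQ⟩ := Finset.exists_subset_card_eq (hqk.trans hT)
  refine ⟨E, hE, Q, hQT, Finset.card_pos.1 (by omega), by omega, ?_⟩
  rw [h.max_iff _ (Finset.union_subset (Finset.sdiff_subset.trans hS) (hQT.trans hTU)),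
    Finset.sum_union ((hTS.mono_left hQT).symm.mono_left Finset.sdiff_subset),
    Finset.sum_congr rfl fun x hx => hTa x (hQT hx), Finset.sum_const, hQ, smul_eq_mul,
    mul_comm q a, ← hsum, Finset.sum_sdiff (hE.trans hDS), hSt]

/-- The target weight is small if there are many true twins. -/
theorem IsStructureOn.target_le (h : IsStructureOn G U k w t) (hTU : T ⊆ U)
    (hT : ∀ x ∈ T, ∀ y ∈ T, TrueTwin G x y) (hcard : k < T.card) : t ≤ 2 * k * k := by
  obtain ⟨u, hu⟩ : T.Nonempty := Finset.card_pos.1 (by omega)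
  obtain ⟨S, hS, huS⟩ := exists_maxStableOn_mem (G := G) (hTU hu)
  have hSt := (h.max_iff S hS.1).1 hS
  have hwu := h.weight u (hTU hu)
  have hadj : ∀ x ∈ T, x ≠ u → G.Adj u x := fun x hx hxu =>
    ((hT u hu x hx x).2 (Or.inr rfl)).resolve_right hxu.symm
  have hscard : S.card ≤ 2 * w u := by
    by_contra hlt
    obtain ⟨E, hE, Q, hQ, ⟨q, hq⟩, -, hM⟩ := h.exists_trade (D := S.erase u) (T := T.erase u)
      (a := w u) hS.1 hSt (Finset.erase_subset u S) (by rw [Finset.card_erase_of_mem huS]; omega)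
      hwu.1 ((Finset.erase_subset u T).trans hTU)
      (Finset.disjoint_left.2 fun x hx hxS =>
        hS.not_adj huS hxS (hadj x (Finset.mem_of_mem_erase hx) (Finset.ne_of_mem_erase hx)))
      (fun x hx => h.weight_eq (hT x (Finset.mem_of_mem_erase hx) u hu)
        (hTU (Finset.mem_of_mem_erase hx)) (hTU hu))
      (by rw [Finset.card_erase_of_mem hu]; omega)
    have hq' := hQ hq
    refine hM.not_adj (u := u) (v := q) ?_ (Finset.mem_union_right _ hq)
      (hadj q (Finset.mem_of_mem_erase hq') (Finset.ne_of_mem_erase hq'))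
    exact Finset.mem_union_left _ (Finset.mem_sdiff.2 ⟨huS, fun h' => by simpa using hE h'⟩)
  calc t ≤ S.card * k := hSt ▸ h.sum_le hS.1
    _ ≤ 2 * w u * k := Nat.mul_le_mul_right k hscard
    _ ≤ 2 * k * k := Nat.mul_le_mul_right k (by omega)

/-- Many false twins with a common neighbour rule out an equistable structure. -/
theorem IsStructureOn.card_falseTwin_le (h : IsStructureOn G U k w t) (hTU : T ⊆ U)
    (hT : ∀ x ∈ T, ∀ y ∈ T, FalseTwin G x y) (hu : u ∈ T) (hv : v ∈ U) (huv : G.Adj u v) :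
    T.card ≤ 2 * k * k := by
  by_contra hlt
  have hwv := h.weight v hv
  obtain ⟨a, ha0, hak, ha⟩ := h.exists_popular (N := k) hTU (by nlinarith)
  obtain ⟨S, hS, hvS⟩ := exists_maxStableOn_mem (G := G) hv
  obtain ⟨S', hS', huS'⟩ := exists_maxStableOn_mem (G := G) (hTU hu)
  have hSt := (h.max_iff S hS.1).1 hS
  have hSt' := (h.max_iff S' hS'.1).1 hS'
  have hTS : Disjoint T S := Finset.disjoint_left.2 fun x hx hxS =>
    hS.not_adj hxS hvS ((hT u hu x hx v).1 huv)
  have hTS' : T ⊆ S' := fun x hx => (hT x hx u hu).mem_of_mem (hTU hx) hS' huS'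
  have h1 : T.card ≤ t := hSt' ▸ (Finset.card_le_card hTS').trans (h.card_le_sum hS'.1)
  have h2 : 2 * k < S.card := by
    have : t ≤ S.card * k := hSt ▸ h.sum_le hS.1
    by_contra hle
    have := Nat.mul_le_mul_right k (not_lt.1 hle)
    omega
  obtain ⟨E, -, Q, hQ, ⟨q, hq⟩, hQk, hM⟩ := h.exists_trade (D := S)
    (T := T.filter fun x => w x = a) (a := a) hS.1 hSt subset_rfl (by omega) ha0
    ((Finset.filter_subset _ T).trans hTU) (hTS.mono_left (Finset.filter_subset _ T))
    (fun x hx => (Finset.mem_filter.1 hx).2) ha.le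
  -- the traded set meets `T`, hence contains `T`, but it has at most `k` elements of `T`
  have hTQ : T ⊆ Q := by
    intro x hx
    have hxM : x ∈ S \ E ∪ Q := (hT x hx q (Finset.mem_filter.1 (hQ hq)).1).mem_of_mem
      (hTU hx) hM (Finset.mem_union_right _ hq)
    rcases Finset.mem_union.1 hxM with h' | h'
    · exact absurd (Finset.mem_sdiff.1 h').1 (Finset.disjoint_left.1 hTS hx)
    · exact h'
  have := Finset.card_le_card hTQ
  nlinarith

/-- A maximal stable set misses few vertices if there are many isolated ones. -/
theorem IsStructureOn.sum_sdiff_le {a : ℕ} (h : IsStructureOn G U k w t) (hTU : T ⊆ U)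
    (hT : ∀ x ∈ T, ∀ y ∈ U, ¬ G.Adj x y) (ha : 0 < a) (hak : a ≤ k) (hTa : ∀ x ∈ T, w x = a)
    (hcard : k ≤ T.card) : ∑ x ∈ U, w x ≤ t + 2 * k * k := by
  obtain ⟨S, hS, -⟩ := exists_maxStableOn (G := G) (U := U) (S := ∅) (by simp) (by simp)
  have hSt := (h.max_iff S hS.1).1 hS
  have hTS : T ⊆ S := fun x hx =>
    (hS.2 x (hTU hx)).2 fun y hy => hT x hx y (hS.1 hy)
  have hle : (U \ S).card ≤ 2 * k := by
    by_contra hlt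
    obtain ⟨E, hE, q, hq0, hqk, hsum⟩ := exists_sum_eq_mul (D := U \ S) (w := w) (k := k) ha
      (fun x hx => h.weight x (Finset.mem_sdiff.1 hx).1) (by omega)
    obtain ⟨Q, hQT, hQ⟩ := Finset.exists_subset_card_eq (hqk.trans hcard)
    have hEU : E ⊆ U := hE.trans Finset.sdiff_subset
    have hES : Disjoint (S \ Q) E := Finset.disjoint_left.2 fun x hx hx' =>
      (Finset.mem_sdiff.1 (hE hx')).2 (Finset.mem_sdiff.1 hx).1
    have hM : MaxStableOn G U (S \ Q ∪ E) := by
      rw [h.max_iff _ (Finset.union_subset (Finset.sdiff_subset.trans hS.1) hEU),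
        Finset.sum_union hES, hsum, ← hSt, ← Finset.sum_sdiff (hQT.trans hTS),
        Finset.sum_congr rfl fun x hx => hTa x (hQT hx), Finset.sum_const, hQ, smul_eq_mul,
        mul_comm q a]
    obtain ⟨x, hx⟩ : Q.Nonempty := Finset.card_pos.1 (by omega)
    have hxM := (hM.2 x (hTU (hQT hx))).2 fun y hy => hT x (hQT hx) y (hM.1 hy)
    rcases Finset.mem_union.1 hxM with h' | h'
    · exact (Finset.mem_sdiff.1 h').2 hx
    · exact (Finset.mem_sdiff.1 (hE h')).2 (hTS (hQT hx))
  have h1 := h.sum_le (S := U \ S) Finset.sdiff_subset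
  have h2 := Nat.mul_le_mul_right k hle
  rw [← Finset.sum_sdiff hS.1, hSt]
  omega

/-! ### Removing a vertex with many twins -/

/-- A set without `v` that meets the conditions in `U` blocks `v`, as it blocks or contains `u`. -/
theorem maxStableOn_insert_iff_of_trueTwin (hv : v ∉ U) (hS : S ⊆ U) (hu : u ∈ U)
    (htw : TrueTwin G u v) : MaxStableOn G (insert v U) S ↔ MaxStableOn G U S := by
  refine ⟨fun h => ⟨hS, fun x hx => h.2 x (Finset.mem_insert_of_mem hx)⟩, fun h => ?_⟩
  refine ⟨hS.trans (Finset.subset_insert v U), fun x hx => ?_⟩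
  rcases Finset.mem_insert.1 hx with rfl | hx
  · refine ⟨fun hxS => absurd (hS hxS) hv, fun hn => ?_⟩
    have hne : ∀ y ∈ S, x ≠ y := fun y hy h' => hv (h' ▸ hS hy)
    have huS : u ∉ S := fun huS =>
      hn u huS (((htw u).1 (Or.inr rfl)).resolve_right (hne u huS))
    refine absurd ((h.2 u hu).2 fun y hy huy => ?_) huS
    exact hn y hy (((htw y).1 (Or.inl huy)).resolve_right (hne y hy))
  · exact h.2 x hx

theorem maxStableOn_insert_iff_of_isolated (hv : v ∉ U) (hiso : ∀ x ∈ U, ¬ G.Adj v x)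
    (hS : S ⊆ insert v U) :
    MaxStableOn G (insert v U) S ↔ v ∈ S ∧ MaxStableOn G U (S.erase v) := by
  have hadj : ∀ x ∈ U, ∀ y, (y = v → ¬ G.Adj x y) := fun x hx y hy h' =>
    hiso x hx (hy ▸ h'.symm)
  have hmem : ∀ y ∈ S, y ≠ v → y ∈ U := fun y hy hyv =>
    (Finset.mem_insert.1 (hS hy)).resolve_left hyv
  have hne : ∀ x ∈ U, x ≠ v := fun x hx h' => hv (h' ▸ hx)
  constructor
  · intro h
    refine ⟨(h.2 v (by simp)).2 fun y hy => ?_, fun x hx => ?_, fun x hx => ?_⟩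
    · by_cases hyv : y = v
      · rw [hyv]; exact G.irrefl
      · exact hiso y (hmem y hy hyv)
    · exact hmem x (Finset.mem_of_mem_erase hx) (Finset.ne_of_mem_erase hx)
    · rw [Finset.mem_erase, and_iff_right (hne x hx), h.2 x (Finset.mem_insert_of_mem hx)]
      refine ⟨fun h' y hy => h' y (Finset.mem_of_mem_erase hy), fun h' y hy => ?_⟩
      by_cases hyv : y = v
      · exact hadj x hx y hyv
      · exact h' y (Finset.mem_erase.2 ⟨hyv, hy⟩)
  · rintro ⟨hvS, h⟩
    refine ⟨hS, fun x hx => ?_⟩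
    rcases Finset.mem_insert.1 hx with rfl | hx
    · refine ⟨fun _ y hy => ?_, fun _ => hvS⟩
      by_cases hyv : y = x
      · rw [hyv]; exact G.irrefl
      · exact hiso y (hmem y hy hyv)
    · have := h.2 x hx
      rw [Finset.mem_erase, and_iff_right (hne x hx)] at this
      rw [this]
      refine ⟨fun h' y hy => ?_, fun h' y hy => h' y (Finset.mem_of_mem_erase hy)⟩
      by_cases hyv : y = v
      · exact hadj x hx y hyv
      · exact h' y (Finset.mem_erase.2 ⟨hyv, hy⟩)

/-- A structure of the large graph restricts to the small one, as a set that avoids `v` is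
maximal stable in both graphs or in neither. Conversely, `v` gets the weight of its twins; a set that contains all of them exceeds the target. -/
theorem kEquistableOn_insert_of_trueTwin (hv : v ∉ U) (hTU : T ⊆ U)
    (htw : ∀ x ∈ T, TrueTwin G x v) (hk : 0 < k) (hcard : 2 * k * k < T.card) :
    KEquistableOn G (insert v U) k ↔ KEquistableOn G U k := by
  obtain ⟨u₀, hu₀⟩ : T.Nonempty := Finset.card_pos.1 (by omega)
  constructor
  · rintro ⟨w, t, h⟩
    refine ⟨w, t, h.target_pos, fun x hx => h.weight x (Finset.mem_insert_of_mem hx),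
      fun S hS => ?_⟩
    rw [← maxStableOn_insert_iff_of_trueTwin hv hS (hTU hu₀) (htw u₀ hu₀),
      h.max_iff S (hS.trans (Finset.subset_insert v U))]
  · rintro ⟨w, t, h⟩
    have hTT : ∀ x ∈ T, ∀ y ∈ T, TrueTwin G x y := fun x hx y hy z =>
      (htw x hx z).trans (htw y hy z).symm
    have ht : t ≤ 2 * k * k := h.target_le hTU hTT (by nlinarith)
    have hne : ∀ x ∈ U, x ≠ v := fun x hx h' => hv (h' ▸ hx)
    have hwU : ∀ x ∈ U, Function.update w v (w u₀) x = w x := fun x hx =>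
      Function.update_of_ne (hne x hx) _ _
    have hw0 := h.weight u₀ (hTU hu₀)
    have hweight : ∀ x ∈ insert v U, 0 < Function.update w v (w u₀) x ∧
        Function.update w v (w u₀) x ≤ k := by
      intro x hx
      rcases Finset.mem_insert.1 hx with rfl | hx
      · simpa using hw0
      · rw [hwU x hx]; exact h.weight x hx
    refine ⟨Function.update w v (w u₀), t, h.target_pos, hweight, fun S hS => ?_⟩
    have base : ∀ S ⊆ U, MaxStableOn G (insert v U) S ↔
        ∑ x ∈ S, Function.update w v (w u₀) x = t := by
      intro S hS
      rw [maxStableOn_insert_iff_of_trueTwin hv hS (hTU hu₀) (htw u₀ hu₀), h.max_iff S hS,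
        Finset.sum_congr rfl fun x hx => hwU x (hS hx)]
    by_cases hvS : v ∈ S
    · -- exchange `v` for a twin of it outside `S`
      have key : ∀ u ∈ T, u ∉ S → (MaxStableOn G (insert v U) S ↔
          ∑ x ∈ S, Function.update w v (w u₀) x = t) := by
        intro u hu huS
        have hs := sum_exchange (Function.update w v (w u₀)) huS hvS
        rw [hwU u (hTU hu), Function.update_self, h.weight_eq (hTT u hu u₀ hu₀) (hTU hu) (hTU hu₀)]
          at hs
        rw [← Nat.add_right_cancel hs, ← maxStableOn_exchange_iff (htw u hu).twin
          (Finset.mem_insert_of_mem (hTU hu)) (Finset.mem_insert_self v U) huS hvS]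
        refine base _ fun x hx => ?_
        rcases Finset.mem_insert.1 hx with rfl | hx
        · exact hTU hu
        · exact (Finset.mem_insert.1 (hS (Finset.mem_of_mem_erase hx))).resolve_left
            (Finset.ne_of_mem_erase hx)
      by_cases hTS : T ⊆ S
      · constructor
        · intro hM
          exact absurd (((htw u₀ hu₀ v).2 (Or.inr rfl)).resolve_right (hne u₀ (hTU hu₀)))
            (hM.not_adj (hTS hu₀) hvS)
        · intro hsum
          have h1 : S.card ≤ t := by
            rw [← hsum, Finset.card_eq_sum_ones]
            exact Finset.sum_le_sum fun x hx => (hweight x (hS hx)).1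
          have h2 := Finset.card_le_card hTS
          omega
      · obtain ⟨u, hu, huS⟩ := Finset.not_subset.1 hTS
        exact key u hu huS
    · exact base S fun x hx => (Finset.mem_insert.1 (hS hx)).resolve_left fun h' => hvS (h' ▸ hx)

/-- The vertex `v` lies in all maximal stable sets, so adding or removing it shifts the target by its
weight. If `v` is added with the weight `a` of many isolated vertices, then a set of the new target
weight that avoids `v` contains such a vertex `u`; without `u` it has the old target weight and is
a maximal stable set, but these contain `u`. -/
theorem kEquistableOn_insert_of_isolated (hv : v ∉ U) (hTU : T ⊆ U)
    (hT : ∀ x ∈ T, ∀ y ∈ U, ¬ G.Adj x y) (hiso : ∀ x ∈ U, ¬ G.Adj v x) (hk : 0 < k)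
    (hcard : k * (2 * k * k) < T.card) :
    KEquistableOn G (insert v U) k ↔ KEquistableOn G U k := by
  have hne : ∀ x ∈ U, x ≠ v := fun x hx h' => hv (h' ▸ hx)
  constructor
  · rintro ⟨w, t, h⟩
    obtain ⟨u₀, hu₀⟩ : T.Nonempty := Finset.card_pos.1 (by omega)
    have hvw := h.weight v (by simp)
    have htv : w v < t := by
      obtain ⟨M, hM, hsub⟩ := exists_maxStableOn (G := G) (U := insert v U) (S := {u₀, v})
        (by simp [Finset.insert_subset_iff, hTU hu₀])
        (by
          intro y hy z hz
          simp only [Finset.mem_insert, Finset.mem_singleton] at hy hz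
          rcases hy with rfl | rfl <;> rcases hz with rfl | rfl
          · exact G.irrefl
          · exact fun h' => hiso _ (hTU hu₀) h'.symm
          · exact hiso _ (hTU hu₀)
          · exact G.irrefl)
      have hMt := (h.max_iff M hM.1).1 hM
      have h1 : ∑ x ∈ {u₀, v}, w x ≤ ∑ x ∈ M, w x := Finset.sum_le_sum_of_subset hsub
      rw [Finset.sum_pair (hne u₀ (hTU hu₀)), hMt] at h1
      have := h.weight u₀ (Finset.mem_insert_of_mem (hTU hu₀))
      omega
    refine ⟨w, t - w v, by omega, fun x hx => h.weight x (Finset.mem_insert_of_mem hx),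
      fun S hS => ?_⟩
    have hvS : v ∉ S := fun h' => hv (hS h')
    have h1 := maxStableOn_insert_iff_of_isolated hv hiso (S := insert v S)
      (Finset.insert_subset_insert v hS)
    rw [Finset.erase_insert hvS, h.max_iff _ (Finset.insert_subset_insert v hS),
      Finset.sum_insert hvS] at h1
    have h2 : MaxStableOn G U S ↔ w v + ∑ x ∈ S, w x = t := by rw [h1]; simp
    rw [h2]
    omega
  · rintro ⟨w, t, h⟩
    obtain ⟨a, ha0, hak, ha⟩ := h.exists_popular (N := 2 * k * k) hTU hcard
    have hsub : T.filter (fun x => w x = a) ⊆ T := Finset.filter_subset _ T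
    have htot := h.sum_sdiff_le (hsub.trans hTU) (fun x hx => hT x (hsub hx)) ha0 hak
      (fun x hx => (Finset.mem_filter.1 hx).2) (by nlinarith)
    have hwU : ∀ x ∈ U, Function.update w v a x = w x := fun x hx =>
      Function.update_of_ne (hne x hx) _ _
    refine ⟨Function.update w v a, t + a, by omega, fun x hx => ?_, fun S hS => ?_⟩
    · rcases Finset.mem_insert.1 hx with rfl | hx
      · simp [ha0, hak]
      · rw [hwU x hx]; exact h.weight x hx
    rw [maxStableOn_insert_iff_of_isolated hv hiso hS]
    by_cases hvS : v ∈ S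
    · have hSU : S.erase v ⊆ U := fun x hx =>
        (Finset.mem_insert.1 (hS (Finset.mem_of_mem_erase hx))).resolve_left
          (Finset.ne_of_mem_erase hx)
      have hsum : ∑ x ∈ S.erase v, Function.update w v a x = ∑ x ∈ S.erase v, w x :=
        Finset.sum_congr rfl fun x hx => hwU x (hSU hx)
      rw [and_iff_right hvS, h.max_iff _ hSU, ← Finset.sum_erase_add S _ hvS, hsum,
        Function.update_self]
      omega
    · have hSU : S ⊆ U := fun x hx =>
        (Finset.mem_insert.1 (hS hx)).resolve_left fun h' => hvS (h' ▸ hx)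
      have hsum' : ∑ x ∈ S, Function.update w v a x = ∑ x ∈ S, w x :=
        Finset.sum_congr rfl fun x hx => hwU x (hSU hx)
      rw [hsum']
      refine ⟨fun h' => absurd h'.1 hvS, fun hsum => ?_⟩
      -- `S` misses too little weight to avoid the isolated vertices of weight `a`
      have hnot : ¬ T.filter (fun x => w x = a) ⊆ U \ S := by
        intro h'
        have h1 := Finset.card_le_card h'
        have h2 := h.card_le_sum (S := U \ S) Finset.sdiff_subset
        have h3 := Finset.sum_sdiff (f := w) hSU
        omega
      obtain ⟨u, hu, huS⟩ := Finset.not_subset.1 hnot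
      obtain ⟨huT, hua⟩ := Finset.mem_filter.1 hu
      have huS' : u ∈ S := by
        by_contra h'
        exact huS (Finset.mem_sdiff.2 ⟨hTU huT, h'⟩)
      have hM : MaxStableOn G U (S.erase u) := by
        rw [h.max_iff _ ((Finset.erase_subset u S).trans hSU)]
        have := Finset.sum_erase_add S w huS'
        omega
      have := (hM.2 u (hTU huT)).2 fun y hy => hT u huT y (hM.1 hy)
      exact absurd this (by simp)

theorem kEquistableOn_insert_of_falseTwin (hv : v ∉ U) (hTU : T ⊆ U)
    (htw : ∀ x ∈ T, FalseTwin G x v) (hk : 0 < k) (hcard : k * (2 * k * k) < T.card) :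
    KEquistableOn G (insert v U) k ↔ KEquistableOn G U k := by
  by_cases hiso : ∀ x ∈ U, ¬ G.Adj v x
  · exact kEquistableOn_insert_of_isolated hv hTU
      (fun x hx y hy h' => hiso y hy ((htw x hx y).1 h')) hiso hk hcard
  · push Not at hiso
    obtain ⟨x, hx, hvx⟩ := hiso
    obtain ⟨u, hu⟩ : T.Nonempty := Finset.card_pos.1 (by omega)
    have hTT : ∀ x ∈ T, ∀ y ∈ T, FalseTwin G x y := fun x hx y hy z =>
      (htw x hx z).trans (htw y hy z).symm
    have hlt : 2 * k * k < T.card := by nlinarith [Nat.mul_le_mul_right (2 * k * k) hk]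
    have hno : ∀ U' : Finset V, U ⊆ U' → ¬ KEquistableOn G U' k := by
      rintro U' hU' ⟨w, t, h⟩
      exact absurd (h.card_falseTwin_le (hTU.trans hU') hTT hu (hU' hx) ((htw u hu x).2 hvx))
        (not_le.2 hlt)
    exact iff_of_false (hno _ (Finset.subset_insert v U)) (hno _ subset_rfl)

/-! ### The vertices that the kernel keeps -/

/-- `K` contains at least `B` false twins or at least `B` true twins of each vertex of `U` that does
not belong to `K`. -/
def TwinDense (G : SimpleGraph V) (U K : Finset V) (B : ℕ) : Prop :=
  ∀ v ∈ U, v ∉ K → (∃ T ⊆ K, B ≤ T.card ∧ ∀ x ∈ T, FalseTwin G x v) ∨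
    ∃ T ⊆ K, B ≤ T.card ∧ ∀ x ∈ T, TrueTwin G x v

/-- Removing vertices that have many twins left does not affect equistability. -/
theorem kEquistableOn_iff_of_twinDense {K : Finset V} {B : ℕ} (hKU : K ⊆ U) (hk : 0 < k)
    (hB : k * (2 * k * k) < B) (hd : TwinDense G U K B) :
    KEquistableOn G U k ↔ KEquistableOn G K k := by
  have key : ∀ D : Finset V, D ⊆ U → Disjoint D K →
      (KEquistableOn G (D ∪ K) k ↔ KEquistableOn G K k) := by
    intro D
    induction D using Finset.induction_on with
    | empty => simp
    | insert v D hvD ih =>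
      intro hDU hDK
      rw [Finset.insert_union, ← ih ((Finset.subset_insert v D).trans hDU)
        (hDK.mono_left (Finset.subset_insert v D))]
      have hvK : v ∉ K := Finset.disjoint_left.1 hDK (Finset.mem_insert_self v D)
      have hv : v ∉ D ∪ K := by simp [hvD, hvK]
      rcases hd v (hDU (Finset.mem_insert_self v D)) hvK with ⟨T, hTK, hT, htw⟩ | ⟨T, hTK, hT, htw⟩
      · exact kEquistableOn_insert_of_falseTwin hv (hTK.trans Finset.subset_union_right) htw hk
          (by omega)
      · refine kEquistableOn_insert_of_trueTwin hv (hTK.trans Finset.subset_union_right) htw hk ?_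
        nlinarith [Nat.mul_le_mul_right (2 * k * k) hk]
  have := key (U \ K) Finset.sdiff_subset Finset.sdiff_disjoint
  rwa [Finset.sdiff_union_of_subset hKU] at this

open Classical in
/-- A `k`-equistable graph has at most `k` twin classes, hence few kept vertices. -/
theorem KEquistableOn.card_le {K : Finset V} {B : ℕ} (h : KEquistableOn G U k)
    (hU : ∀ x y, G.Adj x y → y ∈ U) (hKU : K ⊆ U)
    (hF : ∀ v ∈ K, (K.filter fun x => FalseTwin G x v).card ≤ B)
    (hT : ∀ v ∈ K, (K.filter fun x => TrueTwin G x v).card ≤ B) : K.card ≤ 2 * B * k := by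
  obtain ⟨w, t, h⟩ := h
  have h1 : (K.image w).card ≤ k := by
    calc (K.image w).card ≤ (Finset.Icc 1 k).card := Finset.card_le_card (by
          intro a ha
          obtain ⟨x, hx, rfl⟩ := Finset.mem_image.1 ha
          exact Finset.mem_Icc.2 (h.weight x (hKU hx)))
      _ = k := by simp
  refine (Finset.card_le_mul_card_image K (2 * B) fun a ha => ?_).trans
    (Nat.mul_le_mul_left (2 * B) h1)
  obtain ⟨v, hv, rfl⟩ := Finset.mem_image.1 ha
  have hsub : K.filter (fun x => w x = w v) ⊆
      K.filter (fun x => FalseTwin G x v) ∪ K.filter (fun x => TrueTwin G x v) := by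
    intro x hx
    obtain ⟨hxK, hxw⟩ := Finset.mem_filter.1 hx
    rcases twin_iff.1 (h.twin hU (hKU hxK) (hKU hv) hxw) with h' | h'
    · exact Finset.mem_union_left _ (Finset.mem_filter.2 ⟨hxK, h'⟩)
    · exact Finset.mem_union_right _ (Finset.mem_filter.2 ⟨hxK, h'⟩)
  have h2 := (Finset.card_le_card hsub).trans (Finset.card_union_le _ _)
  have h3 := hF v hv
  have h4 := hT v hv
  omega

end Graph

/-! ### Weight functions and vertex sets in normal form -/

/-- The least `i < k` with `c i`, increased by one; `0` if there is none. -/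
def firstIndex (c : ℕ → Prop) [DecidablePred c] : ℕ → ℕ
  | 0 => 0
  | k + 1 => if firstIndex c k = 0 ∧ c k then k + 1 else firstIndex c k

theorem firstIndex_le (c : ℕ → Prop) [DecidablePred c] (k : ℕ) : firstIndex c k ≤ k := by
  induction k with
  | zero => simp [firstIndex]
  | succ k ih => rw [firstIndex]; split_ifs <;> omega

theorem firstIndex_eq_zero_iff (c : ℕ → Prop) [DecidablePred c] (k : ℕ) :
    firstIndex c k = 0 ↔ ∀ i < k, ¬ c i := by
  induction k with
  | zero => simp [firstIndex]
  | succ k ih =>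
    rw [firstIndex, Nat.forall_lt_succ_right, ← ih]
    split_ifs with h
    · simp [h.2]
    · simp only [iff_self_and]
      exact fun h0 hc => h ⟨h0, hc⟩

theorem firstIndex_eq_succ_iff (c : ℕ → Prop) [DecidablePred c] (k j : ℕ) :
    firstIndex c k = j + 1 ↔ j < k ∧ c j ∧ ∀ i < j, ¬ c i := by
  induction k with
  | zero => simp [firstIndex]
  | succ k ih =>
    rw [firstIndex]
    split_ifs with h
    · have h0 := (firstIndex_eq_zero_iff c k).1 h.1
      constructor
      · intro hk
        obtain rfl : k = j := by omega
        exact ⟨Nat.lt_succ_self k, h.2, h0⟩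
      · rintro ⟨hj, hc, -⟩
        have : ¬ j < k := fun h' => h0 j h' hc
        omega
    · rw [ih]
      constructor
      · rintro ⟨hj, h'⟩
        exact ⟨by omega, h'⟩
      · rintro ⟨hj, hc, hlt⟩
        refine ⟨?_, hc, hlt⟩
        by_contra hjk
        obtain rfl : j = k := by omega
        exact h ⟨(firstIndex_eq_zero_iff c j).2 hlt, hc⟩

/-- The `i`-th digit of `m` in base `b`. -/
def digit (b m i : ℕ) : ℕ := m / b ^ i % b

theorem exists_digit_eq (b k : ℕ) (H : ℕ → ℕ) (hH : ∀ i < k, H i < b) :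
    ∃ m < b ^ k, ∀ i < k, digit b m i = H i := by
  let f : Fin k → Fin b := fun i => ⟨H i, hH i i.2⟩
  refine ⟨finFunctionFinEquiv f, (finFunctionFinEquiv f).2, fun i hi => ?_⟩
  have h1 := congrArg (fun g => (g ⟨i, hi⟩ : Fin b).val)
    (finFunctionFinEquiv.symm_apply_apply f)
  exact h1

open Classical in
/-- The weight function that is described by `H`: if `H i` is positive, then `H i - 1` is the last
vertex of weight `i + 1`, and the weights are nondecreasing on each twin class. A vertex has weight
`0` if `H` assigns no weight to it. -/
noncomputable def weightOf (G : SimpleGraph ℕ) (k : ℕ) (H : ℕ → ℕ) (v : ℕ) : ℕ :=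
  firstIndex (fun i => v < H i ∧ Twin G (H i - 1) v) k

/-- The set that consists, for each `i`, of the vertices of weight `i + 1` below `d i`. -/
def cutSet (n : ℕ) (w d : ℕ → ℕ) : Finset ℕ :=
  (Finset.range n).filter fun v => v < d (w v - 1)

theorem weightOf_congr {G : SimpleGraph ℕ} {k : ℕ} {H H' : ℕ → ℕ} (h : ∀ i < k, H i = H' i) :
    weightOf G k H = weightOf G k H' := by
  classical
  funext v
  unfold weightOf
  induction k with
  | zero => rfl
  | succ k ih =>
    rw [firstIndex, firstIndex, ih fun i hi => h i (by omega), h k (by omega)]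

theorem twin_of_weightOf_eq {G : SimpleGraph ℕ} {k : ℕ} {H : ℕ → ℕ} {u v : ℕ}
    (hu : 0 < weightOf G k H u) (huv : weightOf G k H u = weightOf G k H v) : Twin G u v := by
  classical
  obtain ⟨j, hj⟩ : ∃ j, weightOf G k H u = j + 1 := ⟨_, (Nat.succ_pred_eq_of_pos hu).symm⟩
  have h1 := ((firstIndex_eq_succ_iff _ _ _).1 hj).2.1.2
  have h2 := ((firstIndex_eq_succ_iff _ _ _).1 (huv ▸ hj : weightOf G k H v = j + 1)).2.1.2
  exact h1.symm.trans h2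

theorem Twin.adj_swap_iff {V : Type*} [DecidableEq V] {G : SimpleGraph V} {u v : V}
    (h : Twin G u v) (x y : V) :
    G.Adj (Equiv.swap u v x) (Equiv.swap u v y) ↔ G.Adj x y := by
  have key : ∀ x y, G.Adj x y → G.Adj (Equiv.swap u v x) (Equiv.swap u v y) := by
    intro x y hxy
    have hne := hxy.ne
    rw [Equiv.swap_apply_def, Equiv.swap_apply_def]
    by_cases hxu : x = u <;> by_cases hxv : x = v <;> by_cases hyu : y = u <;>
      by_cases hyv : y = v <;> simp_all
    · exact hxy.symm
    · exact (h y hyu hyv).1 hxy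
    · exact hxy.symm
    · exact (h y hyu hyv).2 hxy
    · exact ((h x hxu hxv).1 hxy.symm).symm
    · exact ((h x hxu hxv).2 hxy.symm).symm
  refine ⟨fun h' => ?_, key x y⟩
  simpa using key _ _ h'

theorem Twin.maxStableOn_map_swap_iff {V : Type*} [DecidableEq V] {G : SimpleGraph V}
    {U S : Finset V} {u v : V} (h : Twin G u v) (hu : u ∈ U) (hv : v ∈ U) :
    MaxStableOn G U (S.map (Equiv.swap u v).toEmbedding) ↔ MaxStableOn G U S := by
  have hU : ∀ x ∈ U, Equiv.swap u v x ∈ U := by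
    intro x hx
    rw [Equiv.swap_apply_def]
    split_ifs <;> assumption
  have key : ∀ S : Finset V, MaxStableOn G U S →
      MaxStableOn G U (S.map (Equiv.swap u v).toEmbedding) := by
    intro S hS
    refine ⟨fun x hx => ?_, fun x hx => ?_⟩
    · obtain ⟨y, hy, rfl⟩ := Finset.mem_map.1 hx
      exact hU y (hS.1 hy)
    · have := hS.2 _ (hU x hx)
      rw [Finset.mem_map_equiv, Equiv.symm_swap, this]
      simp only [Finset.mem_map, Equiv.coe_toEmbedding, forall_exists_index, and_imp,
        forall_apply_eq_imp_iff₂]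
      refine forall₂_congr fun y _ => ?_
      rw [← h.adj_swap_iff x, Equiv.swap_apply_self]
  refine ⟨fun h' => ?_, key S⟩
  have := key _ h'
  rw [Finset.map_map] at this
  convert this
  ext x
  simp

section

variable {G : SimpleGraph ℕ} {n k t : ℕ} {w : ℕ → ℕ}

/-- Exchanging the weights of two twins gives an equistable structure again. -/
theorem IsStructureOn.swap {U : Finset ℕ} {u v : ℕ} (h : IsStructureOn G U k w t)
    (htw : Twin G u v) (hu : u ∈ U) (hv : v ∈ U) :
    IsStructureOn G U k (fun x => w (Equiv.swap u v x)) t := by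
  have hU : ∀ x ∈ U, Equiv.swap u v x ∈ U := by
    intro x hx
    rw [Equiv.swap_apply_def]
    split_ifs <;> assumption
  refine ⟨h.target_pos, fun x hx => h.weight _ (hU x hx), fun S hS => ?_⟩
  rw [← htw.maxStableOn_map_swap_iff hu hv, h.max_iff, Finset.sum_map]
  · rfl
  · intro x hx
    obtain ⟨y, hy, rfl⟩ := Finset.mem_map.1 hx
    exact hU y (hS hy)

/-- There is an equistable structure whose weights are nondecreasing on each twin class: one in
which the large weights sit as far back as possible. -/
theorem KEquistableOn.exists_sorted (h : KEquistableOn G (Finset.range n) k) :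
    ∃ w t, IsStructureOn G (Finset.range n) k w t ∧
      ∀ u v, u < v → v < n → Twin G u v → w u ≤ w v := by
  let pot : (ℕ → ℕ) × ℕ → ℕ := fun p => ∑ x ∈ Finset.range n, p.1 x * (n - x)
  obtain ⟨w₀, t₀, h₀⟩ := h
  obtain ⟨⟨w, t⟩, hw, hmin⟩ := (InvImage.wf pot Nat.lt_wfRel.wf).has_min
    {p : (ℕ → ℕ) × ℕ | IsStructureOn G (Finset.range n) k p.1 p.2} ⟨(w₀, t₀), h₀⟩
  refine ⟨w, t, hw, fun u v huv hvn htw => ?_⟩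
  by_contra hlt
  have hu : u ∈ Finset.range n := Finset.mem_range.2 (huv.trans hvn)
  have hv : v ∈ Finset.range n := Finset.mem_range.2 hvn
  refine hmin (fun x => w (Equiv.swap u v x), t) (IsStructureOn.swap hw htw hu hv) ?_
  change pot _ < pot _
  simp only [pot]
  have hv' : v ∈ (Finset.range n).erase u := Finset.mem_erase.2 ⟨huv.ne', hv⟩
  rw [← Finset.add_sum_erase _ _ hu, ← Finset.add_sum_erase _ _ hv',
    ← Finset.add_sum_erase (Finset.range n) (fun x => w x * (n - x)) hu,
    ← Finset.add_sum_erase _ (fun x => w x * (n - x)) hv']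
  have hrest : ∑ x ∈ ((Finset.range n).erase u).erase v, w (Equiv.swap u v x) * (n - x) =
      ∑ x ∈ ((Finset.range n).erase u).erase v, w x * (n - x) := by
    refine Finset.sum_congr rfl fun x hx => ?_
    simp only [Finset.mem_erase] at hx
    rw [Equiv.swap_apply_of_ne_of_ne hx.2.1 hx.1]
  rw [hrest, Equiv.swap_apply_left, Equiv.swap_apply_right]
  obtain ⟨a, ha⟩ : ∃ a, n - u = (n - v) + a + 1 := ⟨v - u - 1, by omega⟩
  rw [ha]
  push Not at hlt
  nlinarith [Nat.mul_lt_mul_of_pos_right hlt (Nat.succ_pos a)]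

/-- Every vertex set has a counterpart in normal form, provided that vertices of equal weight are
twins: replace vertices of the set by smaller ones of equal weight as long as possible. -/
theorem exists_cutSet (hpos : ∀ v < n, 0 < w v)
    (htw : ∀ u < n, ∀ v < n, w u = w v → Twin G u v) {S : Finset ℕ} (hS : S ⊆ Finset.range n) :
    ∃ d : ℕ → ℕ, (∀ i, d i ≤ n) ∧
      (MaxStableOn G (Finset.range n) (cutSet n w d) ↔ MaxStableOn G (Finset.range n) S) ∧
      ∑ x ∈ cutSet n w d, w x = ∑ x ∈ S, w x := by
  let pot : Finset ℕ → ℕ := fun M => ∑ x ∈ M, x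
  obtain ⟨M, ⟨hMU, hMS, hMw⟩, hmin⟩ := (InvImage.wf pot Nat.lt_wfRel.wf).has_min
    {M : Finset ℕ | M ⊆ Finset.range n ∧
      (MaxStableOn G (Finset.range n) M ↔ MaxStableOn G (Finset.range n) S) ∧
      ∑ x ∈ M, w x = ∑ x ∈ S, w x} ⟨S, hS, Iff.rfl, rfl⟩
  have hdown : ∀ u v, u < v → v ∈ M → w u = w v → u ∈ M := by
    intro u v huv hvM huvw
    by_contra huM
    have hv := Finset.mem_range.1 (hMU hvM)
    have hu : u ∈ Finset.range n := Finset.mem_range.2 (huv.trans hv)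
    have hs := sum_exchange w huM hvM
    rw [huvw] at hs
    refine hmin (insert u (M.erase v))
      ⟨Finset.insert_subset hu ((Finset.erase_subset v M).trans hMU), ?_, ?_⟩ ?_
    · rw [maxStableOn_exchange_iff (htw u (huv.trans hv) v hv huvw) hu (hMU hvM) huM hvM, hMS]
    · omega
    · change pot _ < pot _
      have := sum_exchange (fun x => x) huM hvM
      simp only [pot]
      omega
  let d : ℕ → ℕ := fun i => (M.filter fun x => w x = i + 1).sup (· + 1)
  have hd : ∀ i, d i ≤ n := fun i => Finset.sup_le fun x hx => by
    have := Finset.mem_range.1 (hMU (Finset.mem_filter.1 hx).1)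
    omega
  have hcut : cutSet n w d = M := by
    ext v
    simp only [cutSet, Finset.mem_filter, Finset.mem_range, d, Finset.lt_sup_iff]
    constructor
    · rintro ⟨hv, x, ⟨hxM, hx⟩, hvx⟩
      have := hpos v hv
      rcases Nat.lt_succ_iff_lt_or_eq.1 hvx with hlt | rfl
      · exact hdown v x hlt hxM (by omega)
      · exact hxM
    · intro hvM
      have hv := Finset.mem_range.1 (hMU hvM)
      have := hpos v hv
      exact ⟨hv, v, ⟨hvM, by omega⟩, by omega⟩
  exact ⟨d, hd, by rw [hcut, hMS], by rw [hcut, hMw]⟩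

/-- It suffices to search for weight functions and to test vertex sets in normal form. -/
theorem kEquistableOn_range_iff (hG : ∀ x y, G.Adj x y → y < n) (hk : 0 < k) :
    KEquistableOn G (Finset.range n) k ↔
      ∃ m < (n + 1) ^ k, ∃ t, 0 < t ∧ t ≤ k * n ∧
        (∀ v < n, 0 < weightOf G k (digit (n + 1) m) v) ∧
        ∀ m' < (n + 1) ^ k,
          (MaxStableOn G (Finset.range n)
              (cutSet n (weightOf G k (digit (n + 1) m)) (digit (n + 1) m')) ↔
            ∑ x ∈ cutSet n (weightOf G k (digit (n + 1) m)) (digit (n + 1) m'),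
              weightOf G k (digit (n + 1) m) x = t) := by
  classical
  constructor
  · intro h
    obtain ⟨w, t, hw, hsort⟩ := h.exists_sorted
    have hU : ∀ x y, G.Adj x y → y ∈ Finset.range n := fun x y hxy =>
      Finset.mem_range.2 (hG x y hxy)
    let H : ℕ → ℕ := fun i => ((Finset.range n).filter fun x => w x = i + 1).sup (· + 1)
    have hH : ∀ i, H i < n + 1 := fun i => Nat.lt_succ_of_le <| Finset.sup_le fun x hx => by
      have := Finset.mem_range.1 (Finset.mem_filter.1 hx).1
      omega
    have hlast : ∀ i, 0 < H i → H i - 1 < n ∧ w (H i - 1) = i + 1 := by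
      intro i hi
      have hne : ((Finset.range n).filter fun x => w x = i + 1).Nonempty := by
        rw [Finset.nonempty_iff_ne_empty]
        rintro h0
        simp [H, h0] at hi
      obtain ⟨x, hx, hxH⟩ := Finset.exists_mem_eq_sup _ hne (· + 1)
      have h1 : H i - 1 = x := by
        change Finset.sup _ _ - 1 = x
        rw [hxH]; rfl
      rw [h1]
      simpa using hx
    have hweight : ∀ v < n, weightOf G k H v = w v := by
      intro v hv
      have hwv := hw.weight v (Finset.mem_range.2 hv)
      obtain ⟨j, hj⟩ : ∃ j, w v = j + 1 := ⟨_, (Nat.succ_pred_eq_of_pos hwv.1).symm⟩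
      have hvH : v < H j := by
        refine Finset.lt_sup_iff.2 ⟨v, ?_, Nat.lt_succ_self v⟩
        simp [hv, hj]
      rw [hj]
      refine (firstIndex_eq_succ_iff _ _ _).2 ⟨by omega, ⟨hvH, ?_⟩, ?_⟩
      · obtain ⟨h1, h2⟩ := hlast j (by omega)
        exact hw.twin hU (Finset.mem_range.2 h1) (Finset.mem_range.2 hv) (by omega)
      · rintro i hij ⟨hvi, htw⟩
        obtain ⟨h1, h2⟩ := hlast i (by omega)
        rcases Nat.eq_or_lt_of_le (Nat.le_sub_one_of_lt hvi) with heq | hlt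
        · rw [← heq] at h2; omega
        · have := hsort _ _ hlt h1 htw.symm
          omega
    obtain ⟨m, hm, hmH⟩ := exists_digit_eq (n + 1) k H fun i _ => hH i
    rw [← weightOf_congr hmH] at hweight
    refine ⟨m, hm, t, hw.target_pos, ?_, fun v hv => ?_, fun m' _ => ?_⟩
    · obtain ⟨M, hM, -⟩ := exists_maxStableOn (G := G) (U := Finset.range n) (S := ∅)
        (by simp) (by simp)
      rw [← (hw.max_iff M hM.1).1 hM, mul_comm]
      refine (hw.sum_le hM.1).trans (Nat.mul_le_mul_right k ?_)
      simpa using Finset.card_le_card hM.1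
    · rw [hweight v hv]
      exact (hw.weight v (Finset.mem_range.2 hv)).1
    · have hsub : cutSet n (weightOf G k (digit (n + 1) m)) (digit (n + 1) m') ⊆
          Finset.range n := Finset.filter_subset _ _
      rw [hw.max_iff _ hsub, Finset.sum_congr rfl fun x hx =>
        (hweight x (Finset.mem_range.1 (hsub hx))).symm]
  · rintro ⟨m, -, t, ht, -, hpos, hall⟩
    set w := weightOf G k (digit (n + 1) m) with hwdef
    have hwk : ∀ v, w v ≤ k := fun v => firstIndex_le _ _
    refine ⟨w, t, ht, fun v hv => ⟨hpos v (Finset.mem_range.1 hv), hwk v⟩, fun S hS => ?_⟩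
    obtain ⟨d, hd, hdM, hdw⟩ := exists_cutSet (w := w) hpos
      (fun u hu v hv huv => twin_of_weightOf_eq (hpos u hu) huv) hS
    obtain ⟨m', hm', hmd⟩ := exists_digit_eq (n + 1) k d fun i _ => Nat.lt_succ_of_le (hd i)
    have hcut : cutSet n w d = cutSet n w (digit (n + 1) m') := by
      refine Finset.filter_congr fun v _ => ?_
      have := hwk v
      rw [hmd _ (by omega)]
    rw [← hdM, ← hdw, hcut]
    exact hall m' hm'

end

/-! ### Reasoning about programs -/

/-- The program may assign to the register `r`. -/
def Prog.modReg : Prog → ℕ → Bool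
  | .nop, _ => false
  | .assign r _, r' => r == r'
  | .write _ _ _, _ => false
  | .seq p q, r => p.modReg r || q.modReg r
  | .branch _ p q, r => p.modReg r || q.modReg r
  | .loop _ p, r => p.modReg r

/-- The program may write to the array `a`. -/
def Prog.modArr : Prog → ℕ → Bool
  | .nop, _ => false
  | .assign _ _, _ => false
  | .write a _ _, a' => a == a'
  | .seq p q, a => p.modArr a || q.modArr a
  | .branch _ p q, a => p.modArr a || q.modArr a
  | .loop _ p, a => p.modArr a

/-- `s` and `s'` agree on all registers and arrays that the program `p` does not modify. -/
structure Frame (p : Prog) (s s' : Store) : Prop where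
  reg : ∀ r, p.modReg r = false → s'.reg r = s.reg r
  arr : ∀ a, p.modArr a = false → s'.arr a = s.arr a

theorem Frame.refl (p : Prog) (s : Store) : Frame p s s := ⟨fun _ _ => rfl, fun _ _ => rfl⟩

theorem Frame.trans {p : Prog} {s s₁ s₂ : Store} (h : Frame p s s₁) (h' : Frame p s₁ s₂) :
    Frame p s s₂ :=
  ⟨fun r hr => (h'.reg r hr).trans (h.reg r hr), fun a ha => (h'.arr a ha).trans (h.arr a ha)⟩

theorem Frame.mono {p q : Prog} {s s' : Store} (h : Frame p s s')
    (hr : ∀ r, q.modReg r = false → p.modReg r = false)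
    (ha : ∀ a, q.modArr a = false → p.modArr a = false) : Frame q s s' :=
  ⟨fun r h' => h.reg r (hr r h'), fun a h' => h.arr a (ha a h')⟩

@[simp] theorem Store.setReg_reg (s : Store) (r x r' : ℕ) :
    (s.setReg r x).reg r' = if r' = r then x else s.reg r' := by
  simp [Store.setReg, Function.update_apply]

@[simp] theorem Store.setReg_arr (s : Store) (r x : ℕ) : (s.setReg r x).arr = s.arr := rfl

@[simp] theorem Store.setArr_reg (s : Store) (a i x : ℕ) : (s.setArr a i x).reg = s.reg := rfl

theorem Store.setArr_arr (s : Store) (a i x a' : ℕ) :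
    (s.setArr a i x).arr a' = if a' = a then Function.update (s.arr a) i x else s.arr a' := by
  simp only [Store.setArr, Function.update_apply]

@[simp] theorem Store.setArr_cell (s : Store) (a i x a' j : ℕ) :
    (s.setArr a i x).arr a' j = if a' = a ∧ j = i then x else s.arr a' j := by
  rw [Store.setArr_arr]
  split_ifs <;> simp_all

theorem Exec.frame {W : ℕ} {p : Prog} {s s' : Store} {t : ℕ} (h : Exec W p s t s') :
    Frame p s s' := by
  induction h with
  | nop s => exact Frame.refl _ _
  | assign s r e _ =>
    refine ⟨fun r' hr => ?_, fun _ _ => rfl⟩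
    simp only [Prog.modReg, beq_eq_false_iff_ne, ne_eq] at hr
    simp [Ne.symm hr]
  | write s a i e _ _ =>
    refine ⟨fun _ _ => rfl, fun a' ha => ?_⟩
    simp only [Prog.modArr, beq_eq_false_iff_ne, ne_eq] at ha
    rw [Store.setArr_arr, if_neg (Ne.symm ha)]
  | seq _ _ ih₁ ih₂ =>
    exact (ih₁.mono (by simp +contextual [Prog.modReg]) (by simp +contextual [Prog.modArr])).trans
      (ih₂.mono (by simp +contextual [Prog.modReg]) (by simp +contextual [Prog.modArr]))
  | branch_true _ _ _ ih =>
    exact ih.mono (by simp +contextual [Prog.modReg]) (by simp +contextual [Prog.modArr])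
  | branch_false _ _ _ ih =>
    exact ih.mono (by simp +contextual [Prog.modReg]) (by simp +contextual [Prog.modArr])
  | loop_stop _ _ => exact Frame.refl _ _
  | loop_step _ _ _ _ ih₁ ih₂ =>
    exact (ih₁.mono (by simp [Prog.modReg]) (by simp [Prog.modArr])).trans ih₂

/-- With word bound `W`, the program `p` started in `s` halts within `T` steps, in a store with the
property `Q`. -/
def Runs (W : ℕ) (p : Prog) (s : Store) (T : ℕ) (Q : Store → Prop) : Prop :=
  ∃ t s', Exec W p s t s' ∧ t ≤ T ∧ Q s'

section

variable {W T T₁ T₂ : ℕ} {p q : Prog} {s : Store} {Q R : Store → Prop}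

theorem Runs.mono (h : Runs W p s T₁ R) (hT : T₁ ≤ T)
    (hQ : ∀ s', Frame p s s' → R s' → Q s') : Runs W p s T Q := by
  obtain ⟨t, s', he, ht, hr⟩ := h
  exact ⟨t, s', he, ht.trans hT, hQ s' he.frame hr⟩

theorem Runs.seq (hp : Runs W p s T₁ R)
    (hq : ∀ s', Frame p s s' → R s' → Runs W q s' T₂ Q) (hT : T₁ + T₂ ≤ T) :
    Runs W (.seq p q) s T Q := by
  obtain ⟨t₁, s₁, he₁, ht₁, hr⟩ := hp
  obtain ⟨t₂, s₂, he₂, ht₂, hQ⟩ := hq s₁ he₁.frame hr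
  exact ⟨_, s₂, .seq he₁ he₂, by omega, hQ⟩

theorem Runs.branch {e : Expr} (he : e.Fits W s)
    (hp : e.eval s ≠ 0 → Runs W p s T₁ Q) (hq : e.eval s = 0 → Runs W q s T₁ Q)
    (hT : e.cost + 1 + T₁ ≤ T) : Runs W (.branch e p q) s T Q := by
  by_cases h : e.eval s = 0
  · obtain ⟨t, s', hx, ht, hQ⟩ := hq h
    exact ⟨_, s', .branch_false he h hx, by omega, hQ⟩
  · obtain ⟨t, s', hx, ht, hQ⟩ := hp h
    exact ⟨_, s', .branch_true he h hx, by omega, hQ⟩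

/-- The weakest precondition of a program without loops. -/
def Prog.wp (W : ℕ) : Prog → (Store → Prop) → Store → Prop
  | .nop, Q, s => Q s
  | .assign r e, Q, s => e.Fits W s ∧ Q (s.setReg r (e.eval s))
  | .write a i e, Q, s => (i.Fits W s ∧ e.Fits W s) ∧ Q (s.setArr a (i.eval s) (e.eval s))
  | .seq p q, Q, s => p.wp W (q.wp W Q) s
  | .branch e p q, Q, s =>
      e.Fits W s ∧ (e.eval s ≠ 0 → p.wp W Q s) ∧ (e.eval s = 0 → q.wp W Q s)
  | .loop _ _, _, _ => False

/-- A bound on the running time of a program without loops. -/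
def Prog.size : Prog → ℕ
  | .nop => 1
  | .assign _ e => e.cost + 1
  | .write _ i e => i.cost + e.cost + 1
  | .seq p q => p.size + q.size
  | .branch e p q => e.cost + 1 + (p.size + q.size)
  | .loop _ _ => 0

theorem Runs.of_wp (h : p.wp W Q s) : Runs W p s p.size Q := by
  induction p generalizing s Q with
  | nop => exact ⟨1, s, .nop s, le_rfl, h⟩
  | assign r e => exact ⟨_, _, .assign s r e h.1, le_rfl, h.2⟩
  | write a i e => exact ⟨_, _, .write s a i e h.1.1 h.1.2, le_rfl, h.2⟩
  | seq p q ihp ihq => exact Runs.seq (ihp h) (fun s' _ hs => ihq hs) le_rfl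
  | branch e p q ihp ihq =>
    exact Runs.branch (T₁ := p.size + q.size) h.1
      (fun h' => (ihp (h.2.1 h')).mono (Nat.le_add_right _ _) fun _ _ hs => hs)
      (fun h' => (ihq (h.2.2 h')).mono (Nat.le_add_left _ _) fun _ _ hs => hs) le_rfl
  | loop e p => exact h.elim

/-- A block without loops followed by another program. -/
theorem Runs.wp_seq (h : p.wp W (fun s' => Frame p s s' → Runs W q s' T₂ Q) s)
    (hT : p.size + T₂ ≤ T) : Runs W (.seq p q) s T Q :=
  Runs.seq (Runs.of_wp h) (fun _ hf h' => h' hf) hT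

/-- Loops with an invariant `I` that is indexed by the number `i` of iterations. -/
theorem Runs.loop {e : Expr} (I : ℕ → Store → Prop) (N : ℕ) (c : ℕ → ℕ) (h0 : I 0 s)
    (hstep : ∀ i < N, ∀ s', Frame p s s' → I i s' →
      e.Fits W s' ∧ e.eval s' ≠ 0 ∧ Runs W p s' (c i) (I (i + 1)))
    (hend : ∀ s', Frame p s s' → I N s' → e.Fits W s' ∧ e.eval s' = 0)
    (hT : ∑ i ∈ Finset.range N, (c i + (e.cost + 1)) + (e.cost + 1) ≤ T) :
    Runs W (.loop e p) s T (I N) := by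
  have key : ∀ d i, i + d = N → ∀ s', Frame p s s' → I i s' →
      Runs W (.loop e p) s'
        (∑ j ∈ Finset.Ico i N, (c j + (e.cost + 1)) + (e.cost + 1)) (I N) := by
    intro d
    induction d with
    | zero =>
      intro i hi s' hf hI
      obtain rfl : i = N := hi
      obtain ⟨hfit, hev⟩ := hend s' hf hI
      exact ⟨_, s', Exec.loop_stop hfit hev, by simp, hI⟩
    | succ d ih =>
      intro i hi s' hf hI
      obtain ⟨hfit, hev, t₁, s₁, he₁, ht₁, hI₁⟩ := hstep i (by omega) s' hf hI
      obtain ⟨t₂, s₂, he₂, ht₂, hI₂⟩ := ih (i + 1) (by omega) s₁ (hf.trans he₁.frame) hI₁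
      refine ⟨_, s₂, .loop_step hfit hev he₁ he₂, ?_, hI₂⟩
      rw [Finset.sum_eq_sum_Ico_succ_bot (by omega)]
      omega
  obtain ⟨t, s', he, ht, hI⟩ := key N 0 (by omega) s (Frame.refl _ _) h0
  rw [← Finset.range_eq_Ico] at ht
  exact ⟨t, s', he, ht.trans hT, hI⟩

/-- Repeat `p` while the register `r`, which is incremented after each round, is below `e`. -/
def Prog.upTo (r : ℕ) (e : Expr) (p : Prog) : Prog :=
  .loop (.bin .lt (.reg r) e) (.seq p (.assign r (.bin .add (.reg r) (.const 1))))

/-- The body of `upTo` must not assign to the counter `r`; the invariant `I` is indexed by its value.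
The rule allows different costs `c i` for the rounds, which nested loops over adjacency lists need. -/
theorem Runs.upTo {r : ℕ} {e : Expr} (I : ℕ → Store → Prop) (lo hi : ℕ) (c : ℕ → ℕ)
    (hle : lo ≤ hi) (hr : s.reg r = lo) (h0 : I lo s) (hp : p.modReg r = false)
    (hW : hi + 1 ≤ W)
    (he : ∀ i s', Frame (.upTo r e p) s s' → I i s' → e.Fits W s' ∧ e.eval s' = hi)
    (hstep : ∀ i, lo ≤ i → i < hi → ∀ s', Frame (.upTo r e p) s s' → s'.reg r = i → I i s' →
      Runs W p s' (c i) (fun s'' => s''.reg r = i → I (i + 1) (s''.setReg r (i + 1))))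
    (hT : ∑ i ∈ Finset.Ico lo hi, (c i + (e.cost + 7)) + (e.cost + 3) ≤ T) :
    Runs W (.upTo r e p) s T (fun s' => s'.reg r = hi ∧ I hi s') := by
  have hco : (Expr.bin .lt (.reg r) e).cost + 1 = e.cost + 3 := by simp [Expr.cost]; omega
  refine (Runs.loop (T := T) (fun i s' => s'.reg r = lo + i ∧ I (lo + i) s') (hi - lo)
    (fun i => c (lo + i) + 4) ⟨by simpa using hr, by simpa using h0⟩ ?_ ?_ ?_).mono le_rfl ?_
  · rintro i hilt s' hf ⟨hri, hI⟩
    replace hf := hf.mono (q := .upTo r e p) (fun _ h => h) (fun _ h => h)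
    obtain ⟨hfit, hev⟩ := he _ s' hf hI
    refine ⟨?_, ?_, ?_⟩
    · simp only [Expr.Fits, Expr.eval, hri, hev, Op.eval]
      refine ⟨by omega, hfit, ?_⟩
      split_ifs <;> omega
    · simp only [Expr.eval, hri, hev, Op.eval]
      rw [if_pos (by omega)]
      exact one_ne_zero
    · refine Runs.seq (hstep (lo + i) (by omega) (by omega) s' hf hri hI)
        (T₂ := 4) (fun s₁ hf₁ h₁ => ?_) le_rfl
      have hr₁ : s₁.reg r = lo + i := (hf₁.reg r hp).trans hri
      refine (Runs.of_wp ?_).mono (R := fun s' => s'.reg r = lo + (i + 1) ∧ I (lo + (i + 1)) s')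
        (by simp [Prog.size, Expr.cost]) fun _ _ h => h
      simp only [Prog.wp, Expr.Fits, Expr.eval, hr₁, Op.eval]
      refine ⟨by omega, ?_, ?_⟩
      · simp [add_assoc]
      · rw [add_assoc] at h₁
        exact h₁ hr₁
  · rintro s' hf ⟨hri, hI⟩
    replace hf := hf.mono (q := .upTo r e p) (fun _ h => h) (fun _ h => h)
    obtain ⟨hfit, hev⟩ := he _ s' hf hI
    constructor
    · simp only [Expr.Fits, Expr.eval, hri, hev, Op.eval]
      refine ⟨by omega, hfit, ?_⟩
      split_ifs <;> omega
    · simp only [Expr.eval, hri, hev, Op.eval]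
      rw [if_neg (by omega)]
  · rw [hco]
    refine le_trans (Nat.add_le_add_right (le_of_eq ?_) _) hT
    rw [Finset.sum_Ico_eq_sum_range]
    exact Finset.sum_congr rfl fun i _ => by ring
  · rintro s' - ⟨h1, h2⟩
    rw [show lo + (hi - lo) = hi by omega] at h1 h2
    exact ⟨h1, h2⟩

/-- The case of `Runs.upTo` in which every round takes the same time. -/
theorem Runs.upTo_const {r : ℕ} {e : Expr} (I : ℕ → Store → Prop) (lo hi : ℕ) (c : ℕ)
    (hle : lo ≤ hi) (hr : s.reg r = lo) (h0 : I lo s) (hp : p.modReg r = false)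
    (hW : hi + 1 ≤ W)
    (he : ∀ i s', Frame (.upTo r e p) s s' → I i s' → e.Fits W s' ∧ e.eval s' = hi)
    (hstep : ∀ i, lo ≤ i → i < hi → ∀ s', Frame (.upTo r e p) s s' → s'.reg r = i → I i s' →
      Runs W p s' c (fun s'' => s''.reg r = i → I (i + 1) (s''.setReg r (i + 1))))
    (hT : (hi - lo) * (c + (e.cost + 7)) + (e.cost + 3) ≤ T) :
    Runs W (.upTo r e p) s T (fun s' => s'.reg r = hi ∧ I hi s') :=
  Runs.upTo I lo hi (fun _ => c) hle hr h0 hp hW he hstep (by simpa using hT)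

end

/-! ### Adjacency lists of graphs on the natural numbers -/

/-- `off` and `nbr` are adjacency lists of the graph `G`, whose edges join numbers below `n`. -/
structure AdjArrays (G : SimpleGraph ℕ) (n : ℕ) (off nbr : ℕ → ℕ) : Prop where
  adj_lt : ∀ x y, G.Adj x y → y < n
  off_zero : off 0 = 0
  off_le : ∀ v < n, off v ≤ off (v + 1)
  bijOn : ∀ v < n, Set.BijOn nbr (Set.Ico (off v) (off (v + 1))) {u | G.Adj v u}

section

variable {G : SimpleGraph ℕ} {n : ℕ} {off nbr : ℕ → ℕ}

theorem AdjArrays.off_mono (h : AdjArrays G n off nbr) {u v : ℕ} (huv : u ≤ v) (hv : v ≤ n) :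
    off u ≤ off v := by
  induction v, huv using Nat.le_induction with
  | base => exact le_rfl
  | succ v huv ih => exact (ih (by omega)).trans (h.off_le v (by omega))

theorem AdjArrays.adj_nbr (h : AdjArrays G n off nbr) {v j : ℕ} (hv : v < n)
    (h1 : off v ≤ j) (h2 : j < off (v + 1)) : G.Adj v (nbr j) :=
  (h.bijOn v hv).mapsTo ⟨h1, h2⟩

theorem AdjArrays.adj_iff (h : AdjArrays G n off nbr) {v u : ℕ} (hv : v < n) :
    G.Adj v u ↔ ∃ j, off v ≤ j ∧ j < off (v + 1) ∧ nbr j = u := by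
  constructor
  · intro hu
    obtain ⟨j, hj, rfl⟩ := (h.bijOn v hv).surjOn hu
    exact ⟨j, hj.1, hj.2, rfl⟩
  · rintro ⟨j, h1, h2, rfl⟩
    exact h.adj_nbr hv h1 h2

theorem AdjArrays.nbr_inj (h : AdjArrays G n off nbr) {v i j : ℕ} (hv : v < n)
    (hi : off v ≤ i) (hi' : i < off (v + 1)) (hj : off v ≤ j) (hj' : j < off (v + 1))
    (hij : nbr i = nbr j) : i = j :=
  (h.bijOn v hv).injOn ⟨hi, hi'⟩ ⟨hj, hj'⟩ hij

theorem AdjArrays.sum_off_sub (h : AdjArrays G n off nbr) :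
    ∑ v ∈ Finset.Ico 0 n, (off (v + 1) - off v) = off n := by
  have key : ∀ m ≤ n, ∑ v ∈ Finset.range m, (off (v + 1) - off v) = off m := by
    intro m
    induction m with
    | zero => simp [h.off_zero]
    | succ m ih =>
      intro hm
      rw [Finset.sum_range_succ, ih (by omega)]
      have := h.off_le m hm
      omega
  rw [← Finset.range_eq_Ico]
  exact key n le_rfl

theorem AdjArrays.off_le_sq (h : AdjArrays G n off nbr) : off n ≤ n * n := by
  rw [← h.sum_off_sub]
  calc ∑ v ∈ Finset.Ico 0 n, (off (v + 1) - off v) ≤ ∑ _v ∈ Finset.Ico 0 n, n := by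
        refine Finset.sum_le_sum fun v hv => ?_
        have hvn := (Finset.mem_Ico.1 hv).2
        rw [← Nat.card_Ico, ← Finset.card_range n]
        refine Finset.card_le_card_of_injOn nbr (fun j hj => ?_) fun i hi j hj hij => ?_
        · have hj := Finset.mem_Ico.1 hj
          simpa using h.adj_lt _ _ (h.adj_nbr hvn hj.1 hj.2)
        · have hi := Finset.mem_Ico.1 hi
          have hj := Finset.mem_Ico.1 hj
          exact h.nbr_inj hvn hi.1 hi.2 hj.1 hj.2 hij
    _ = n * n := by simp

end

/-! ### Notation for programs -/

instance (c : ℕ) : OfNat Expr c := ⟨.const c⟩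
instance : Add Expr := ⟨.bin .add⟩
instance : Sub Expr := ⟨.bin .sub⟩
instance : Mul Expr := ⟨.bin .mul⟩

theorem Expr.ofNat_def (c : ℕ) : (OfNat.ofNat c : Expr) = .const c := rfl
theorem Expr.add_def (x y : Expr) : x + y = .bin .add x y := rfl
theorem Expr.sub_def (x y : Expr) : x - y = .bin .sub x y := rfl
theorem Expr.mul_def (x y : Expr) : x * y = .bin .mul x y := rfl

attribute [simp] Prog.wp Expr.Fits Expr.eval Op.eval Expr.ofNat_def Expr.add_def Expr.sub_def
  Expr.mul_def

infixr:60 " ⨾ " => Prog.seq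

/-! ### Partition refinement -/

/-- Move the item in register `6` from its class to the class of those items of its old class that
are adjacent to the vertex in register `2`. Array `2` holds the class of every item. If the class
`c` has already been split by this vertex, then cell `c` of array `3` holds the successor of
the vertex, and cell `c` of array `4` holds the class that was split off from `c`. Register `4`
holds the first unused class. -/
def touch : Prog :=
  .assign 5 (.get 2 (.reg 6)) ⨾
  .branch (.bin .eq (.get 3 (.reg 5)) (.reg 2 + 1)) .nop
    (.write 3 (.reg 5) (.reg 2 + 1) ⨾ .write 4 (.reg 5) (.reg 4) ⨾
      .assign 4 (.reg 4 + 1)) ⨾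
  .write 2 (.reg 6) (.get 4 (.reg 5))

/-- The state of the refinement while the vertex `v` is processed: `E` is the partition of the items
`0, …, M - 1` before this round, `P` holds for the items that have been touched in this round, and
`F` bounds the number of classes. -/
structure Refining (cls stamp new : ℕ → ℕ) (fresh M L v F : ℕ) (E : ℕ → ℕ → Prop)
    (P : ℕ → Prop) : Prop where
  cls_lt : ∀ x < M, cls x < fresh
  fresh_le : fresh ≤ F
  stamp_le : ∀ c < L, stamp c ≤ v + 1
  same : ∀ x < M, ∀ y < M, (cls x = cls y ↔ E x y ∧ (P x ↔ P y))
  stamped : ∀ x < M, ¬ P x → (stamp (cls x) = v + 1 ↔ ∃ y < M, P y ∧ E x y)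
  new_eq : ∀ x < M, ¬ P x → stamp (cls x) = v + 1 → ∀ y < M, (cls y = new (cls x) ↔ P y ∧ E x y)

section

variable {cls stamp new : ℕ → ℕ} {fresh M L v F z : ℕ} {E : ℕ → ℕ → Prop} {P : ℕ → Prop}

theorem Refining.congr {P' : ℕ → Prop} (h : Refining cls stamp new fresh M L v F E P)
    (hP : ∀ x < M, (P x ↔ P' x)) : Refining cls stamp new fresh M L v F E P' := by
  refine ⟨h.cls_lt, h.fresh_le, h.stamp_le, ?_, ?_, ?_⟩
  · intro x hx y hy
    rw [h.same x hx y hy, hP x hx, hP y hy]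
  · intro x hx hPx
    rw [h.stamped x hx (by rwa [hP x hx])]
    exact exists_congr fun y => and_congr_right fun hy => by rw [hP y hy]
  · intro x hx hPx hs y hy
    rw [h.new_eq x hx (by rwa [hP x hx]) hs y hy, hP y hy]

/-- Touching an item whose class has already been split in this round. -/
theorem Refining.touch_old (h : Refining cls stamp new fresh M L v F E P)
    (hE : Equivalence E) (hz : z < M) (hPz : ¬ P z) (hs : stamp (cls z) = v + 1) :
    Refining (Function.update cls z (new (cls z))) stamp new fresh M L v (F + 1) E
      (fun x => P x ∨ x = z) := by
  obtain ⟨y₀, hy₀, hPy₀, hEy₀⟩ := (h.stamped z hz hPz).1 hs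
  have hnew := h.new_eq z hz hPz hs
  have hval := (hnew y₀ hy₀).2 ⟨hPy₀, hEy₀⟩
  have hcls : ∀ x, x ≠ z → Function.update cls z (new (cls z)) x = cls x := fun x hx =>
    Function.update_of_ne hx _ _
  have hself : Function.update cls z (new (cls z)) z = new (cls z) := Function.update_self ..
  refine ⟨?_, h.fresh_le.trans (Nat.le_succ F), h.stamp_le, ?_, ?_, ?_⟩
  · intro x hx
    by_cases hxz : x = z
    · rw [hxz, hself, ← hval]; exact h.cls_lt y₀ hy₀
    · rw [hcls x hxz]; exact h.cls_lt x hx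
  · intro x hx y hy
    by_cases hxz : x = z <;> by_cases hyz : y = z
    · simp [hxz, hyz, hE.refl z]
    · rw [hxz, hself, hcls y hyz, eq_comm, hnew y hy]
      simp [hyz, and_comm]
    · rw [hyz, hself, hcls x hxz, hnew x hx]
      simp only [hxz, or_false, or_true, iff_true]
      exact ⟨fun h' => ⟨hE.symm h'.2, h'.1⟩, fun h' => ⟨h'.2, hE.symm h'.1⟩⟩
    · rw [hcls x hxz, hcls y hyz, h.same x hx y hy]
      simp [hxz, hyz]
  · intro x hx hPx
    push Not at hPx
    rw [hcls x hPx.2, h.stamped x hx hPx.1]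
    constructor
    · rintro ⟨y, hy, hPy, hxy⟩
      exact ⟨y, hy, Or.inl hPy, hxy⟩
    · rintro ⟨y, hy, hPy | rfl, hxy⟩
      · exact ⟨y, hy, hPy, hxy⟩
      · exact ⟨y₀, hy₀, hPy₀, hE.trans hxy hEy₀⟩
  · intro x hx hPx hsx y hy
    push Not at hPx
    rw [hcls x hPx.2] at hsx ⊢
    have hnx := h.new_eq x hx hPx.1 hsx
    by_cases hyz : y = z
    · subst hyz
      rw [hself, ← hval, hnx y₀ hy₀]
      simp only [or_true, true_and]
      exact ⟨fun h' => hE.trans h'.2 (hE.symm hEy₀), fun h' => ⟨hPy₀, hE.trans h' hEy₀⟩⟩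
    · rw [hcls y hyz, hnx y hy]
      simp [hyz]

/-- Touching the first item of a class in this round opens a new class. -/
theorem Refining.touch_new (h : Refining cls stamp new fresh M L v F E P)
    (hE : Equivalence E) (hz : z < M) (hPz : ¬ P z) (hs : stamp (cls z) ≠ v + 1) :
    Refining (Function.update cls z fresh) (Function.update stamp (cls z) (v + 1))
      (Function.update new (cls z) fresh) (fresh + 1) M L v (F + 1) E
      (fun x => P x ∨ x = z) := by
  have hno : ∀ y < M, P y → ¬ E z y := fun y hy hPy hzy =>
    hs ((h.stamped z hz hPz).2 ⟨y, hy, hPy, hzy⟩)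
  have hcls : ∀ x, x ≠ z → Function.update cls z fresh x = cls x := fun x hx =>
    Function.update_of_ne hx _ _
  have hself : Function.update cls z fresh z = fresh := Function.update_self ..
  have hne : ∀ x < M, cls x ≠ fresh := fun x hx => (h.cls_lt x hx).ne
  have hsame : ∀ x < M, ¬ P x → (cls x = cls z ↔ E x z) := fun x hx hPx => by
    rw [h.same x hx z hz]; simp [hPx, hPz]
  refine ⟨?_, Nat.succ_le_succ h.fresh_le, ?_, ?_, ?_, ?_⟩
  · intro x hx
    by_cases hxz : x = z
    · rw [hxz, hself]; exact Nat.lt_succ_self _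
    · rw [hcls x hxz]; exact (h.cls_lt x hx).trans (Nat.lt_succ_self _)
  · intro c hc
    rw [Function.update_apply]
    split_ifs
    · exact le_rfl
    · exact h.stamp_le c hc
  · intro x hx y hy
    by_cases hxz : x = z <;> by_cases hyz : y = z
    · simp [hxz, hyz, hE.refl z]
    · rw [hxz, hself, hcls y hyz]
      refine iff_of_false (hne y hy).symm ?_
      rintro ⟨hzy, hP⟩
      exact hno y hy ((hP.1 (Or.inr rfl)).resolve_right hyz) hzy
    · rw [hyz, hself, hcls x hxz]
      refine iff_of_false (hne x hx) ?_
      rintro ⟨hxz', hP⟩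
      exact hno x hx ((hP.2 (Or.inr rfl)).resolve_right hxz) (hE.symm hxz')
    · rw [hcls x hxz, hcls y hyz, h.same x hx y hy]
      simp [hxz, hyz]
  · intro x hx hPx
    push Not at hPx
    rw [hcls x hPx.2, Function.update_apply]
    split_ifs with hc
    · simp only [true_iff]
      exact ⟨z, hz, Or.inr rfl, (hsame x hx hPx.1).1 hc⟩
    · rw [h.stamped x hx hPx.1]
      constructor
      · rintro ⟨y, hy, hPy, hxy⟩
        exact ⟨y, hy, Or.inl hPy, hxy⟩
      · rintro ⟨y, hy, hPy | rfl, hxy⟩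
        · exact ⟨y, hy, hPy, hxy⟩
        · exact absurd ((hsame x hx hPx.1).2 hxy) hc
  · intro x hx hPx hsx y hy
    push Not at hPx
    rw [hcls x hPx.2] at hsx ⊢
    by_cases hc : cls x = cls z
    · have hxz := (hsame x hx hPx.1).1 hc
      rw [hc, Function.update_self]
      by_cases hyz : y = z
      · subst hyz
        simp [hxz]
      · rw [hcls y hyz]
        refine iff_of_false (hne y hy) ?_
        rintro ⟨hPy, hxy⟩
        exact hno y hy (hPy.resolve_right hyz) (hE.trans (hE.symm hxz) hxy)
    · rw [Function.update_of_ne hc] at hsx ⊢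
      by_cases hyz : y = z
      · subst hyz
        obtain ⟨y₀, hy₀, hPy₀, hEy₀⟩ := (h.stamped x hx hPx.1).1 hsx
        have hval := (h.new_eq x hx hPx.1 hsx y₀ hy₀).2 ⟨hPy₀, hEy₀⟩
        rw [hself, ← hval]
        refine iff_of_false (hne y₀ hy₀).symm ?_
        rintro ⟨-, hxy⟩
        exact hc ((hsame x hx hPx.1).2 hxy)
      · rw [hcls y hyz, h.new_eq x hx hPx.1 hsx y hy]
        simp [hyz]

end

/-- `Refining` for the contents of a store. -/
abbrev RefiningStore (s : Store) (M L v F : ℕ) (E : ℕ → ℕ → Prop) (P : ℕ → Prop) : Prop :=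
  Refining (s.arr 2) (s.arr 3) (s.arr 4) (s.reg 4) M L v F E P

theorem runs_touch {W M L v F z : ℕ} {E : ℕ → ℕ → Prop} {P : ℕ → Prop} {s : Store}
    (h : RefiningStore s M L v F E P) (hE : Equivalence E) (hv : s.reg 2 = v) (hz : s.reg 6 = z)
    (hzM : z < M) (hPz : ¬ P z) (hML : M ≤ W) (hF : F < L) (hLW : L ≤ W) (hvW : v + 1 ≤ W) :
    Runs W touch s 27
      (fun s' => RefiningStore s' M L v (F + 1) E (fun x => P x ∨ x = z)) := by
  have h1 := h.cls_lt z hzM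
  have h2 := h.fresh_le
  have h3 := h.stamp_le (s.arr 2 z) (by omega)
  refine (Runs.of_wp (Q := fun s' => RefiningStore s' M L v (F + 1) E (fun x => P x ∨ x = z))
    ?_).mono (by decide) fun _ _ h => h
  simp [touch, hz, hv]
  refine ⟨by omega, ⟨by omega, by omega, by split_ifs <;> omega⟩, fun hs => ?_, fun hs => ?_⟩
  · obtain ⟨y, hy, hPy⟩ := (h.stamped z hzM hPz).1 hs
    have h4 := (h.new_eq z hzM hPz hs y hy).2 hPy
    have h5 := h.cls_lt y hy
    refine ⟨by omega, ?_⟩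
    simpa [RefiningStore, Store.setArr_arr] using h.touch_old hE hzM hPz hs
  · refine ⟨by omega, by omega, by omega, by omega, ?_⟩
    simpa [RefiningStore, Store.setArr_arr] using h.touch_new hE hzM hPz hs

/-- The items are the numbers below `2 n`. The item `x < n` stands for the open neighbourhood of
the vertex `x`, the item `n + x` for the closed one. -/
def ItemAdj (G : SimpleGraph ℕ) (n x v : ℕ) : Prop :=
  G.Adj v x ∨ ∃ y < n, x = n + y ∧ (G.Adj v y ∨ v = y)

/-- The items `x` and `y` stand for sets that contain the same vertices below `v`. -/
def SameBelow (G : SimpleGraph ℕ) (n v x y : ℕ) : Prop :=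
  ∀ u < v, (ItemAdj G n x u ↔ ItemAdj G n y u)

theorem sameBelow_equivalence (G : SimpleGraph ℕ) (n v : ℕ) : Equivalence (SameBelow G n v) :=
  ⟨fun _ _ _ => Iff.rfl, fun h u hu => (h u hu).symm,
    fun h h' u hu => (h u hu).trans (h' u hu)⟩

/-- Clear the arrays that hold the classes, the stamps and the counters. -/
def clear : Prog :=
  .assign 7 (2 * .reg 0 + 2 * .get 0 (.reg 0) + 2) ⨾
  .assign 2 0 ⨾
  .upTo 2 (.reg 7)
    (.write 2 (.reg 2) 0 ⨾ .write 3 (.reg 2) 0 ⨾ .write 5 (.reg 2) 0 ⨾ .write 6 (.reg 2) 0)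

/-- Compute the twin classes by refining the partition of the items with each vertex. -/
def refine : Prog :=
  clear ⨾
  (.assign 4 1 ⨾ .assign 2 0) ⨾
  .upTo 2 (.reg 0)
    ((.assign 6 (.reg 0 + .reg 2) ⨾ touch) ⨾
     (.assign 3 (.get 0 (.reg 2)) ⨾ .assign 7 (.get 0 (.reg 2 + 1))) ⨾
     .upTo 3 (.reg 7)
       ((.assign 6 (.get 1 (.reg 3)) ⨾ touch) ⨾ (.assign 6 (.reg 0 + .reg 6) ⨾ touch)))

/-- The contents of array `2` after the refinement. -/
structure TwinLabels (G : SimpleGraph ℕ) (n L : ℕ) (cls : ℕ → ℕ) : Prop where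
  cls_lt : ∀ x < 2 * n, cls x < L
  falseTwin_iff : ∀ x < n, ∀ y < n, (cls x = cls y ↔ FalseTwin G x y)
  trueTwin_iff : ∀ x < n, ∀ y < n, (cls (n + x) = cls (n + y) ↔ TrueTwin G x y)

/-- Two sets of vertices that agree below `n` are equal, so the final partition of the items tells
which open and which closed neighbourhoods coincide. -/
theorem twinLabels_of_sameBelow {G : SimpleGraph ℕ} {n L : ℕ} {cls : ℕ → ℕ}
    (hG : ∀ x y, G.Adj x y → y < n) (hlt : ∀ x < 2 * n, cls x < L)
    (h : ∀ x < 2 * n, ∀ y < 2 * n, (cls x = cls y ↔ SameBelow G n n x y)) :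
    TwinLabels G n L cls := by
  refine ⟨hlt, fun x hx y hy => ?_, fun x hx y hy => ?_⟩
  · have hitem : ∀ x < n, ∀ u, ItemAdj G n x u ↔ G.Adj x u := by
      intro x hx u
      rw [G.adj_comm, ItemAdj]
      refine or_iff_left ?_
      rintro ⟨z, -, rfl, -⟩
      omega
    rw [h x (by omega) y (by omega)]
    constructor
    · intro h' u
      by_cases hu : u < n
      · rw [← hitem x hx, ← hitem y hy, h' u hu]
      · exact iff_of_false (fun h1 => hu (hG _ _ h1)) (fun h1 => hu (hG _ _ h1))
    · intro h' u _
      rw [hitem x hx, hitem y hy, h' u]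
  · have hitem : ∀ x < n, ∀ u, ItemAdj G n (n + x) u ↔ (G.Adj x u ∨ x = u) := by
      intro x hx u
      rw [G.adj_comm x u, @eq_comm _ x u]
      constructor
      · rintro (h1 | ⟨z, -, h1, h2⟩)
        · have := hG _ _ h1
          omega
        · obtain rfl : x = z := by omega
          exact h2
      · exact fun h1 => Or.inr ⟨x, hx, rfl, h1⟩
    rw [h _ (by omega) _ (by omega)]
    constructor
    · intro h' u
      by_cases hu : u < n
      · rw [← hitem x hx, ← hitem y hy, h' u hu]
      · refine iff_of_false ?_ ?_
        · rintro (h1 | rfl)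
          · exact hu (hG _ _ h1)
          · exact hu hx
        · rintro (h1 | rfl)
          · exact hu (hG _ _ h1)
          · exact hu hy
    · intro h' u _
      rw [hitem x hx, hitem y hy, h' u]

theorem runs_clear {W n e L : ℕ} {s : Store} (hn : s.reg 0 = n) (he : s.arr 0 n = e)
    (hL : L = 2 * n + 2 * e + 2) (hLW : L < W) :
    Runs W clear s (30 * L + 60) (fun s' => ∀ i < L, s'.arr 2 i = 0 ∧ s'.arr 3 i = 0 ∧
      s'.arr 5 i = 0 ∧ s'.arr 6 i = 0) := by
  refine Runs.wp_seq (T₂ := 30 * L + 40) ?_ (by simp [Prog.size, Expr.cost]; omega)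
  simp only [Prog.wp]
  refine ⟨by simp [hn, he]; omega, fun hf => ?_⟩
  refine Runs.wp_seq (T₂ := 30 * L + 30) ?_ (by simp [Prog.size, Expr.cost]; omega)
  simp only [Prog.wp]
  refine ⟨by simp, fun hf => ?_⟩
  set s₁ := (s.setReg 7 _).setReg 2 _ with hs₁
  have h7 : s₁.reg 7 = L := by simp [hs₁, hn, he, hL]
  have h2 : s₁.reg 2 = 0 := by simp [hs₁]
  refine (Runs.upTo_const (fun j s' => ∀ i < j, s'.arr 2 i = 0 ∧ s'.arr 3 i = 0 ∧
      s'.arr 5 i = 0 ∧ s'.arr 6 i = 0) 0 L 12 (Nat.zero_le L) h2 (by simp) rfl hLW ?_ ?_ ?_).mono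
      le_rfl fun _ _ h => h.2
  · intro i s' hf _
    have := (hf.reg 7 rfl).trans h7
    simp [this]; omega
  · intro i _ hi s' hf h2 hI
    refine (Runs.of_wp ?_).mono (R := fun s'' => ∀ j < i + 1, s''.arr 2 j = 0 ∧ s''.arr 3 j = 0 ∧
      s''.arr 5 j = 0 ∧ s''.arr 6 j = 0) (by decide) fun _ _ h _ => by simpa using h
    simp [h2]
    refine ⟨by omega, fun j hj => ?_⟩
    have := hI j
    grind
  · simp [Expr.cost]; omega

/-- The state of the refinement before the vertex `v` is processed. -/
structure Refined (cls stamp : ℕ → ℕ) (fresh M L v F : ℕ) (E : ℕ → ℕ → Prop) : Prop where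
  cls_lt : ∀ x < M, cls x < fresh
  fresh_le : fresh ≤ F
  stamp_le : ∀ c < L, stamp c ≤ v
  same : ∀ x < M, ∀ y < M, (cls x = cls y ↔ E x y)

theorem Refined.refining {cls stamp : ℕ → ℕ} {fresh M L v F : ℕ} {E : ℕ → ℕ → Prop}
    (h : Refined cls stamp fresh M L v F E) (new : ℕ → ℕ) (hF : F ≤ L) :
    Refining cls stamp new fresh M L v F E (fun _ => False) := by
  have hs : ∀ x < M, stamp (cls x) ≠ v + 1 := fun x hx => by
    have h1 := h.cls_lt x hx
    have h2 := h.fresh_le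
    have h3 := h.stamp_le (cls x) (by omega)
    omega
  refine ⟨h.cls_lt, h.fresh_le, fun c hc => (h.stamp_le c hc).trans (Nat.le_succ v), ?_, ?_, ?_⟩
  · intro x hx y hy
    simp [h.same x hx y hy]
  · intro x hx _
    simp [hs x hx]
  · intro x hx _ h'
    exact absurd h' (hs x hx)

theorem Refining.refined {G : SimpleGraph ℕ} {cls stamp new : ℕ → ℕ} {fresh n M L v F F' : ℕ}
    {P : ℕ → Prop} (h : Refining cls stamp new fresh M L v F (SameBelow G n v) P)
    (hP : ∀ x < M, (P x ↔ ItemAdj G n x v)) (hF : F ≤ F') :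
    Refined cls stamp fresh M L (v + 1) F' (SameBelow G n (v + 1)) := by
  refine ⟨h.cls_lt, h.fresh_le.trans hF, h.stamp_le, fun x hx y hy => ?_⟩
  rw [h.same x hx y hy, hP x hx, hP y hy]
  simp only [SameBelow, Nat.forall_lt_succ_right]

/-- The items that have been touched when the entries below `j` of the adjacency list of `v` have
been processed. -/
def Touched (nbr : ℕ → ℕ) (n v lo j x : ℕ) : Prop :=
  x = n + v ∨ ∃ i, lo ≤ i ∧ i < j ∧ (x = nbr i ∨ x = n + nbr i)

theorem AdjArrays.touched_iff {G : SimpleGraph ℕ} {n v : ℕ} {off nbr : ℕ → ℕ}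
    (h : AdjArrays G n off nbr) (hv : v < n) (x : ℕ) :
    Touched nbr n v (off v) (off (v + 1)) x ↔ ItemAdj G n x v := by
  simp only [Touched, ItemAdj, h.adj_iff hv]
  constructor
  · rintro (rfl | ⟨i, h1, h2, rfl | rfl⟩)
    · exact Or.inr ⟨v, hv, rfl, Or.inr rfl⟩
    · exact Or.inl ⟨i, h1, h2, rfl⟩
    · exact Or.inr ⟨nbr i, h.adj_lt _ _ (h.adj_nbr hv h1 h2), rfl, Or.inl ⟨i, h1, h2, rfl⟩⟩
  · rintro (⟨i, h1, h2, rfl⟩ | ⟨y, hy, rfl, ⟨i, h1, h2, rfl⟩ | rfl⟩)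
    · exact Or.inr ⟨i, h1, h2, Or.inl rfl⟩
    · exact Or.inr ⟨i, h1, h2, Or.inr rfl⟩
    · exact Or.inl rfl

/-- The refinement takes linear time and computes the twin classes. -/
theorem runs_refine {G : SimpleGraph ℕ} {W n L : ℕ} {s : Store} {off nbr : ℕ → ℕ}
    (hadj : AdjArrays G n off nbr) (hn : s.reg 0 = n) (hoff : s.arr 0 = off)
    (hnbr : s.arr 1 = nbr) (hL : L = 2 * n + 2 * off n + 2) (hLW : L < W) :
    Runs W refine s (200 * (n + off n + 1)) (fun s' => TwinLabels G n L (s'.arr 2) ∧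
      ∀ i < L, s'.arr 5 i = 0 ∧ s'.arr 6 i = 0) := by
  refine Runs.seq (T₂ := 110 * (n + off n) + 20) (runs_clear hn (by rw [hoff]) hL hLW)
    (fun s₁ hf₁ h₁ => ?_) (by omega)
  refine Runs.wp_seq (T₂ := 110 * (n + off n) + 10) ?_ (by simp [Prog.size, Expr.cost]; omega)
  simp only [Prog.wp]
  refine ⟨by simp; omega, by simp, fun _ => ?_⟩
  set s₂ := (s₁.setReg 4 _).setReg 2 _ with hs₂
  have h0 : s₂.reg 0 = n := by simp [hs₂, (hf₁.reg 0 rfl).trans hn]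
  have ha0 : s₂.arr 0 = off := by simp [hs₂, (hf₁.arr 0 rfl).trans hoff]
  have ha1 : s₂.arr 1 = nbr := by simp [hs₂, (hf₁.arr 1 rfl).trans hnbr]
  have h56 : ∀ i < L, s₂.arr 5 i = 0 ∧ s₂.arr 6 i = 0 := by
    simpa [hs₂] using fun i hi => (h₁ i hi).2.2
  have hoffn : ∀ v < n, off (v + 1) ≤ off n := fun v hv => hadj.off_mono hv le_rfl
  refine (Runs.upTo (fun v s' => Refined (s'.arr 2) (s'.arr 3) (s'.reg 4) (2 * n) L v
      (1 + v + 2 * off v) (SameBelow G n v)) 0 n (fun v => 60 + 100 * (off (v + 1) - off v))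
      (Nat.zero_le n) (by simp [hs₂]) ?_ rfl (by omega) ?_ ?_ ?_).mono le_rfl ?_
  · have hz : ∀ x < 2 * n, s₂.arr 2 x = 0 := fun x hx => by
      simpa [hs₂] using (h₁ x (by omega)).1
    refine ⟨fun x hx => ?_, by simp [hs₂], fun c hc => ?_, fun x hx y hy => ?_⟩
    · rw [hz x hx]; simp [hs₂]
    · simpa [hs₂] using (h₁ c hc).2.1
    · simp [hz x hx, hz y hy, SameBelow]
  · intro i s' hf _
    have := (hf.reg 0 rfl).trans h0
    simp [this]; omega
  · intro v _ hv s' hf hrv hI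
    have h0' := (hf.reg 0 rfl).trans h0
    have ha0' := (hf.arr 0 rfl).trans ha0
    have ha1' := (hf.arr 1 rfl).trans ha1
    have hvn := hoffn v hv
    have hlev := hadj.off_le v hv
    have hE := sameBelow_equivalence G n v
    -- the closed neighbourhood of `v` contains `v`
    refine Runs.seq (T₁ := 31) (T₂ := 29 + 100 * (off (v + 1) - off v))
      (R := fun s' => RefiningStore s' (2 * n) L v (2 + v + 2 * off v) (SameBelow G n v)
        (Touched nbr n v (off v) (off v))) ?_ (fun s₃ hf₃ h₃ => ?_) (by omega)
    · refine Runs.wp_seq (T₂ := 27) ?_ (by simp [Prog.size, Expr.cost])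
      simp only [Prog.wp]
      refine ⟨by simp [h0', hrv]; omega, fun _ => ?_⟩
      have hI' := hI.refining (s'.arr 4) (by omega)
      refine (runs_touch (M := 2 * n) (L := L) (v := v) (F := 1 + v + 2 * off v) (z := n + v)
        (E := SameBelow G n v) (P := fun _ => False) ?_ hE (by simp [hrv]) (by simp [h0', hrv])
        (by omega) (by simp) (by omega) (by omega) (by omega) (by omega)).mono le_rfl ?_
      · simpa [RefiningStore] using hI'
      · intro s'' _ h''
        rw [show 2 + v + 2 * off v = 1 + v + 2 * off v + 1 by omega]
        refine h''.congr fun x _ => ?_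
        simp only [Touched, false_or]
        exact ⟨Or.inl, fun h => h.resolve_right (by rintro ⟨i, h1, h2, -⟩; omega)⟩
    have h0₃ := (hf₃.reg 0 rfl).trans h0'
    have hv₃ := (hf₃.reg 2 rfl).trans hrv
    have ha0₃ := (hf₃.arr 0 rfl).trans ha0'
    have ha1₃ := (hf₃.arr 1 rfl).trans ha1'
    refine Runs.wp_seq (T₂ := 19 + 100 * (off (v + 1) - off v)) ?_
      (by simp [Prog.size, Expr.cost]; omega)
    simp only [Prog.wp]
    refine ⟨by simp [hv₃, ha0₃]; omega, by simp [hv₃, ha0₃]; omega, fun _ => ?_⟩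
    set s₄ := (s₃.setReg 3 _).setReg 7 _ with hs₄
    refine (Runs.upTo_const (fun j s' => RefiningStore s' (2 * n) L v (2 + v + 2 * j)
      (SameBelow G n v) (Touched nbr n v (off v) j)) (off v) (off (v + 1)) 62 hlev
      (by simp [hs₄, hv₃, ha0₃]) (by simpa [hs₄, RefiningStore] using h₃) rfl (by omega) ?_ ?_ ?_).mono le_rfl ?_
    · intro i s' hf _
      have : s'.reg 7 = off (v + 1) := (hf.reg 7 rfl).trans (by simp [hs₄, hv₃, ha0₃])
      simp [this]; omega
    · intro j hj hj' s₅ hf₅ h3₅ hI₅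
      have hadjj := hadj.adj_nbr hv hj hj'
      have hjn := hadj.adj_lt _ _ hadjj
      have h0₅ : s₅.reg 0 = n := (hf₅.reg 0 rfl).trans (by simp [hs₄, h0₃])
      have hv₅ : s₅.reg 2 = v := (hf₅.reg 2 rfl).trans (by simp [hs₄, hv₃])
      have ha1₅ : s₅.arr 1 = nbr := (hf₅.arr 1 rfl).trans (by simp [hs₄, ha1₃])
      have hnot : ¬ Touched nbr n v (off v) j (nbr j) := by
        rintro (h | ⟨i, h1, h2, h | h⟩)
        · omega
        · have := hadj.nbr_inj hv h1 (h2.trans hj') hj hj' h.symm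
          omega
        · omega
      have hnot' : ¬ (Touched nbr n v (off v) j (n + nbr j) ∨ n + nbr j = nbr j) := by
        rintro ((h | ⟨i, h1, h2, h | h⟩) | h)
        · have : v = nbr j := by omega
          rw [← this] at hadjj
          exact hadjj.ne rfl
        · have := hadj.adj_lt _ _ (hadj.adj_nbr hv h1 (h2.trans hj'))
          omega
        · have := hadj.nbr_inj hv h1 (h2.trans hj') hj hj' (by omega)
          omega
        · omega
      refine Runs.seq (T₁ := 30) (T₂ := 32)
        (R := fun s' => RefiningStore s' (2 * n) L v (2 + v + 2 * j + 1) (SameBelow G n v)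
          (fun x => Touched nbr n v (off v) j x ∨ x = nbr j) ∧ s'.reg 6 = nbr j)
        ?_ (fun s₆ hf₆ h₆ => ?_) (by omega)
      · refine Runs.wp_seq (T₂ := 27) ?_ (by simp [Prog.size, Expr.cost])
        simp only [Prog.wp]
        refine ⟨by simp [h3₅, ha1₅]; omega, fun _ => ?_⟩
        refine (runs_touch (M := 2 * n) (L := L) (v := v) (z := nbr j) (F := 2 + v + 2 * j)
          (P := Touched nbr n v (off v) j) ?_ hE (by simp [hv₅])
          (by simp [h3₅, ha1₅]) (by omega) hnot (by omega) (by omega) (by omega)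
          (by omega)).mono le_rfl ?_
        · simpa [RefiningStore] using hI₅
        · intro s'' hf'' h''
          exact ⟨h'', (hf''.reg 6 rfl).trans (by simp [h3₅, ha1₅])⟩
      · have h0₆ : s₆.reg 0 = n := (hf₆.reg 0 rfl).trans h0₅
        have hv₆ : s₆.reg 2 = v := (hf₆.reg 2 rfl).trans hv₅
        refine Runs.wp_seq (T₂ := 27) ?_ (by simp [Prog.size, Expr.cost])
        simp only [Prog.wp]
        refine ⟨by simp [h0₆, h₆.2]; omega, fun _ => ?_⟩
        refine (runs_touch (M := 2 * n) (L := L) (v := v) (z := n + nbr j)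
          (F := 2 + v + 2 * j + 1) (P := fun x => Touched nbr n v (off v) j x ∨ x = nbr j) ?_ hE
          (by simp [hv₆])
          (by simp [h0₆, h₆.2]) (by omega) hnot' (by omega) (by omega) (by omega)
          (by omega)).mono le_rfl ?_
        · simpa [RefiningStore] using h₆.1
        · intro s'' hf'' h'' _
          have : RefiningStore s'' (2 * n) L v (2 + v + 2 * (j + 1)) (SameBelow G n v)
              (Touched nbr n v (off v) (j + 1)) := by
            refine h''.congr fun x _ => ?_
            simp only [Touched]
            constructor
            · rintro (((h | ⟨i, h1, h2, h⟩) | h) | h)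
              · exact Or.inl h
              · exact Or.inr ⟨i, h1, by omega, h⟩
              · exact Or.inr ⟨j, hj, by omega, Or.inl h⟩
              · exact Or.inr ⟨j, hj, by omega, Or.inr h⟩
            · rintro (h | ⟨i, h1, h2, h⟩)
              · exact Or.inl (Or.inl (Or.inl h))
              · rcases Nat.lt_succ_iff_lt_or_eq.1 h2 with h2 | rfl
                · exact Or.inl (Or.inl (Or.inr ⟨i, h1, h2, h⟩))
                · rcases h with h | h
                  · exact Or.inl (Or.inr h)
                  · exact Or.inr h
          simpa [RefiningStore] using this
    · simp [Expr.cost]; omega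
    · rintro s₅ hf₅ ⟨-, h₅⟩ -
      have := h₅.refined (F' := 1 + (v + 1) + 2 * off (v + 1))
        (fun x _ => hadj.touched_iff hv x) (by omega)
      simpa using this
  · have := hadj.sum_off_sub
    simp only [Expr.cost, Finset.sum_add_distrib, ← Finset.mul_sum, this]
    simp; omega
  · rintro s' hf ⟨-, h'⟩
    refine ⟨twinLabels_of_sameBelow hadj.adj_lt (fun x hx => ?_) h'.same, ?_⟩
    · have h1 := h'.cls_lt x hx
      have h2 := h'.fresh_le
      omega
    · intro i hi
      rw [hf.arr 5 rfl, hf.arr 6 rfl]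
      exact h56 i hi

/-! ### Selecting the vertices of the kernel -/

/-- The number of elements of `K` below `x`. -/
def rank (K : Finset ℕ) (x : ℕ) : ℕ := (K.filter (· < x)).card

theorem rank_le_card (K : Finset ℕ) (x : ℕ) : rank K x ≤ K.card :=
  Finset.card_le_card (Finset.filter_subset _ K)

theorem rank_lt_rank {K : Finset ℕ} {x y : ℕ} (hx : x ∈ K) (hxy : x < y) :
    rank K x < rank K y := by
  refine Finset.card_lt_card (Finset.ssubset_iff_of_subset ?_ |>.2 ⟨x, ?_, ?_⟩)
  · intro z hz
    simp only [Finset.mem_filter] at hz ⊢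
    exact ⟨hz.1, hz.2.trans hxy⟩
  · simp [hx, hxy]
  · simp

theorem rank_lt_card {K : Finset ℕ} {x : ℕ} (hx : x ∈ K) : rank K x < K.card :=
  Finset.card_lt_card (Finset.ssubset_iff_of_subset (Finset.filter_subset _ K) |>.2
    ⟨x, hx, by simp⟩)

theorem rank_injOn (K : Finset ℕ) : Set.InjOn (rank K) K := by
  intro x hx y hy hxy
  rcases lt_trichotomy x y with h | h | h
  · exact absurd hxy (rank_lt_rank hx h).ne
  · exact h
  · exact absurd hxy (rank_lt_rank hy h).ne'

theorem rank_le_self (K : Finset ℕ) (x : ℕ) : rank K x ≤ x := by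
  have : K.filter (· < x) ⊆ Finset.range x := fun y hy => by simpa using (Finset.mem_filter.1 hy).2
  simpa [rank] using Finset.card_le_card this

theorem rank_succ (K : Finset ℕ) (x : ℕ) :
    rank K (x + 1) = if x ∈ K then rank K x + 1 else rank K x := by
  unfold rank
  have h : K.filter (· < x + 1) = K.filter (fun y => y < x ∨ y = x) :=
    Finset.filter_congr fun y _ => by omega
  rw [h, Finset.filter_or, Finset.filter_eq']
  split_ifs with hx
  · rw [Finset.card_union_of_disjoint (by simp), Finset.card_singleton]
  · simp

theorem rank_eq_card {K : Finset ℕ} {n : ℕ} (h : K ⊆ Finset.range n) : rank K n = K.card := by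
  rw [rank, Finset.filter_true_of_mem fun x hx => Finset.mem_range.1 (h hx)]

/-- Keep a vertex unless `3 k ^ 3` false twins or `3 k ^ 3` true twins of it have already been kept.
Register `9` counts the kept vertices, and arrays `5` and `6` count those in each class of false and
of true twins. Array `7` receives `0` for a vertex that is not kept, and the new number of
the vertex, increased by one, otherwise. -/
def select : Prog :=
  (.assign 8 (3 * .reg 1 * .reg 1 * .reg 1) ⨾ .assign 9 0 ⨾ .assign 2 0) ⨾
  .upTo 2 (.reg 0)
    (.branch ((.bin .lt (.get 5 (.get 2 (.reg 2))) (.reg 8)) *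
        (.bin .lt (.get 6 (.get 2 (.reg 0 + .reg 2))) (.reg 8)))
      (.write 5 (.get 2 (.reg 2)) (.get 5 (.get 2 (.reg 2)) + 1) ⨾
       .write 6 (.get 2 (.reg 0 + .reg 2)) (.get 6 (.get 2 (.reg 0 + .reg 2)) + 1) ⨾
       .assign 9 (.reg 9 + 1) ⨾
       .write 7 (.reg 2) (.reg 9))
      (.write 7 (.reg 2) 0))

/-- The state of the selection before the vertex `u` is processed; `K` consists of the kept
vertices, `idx` holds their new numbers, and `cF` and `cT` count the kept vertices by class. -/
structure Selection (cls : ℕ → ℕ) (n L B u : ℕ) (K : Finset ℕ) (q : ℕ) (idx cF cT : ℕ → ℕ) :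
    Prop where
  subset : K ⊆ Finset.range u
  card : q = K.card
  idx_eq : ∀ x < u, idx x = if x ∈ K then rank K x + 1 else 0
  cF_eq : ∀ c < L, cF c = (K.filter fun x => cls x = c).card
  cT_eq : ∀ c < L, cT c = (K.filter fun x => cls (n + x) = c).card
  cF_le : ∀ c, (K.filter fun x => cls x = c).card ≤ B
  cT_le : ∀ c, (K.filter fun x => cls (n + x) = c).card ≤ B
  dense : ∀ x < u, x ∉ K → B ≤ (K.filter fun y => cls y = cls x).card ∨
    B ≤ (K.filter fun y => cls (n + y) = cls (n + x)).card

section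

variable {cls idx cF cT : ℕ → ℕ} {n L B u q : ℕ} {K : Finset ℕ}

theorem Selection.drop (h : Selection cls n L B u K q idx cF cT)
    (hfull : B ≤ (K.filter fun y => cls y = cls u).card ∨
      B ≤ (K.filter fun y => cls (n + y) = cls (n + u)).card) :
    Selection cls n L B (u + 1) K q (Function.update idx u 0) cF cT := by
  have hu : u ∉ K := fun h' => by simpa using h.subset h'
  refine ⟨h.subset.trans (Finset.range_subset_range.2 (Nat.le_succ u)), h.card, ?_, h.cF_eq,
    h.cT_eq, h.cF_le, h.cT_le, ?_⟩
  · intro x hx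
    rcases Nat.lt_succ_iff_lt_or_eq.1 hx with hx | rfl
    · rw [Function.update_of_ne hx.ne, h.idx_eq x hx]
    · simp [hu]
  · intro x hx hxK
    rcases Nat.lt_succ_iff_lt_or_eq.1 hx with hx | rfl
    · exact h.dense x hx hxK
    · exact hfull

theorem Selection.keep (h : Selection cls n L B u K q idx cF cT)
    (hF : (K.filter fun y => cls y = cls u).card < B)
    (hT : (K.filter fun y => cls (n + y) = cls (n + u)).card < B) :
    Selection cls n L B (u + 1) (insert u K) (q + 1) (Function.update idx u (q + 1))
      (Function.update cF (cls u) (cF (cls u) + 1))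
      (Function.update cT (cls (n + u)) (cT (cls (n + u)) + 1)) := by
  have hu : u ∉ K := fun h' => by simpa using h.subset h'
  have hcard : ∀ f : ℕ → ℕ, ∀ c, ((insert u K).filter fun x => f x = c).card =
      if c = f u then (K.filter fun x => f x = c).card + 1 else
        (K.filter fun x => f x = c).card := by
    intro f c
    rw [Finset.filter_insert]
    by_cases hc : f u = c
    · rw [if_pos hc, if_pos hc.symm, Finset.card_insert_of_notMem (by simp [hu])]
    · rw [if_neg hc, if_neg (Ne.symm hc)]
  have hle : ∀ f : ℕ → ℕ, ∀ c, (K.filter fun x => f x = c).card ≤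
      ((insert u K).filter fun x => f x = c).card := fun f c =>
    Finset.card_le_card (Finset.filter_subset_filter _ (Finset.subset_insert u K))
  have hrank : ∀ x ≤ u, rank (insert u K) x = rank K x := by
    intro x hx
    rw [rank, Finset.filter_insert, if_neg (by omega), rank]
  refine ⟨?_, ?_, ?_, ?_, ?_, ?_, ?_, ?_⟩
  · refine Finset.insert_subset (by simp) (h.subset.trans ?_)
    exact Finset.range_subset_range.2 (Nat.le_succ u)
  · rw [Finset.card_insert_of_notMem hu, h.card]
  · intro x hx
    rcases Nat.lt_succ_iff_lt_or_eq.1 hx with hx | rfl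
    · rw [Function.update_of_ne hx.ne, h.idx_eq x hx, hrank x hx.le]
      simp [hx.ne]
    · rw [Function.update_self, if_pos (Finset.mem_insert_self _ _), hrank _ le_rfl,
        rank_eq_card h.subset, h.card]
  · intro c hc
    rw [hcard cls, Function.update_apply]
    split_ifs with h'
    · rw [← h', h.cF_eq c hc]
    · exact h.cF_eq c hc
  · intro c hc
    rw [hcard (fun x => cls (n + x)), Function.update_apply]
    split_ifs with h'
    · rw [← h', h.cT_eq c hc]
    · exact h.cT_eq c hc
  · intro c
    rw [hcard cls]
    split_ifs with h'
    · rw [h']; exact hF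
    · exact h.cF_le c
  · intro c
    rw [hcard (fun x => cls (n + x))]
    split_ifs with h'
    · rw [h']; exact hT
    · exact h.cT_le c
  · intro x hx hxK
    simp only [Finset.mem_insert, not_or] at hxK
    refine (h.dense x (by omega) hxK.2).imp (fun h' => h'.trans (hle cls _)) fun h' =>
      h'.trans (hle (fun x => cls (n + x)) _)

theorem Selection.card_le {G : SimpleGraph ℕ} {k : ℕ}
    (h : Selection cls n L B n K q idx cF cT)
    (hcls : TwinLabels G n L cls) (hG : ∀ x y, G.Adj x y → y < n)
    (heq : KEquistableOn G (Finset.range n) k) : q ≤ 2 * B * k := by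
  classical
  rw [h.card]
  refine heq.card_le (fun x y hxy => Finset.mem_range.2 (hG x y hxy)) h.subset ?_ ?_
  · intro v hv
    refine le_trans (le_of_eq ?_) (h.cF_le (cls v))
    congr 1
    refine Finset.filter_congr fun x hx => ?_
    rw [hcls.falseTwin_iff x (Finset.mem_range.1 (h.subset hx)) v
      (Finset.mem_range.1 (h.subset hv))]
  · intro v hv
    refine le_trans (le_of_eq ?_) (h.cT_le (cls (n + v)))
    congr 1
    refine Finset.filter_congr fun x hx => ?_
    rw [hcls.trueTwin_iff x (Finset.mem_range.1 (h.subset hx)) v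
      (Finset.mem_range.1 (h.subset hv))]

theorem Selection.twinDense {G : SimpleGraph ℕ} (h : Selection cls n L B n K q idx cF cT)
    (hcls : TwinLabels G n L cls) : TwinDense G (Finset.range n) K B := by
  intro v hv hvK
  have hv' := Finset.mem_range.1 hv
  refine (h.dense v hv' hvK).imp (fun h' => ?_) fun h' => ?_
  · refine ⟨_, Finset.filter_subset _ K, h', fun x hx => ?_⟩
    obtain ⟨hxK, hx⟩ := Finset.mem_filter.1 hx
    exact (hcls.falseTwin_iff x (Finset.mem_range.1 (h.subset hxK)) v hv').1 hx
  · refine ⟨_, Finset.filter_subset _ K, h', fun x hx => ?_⟩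
    obtain ⟨hxK, hx⟩ := Finset.mem_filter.1 hx
    exact (hcls.trueTwin_iff x (Finset.mem_range.1 (h.subset hxK)) v hv').1 hx

end

theorem runs_select {W n k L B : ℕ} {s : Store} (hn : s.reg 0 = n) (hk : s.reg 1 = k)
    (hcls : ∀ x < 2 * n, s.arr 2 x < L) (hzero : ∀ i < L, s.arr 5 i = 0 ∧ s.arr 6 i = 0)
    (hB : B = 3 * k * k * k) (hBW : B < W) (hLW : L < W) (hnL : 2 * n + 1 < L)
    (hkW : 3 * k * k < W) (hkW' : 3 * k < W) (hkW'' : k < W) (h3W : 3 < W) :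
    Runs W select s (100 * (n + 1)) (fun s' => s'.reg 8 = B ∧ ∃ K,
      Selection (s.arr 2) n L B n K (s'.reg 9) (s'.arr 7) (s'.arr 5) (s'.arr 6)) := by
  refine Runs.wp_seq (T₂ := 80 * (n + 1)) ?_ (by simp [Prog.size, Expr.cost]; omega)
  simp only [Prog.wp]
  refine ⟨by simp [hk]; omega, by simp, by simp, fun _ => ?_⟩
  set s₁ := ((s.setReg 8 _).setReg 9 _).setReg 2 _ with hs₁
  have h0 : s₁.reg 0 = n := by simp [hs₁, hn]
  have h8 : s₁.reg 8 = B := by simp [hs₁, hk, hB]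
  have ha2 : s₁.arr 2 = s.arr 2 := by simp [hs₁]
  refine (Runs.upTo_const (fun u s' => ∃ K,
      Selection (s.arr 2) n L B u K (s'.reg 9) (s'.arr 7) (s'.arr 5) (s'.arr 6)) 0 n 55
      (Nat.zero_le n) (by simp [hs₁]) ?_ rfl (by omega) ?_ ?_ ?_).mono le_rfl
      fun s' hf h => ⟨(hf.reg 8 rfl).trans h8, h.2⟩
  · refine ⟨∅, by simp, by simp [hs₁], by simp, ?_, ?_, by simp, by simp, by simp⟩
    · intro c hc; simpa [hs₁] using (hzero c hc).1
    · intro c hc; simpa [hs₁] using (hzero c hc).2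
  · intro i s' hf _
    have := (hf.reg 0 rfl).trans h0
    simp [this]; omega
  · rintro u _ hu s' hf h2 ⟨K, hK⟩
    have h0' := (hf.reg 0 rfl).trans h0
    have h8' := (hf.reg 8 rfl).trans h8
    have ha2' := (hf.arr 2 rfl).trans ha2
    have hlF := hcls u (by omega)
    have hlT := hcls (n + u) (by omega)
    have hcF := hK.cF_eq _ hlF
    have hcT := hK.cT_eq _ hlT
    have hFB := hK.cF_le (s.arr 2 u)
    have hTB := hK.cT_le (s.arr 2 (n + u))
    have hq : s'.reg 9 ≤ u := by
      rw [hK.card]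
      simpa using Finset.card_le_card hK.subset
    refine (Runs.of_wp ?_).mono (R := fun s'' => ∃ K,
      Selection (s.arr 2) n L B (u + 1) K (s''.reg 9) (s''.arr 7) (s''.arr 5) (s''.arr 6))
      (by decide) fun _ _ h _ => by simpa using h
    have hdrop := fun h' => Selection.drop hK h'
    have hkeep := fun h' => Selection.keep hK h'
    rw [← hcF] at hdrop hkeep hFB
    rw [← hcT] at hdrop hkeep hTB
    by_cases hF : s'.arr 5 (s.arr 2 u) < B <;> by_cases hT : s'.arr 6 (s.arr 2 (n + u)) < B
    · simp [h0', h2, h8', ha2', hF, hT]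
      refine ⟨by omega, by omega, by omega, by omega, by omega, insert u K, ?_⟩
      simpa [Store.setArr_arr] using hkeep hF hT
    all_goals
      simp [h0', h2, h8', ha2', hF, hT]
      refine ⟨by omega, by omega, K, ?_⟩
      simpa [Store.setArr_arr] using hdrop (by omega)
  · simp [Expr.cost]; omega

/-! ### Building the kernel -/

/-- The graph `G` on `Fin n`, regarded as a graph on the natural numbers. -/
abbrev natGraph {n : ℕ} (G : SimpleGraph (Fin n)) : SimpleGraph ℕ := G.map Fin.valEmbedding

theorem natGraph_adj_iff {n : ℕ} (G : SimpleGraph (Fin n)) (x y : ℕ) :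
    (natGraph G).Adj x y ↔ ∃ (hx : x < n) (hy : y < n), G.Adj ⟨x, hx⟩ ⟨y, hy⟩ := by
  simp only [SimpleGraph.map_adj, Fin.valEmbedding_apply]
  constructor
  · rintro ⟨a, b, h, rfl, rfl⟩
    exact ⟨a.2, b.2, h⟩
  · rintro ⟨hx, hy, h⟩
    exact ⟨_, _, h, rfl, rfl⟩

theorem isKEquistable_iff_natGraph {n k : ℕ} (G : SimpleGraph (Fin n)) :
    IsKEquistable G k ↔ KEquistableOn (natGraph G) (Finset.range n) k := by
  have h := isKEquistable_comap_iff (G := natGraph G) (k := k) (Fin.valEmbedding (n := n))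
  rw [SimpleGraph.comap_map_eq] at h
  rw [h]
  have : Finset.univ.map (Fin.valEmbedding (n := n)) = Finset.range n := by
    ext x
    simp only [Finset.mem_map, Finset.mem_univ, true_and, Fin.valEmbedding_apply,
      Finset.mem_range]
    exact ⟨fun ⟨a, ha⟩ => ha ▸ a.2, fun hx => ⟨⟨x, hx⟩, rfl⟩⟩
  rw [this]

theorem IsAdjacencyList.adjArrays {n : ℕ} {G : SimpleGraph (Fin n)} {off nbr : ℕ → ℕ}
    (h : IsAdjacencyList G off nbr) : AdjArrays (natGraph G) n off nbr := by
  refine ⟨fun x y hxy => ((natGraph_adj_iff G x y).1 hxy).2.1, h.off_zero,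
    fun v hv => h.off_le ⟨v, hv⟩, fun v hv => ?_⟩
  convert h.bijOn ⟨v, hv⟩ using 1
  ext u
  simp only [Set.mem_ofPred_eq, natGraph_adj_iff, Set.mem_image, SimpleGraph.mem_neighborSet]
  constructor
  · rintro ⟨_, hu, h'⟩
    exact ⟨⟨u, hu⟩, h', rfl⟩
  · rintro ⟨a, h', rfl⟩
    exact ⟨hv, a.2, h'⟩

/-- The adjacency lists contain every edge twice. -/
theorem IsAdjacencyList.off_eq {n : ℕ} {G : SimpleGraph (Fin n)} {off nbr : ℕ → ℕ}
    (h : IsAdjacencyList G off nbr) : off n = 2 * numEdges G := by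
  classical
  rw [numEdges, ← SimpleGraph.coe_edgeFinset, Set.ncard_coe_finset,
    ← SimpleGraph.sum_degrees_eq_twice_card_edges, ← h.adjArrays.sum_off_sub,
    ← Finset.range_eq_Ico, ← Fin.sum_univ_eq_sum_range (fun v => off (v + 1) - off v)]
  refine Finset.sum_congr rfl fun v _ => ?_
  have h1 := (h.bijOn v).image_eq
  have h2 := congrArg Set.ncard h1
  rw [(h.bijOn v).injOn.ncard_image,
    Set.ncard_image_of_injective _ Fin.val_injective, ← Finset.coe_Ico, Set.ncard_coe_finset,
    Nat.card_Ico] at h2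
  rw [h2, ← SimpleGraph.card_neighborFinset_eq_degree, ← Set.ncard_coe_finset,
    SimpleGraph.coe_neighborFinset]

/-- Overwrite the adjacency lists by those of the subgraph induced by the kept vertices. Register
`10` holds the number of entries written so far. -/
def build : Prog :=
  (.assign 10 0 ⨾ .assign 3 0 ⨾ .assign 2 0) ⨾
  .upTo 2 (.reg 0)
    (.assign 7 (.get 0 (.reg 2 + 1)) ⨾
     .branch (.get 7 (.reg 2))
      (.upTo 3 (.reg 7)
        (.assign 6 (.get 7 (.get 1 (.reg 3))) ⨾
         .branch (.reg 6) (.write 1 (.reg 10) (.reg 6 - 1) ⨾ .assign 10 (.reg 10 + 1)) .nop) ⨾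
       .write 0 (.get 7 (.reg 2)) (.reg 10))
      (.assign 3 (.reg 7))) ⨾
  .assign 0 (.reg 9)

/-- The state of the construction before the vertex `u` is processed: `o` and `b` are the arrays that
initially hold the adjacency lists `off` and `nbr` of `G` and finally hold those of the subgraph
induced by `K`, and `pos` is the number of new entries. New entries never overtake the old entries
that are still needed. -/
structure Building (G : SimpleGraph ℕ) (off nbr : ℕ → ℕ) (K : Finset ℕ) (n u : ℕ)
    (o b : ℕ → ℕ) (pos : ℕ) : Prop where
  pos_le : pos ≤ off u
  zero : o 0 = 0
  last : o (rank K u) = pos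
  off_eq : ∀ i, u < i → i ≤ n → o i = off i
  nbr_eq : ∀ i, off u ≤ i → b i = nbr i
  lists : ∀ x ∈ K, x < u → o (rank K x) ≤ o (rank K x + 1) ∧ o (rank K x + 1) ≤ pos ∧
    Set.BijOn b (Set.Ico (o (rank K x)) (o (rank K x + 1))) (rank K '' {y | y ∈ K ∧ G.Adj x y})

/-- The state while the list of `u` is processed, before the entry `j`. -/
structure BuildingList (nbr : ℕ → ℕ) (K : Finset ℕ) (lo pos₀ j : ℕ) (b₀ b : ℕ → ℕ)
    (pos : ℕ) : Prop where
  le_pos : pos₀ ≤ pos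
  pos_le : pos ≤ j
  nbr_eq : ∀ i, j ≤ i → b i = nbr i
  old_eq : ∀ i < pos₀, b i = b₀ i
  bijOn : Set.BijOn b (Set.Ico pos₀ pos)
    (rank K '' {y | y ∈ K ∧ ∃ i, lo ≤ i ∧ i < j ∧ nbr i = y})

section

variable {G : SimpleGraph ℕ} {off nbr o b b₀ : ℕ → ℕ} {K : Finset ℕ} {n u j lo pos pos₀ : ℕ}

theorem bijOn_update_Ico {f : ℕ → ℕ} {a c y : ℕ} {S : Set ℕ} (h : Set.BijOn f (Set.Ico a c) S)
    (hac : a ≤ c) (hy : y ∉ S) :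
    Set.BijOn (Function.update f c y) (Set.Ico a (c + 1)) (insert y S) := by
  have h1 : Set.BijOn (Function.update f c y) (Set.Ico a c) S :=
    h.congr fun x hx => (Function.update_of_ne (ne_of_lt hx.2) _ _).symm
  have h2 : Set.Ico a (c + 1) = insert c (Set.Ico a c) := by
    ext x
    simp only [Set.mem_Ico, Set.mem_insert_iff]
    omega
  have h3 := h1.insert (a := c) (by simpa using hy)
  rw [h2]
  simpa using h3

theorem BuildingList.keep (h : BuildingList nbr K lo pos₀ j b₀ b pos) (hlo : lo ≤ j)
    (hK : nbr j ∈ K) (hinj : ∀ i, lo ≤ i → i < j → nbr i ≠ nbr j) :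
    BuildingList nbr K lo pos₀ (j + 1) b₀ (Function.update b pos (rank K (nbr j))) (pos + 1) := by
  refine ⟨h.le_pos.trans (Nat.le_succ _), Nat.succ_le_succ h.pos_le, ?_, ?_, ?_⟩
  · intro i hi
    have := h.pos_le
    rw [Function.update_of_ne (by omega), h.nbr_eq i (by omega)]
  · intro i hi
    have := h.le_pos
    rw [Function.update_of_ne (by omega), h.old_eq i hi]
  · have := bijOn_update_Ico h.bijOn h.le_pos (y := rank K (nbr j)) ?_
    · convert this using 1
      ext z
      simp only [Set.mem_image, Set.mem_ofPred_eq, Set.mem_insert_iff]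
      constructor
      · rintro ⟨y, ⟨hy, i, h1, h2, rfl⟩, rfl⟩
        rcases Nat.lt_succ_iff_lt_or_eq.1 h2 with h2 | rfl
        · exact Or.inr ⟨_, ⟨hy, i, h1, h2, rfl⟩, rfl⟩
        · exact Or.inl rfl
      · rintro (rfl | ⟨y, ⟨hy, i, h1, h2, rfl⟩, rfl⟩)
        · exact ⟨_, ⟨hK, j, hlo, Nat.lt_succ_self j, rfl⟩, rfl⟩
        · exact ⟨_, ⟨hy, i, h1, by omega, rfl⟩, rfl⟩
    · rintro ⟨y, ⟨hy, i, h1, h2, rfl⟩, hr⟩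
      exact hinj i h1 h2 (rank_injOn K hy hK hr)

theorem BuildingList.drop (h : BuildingList nbr K lo pos₀ j b₀ b pos) (hK : nbr j ∉ K) :
    BuildingList nbr K lo pos₀ (j + 1) b₀ b pos := by
  refine ⟨h.le_pos, h.pos_le.trans (Nat.le_succ j), fun i hi => h.nbr_eq i (by omega), h.old_eq, ?_⟩
  convert h.bijOn using 4 with y
  constructor
  · rintro ⟨hy, i, h1, h2, rfl⟩
    rcases Nat.lt_succ_iff_lt_or_eq.1 h2 with h2 | rfl
    · exact ⟨hy, i, h1, h2, rfl⟩
    · exact absurd hy hK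
  · rintro ⟨hy, i, h1, h2, rfl⟩
    exact ⟨hy, i, h1, by omega, rfl⟩

theorem Building.keep (h : Building G off nbr K n u o b₀ pos₀) (hadj : AdjArrays G n off nbr)
    (hu : u < n) (hK : u ∈ K)
    (hl : BuildingList nbr K (off u) pos₀ (off (u + 1)) b₀ b pos) :
    Building G off nbr K n (u + 1) (Function.update o (rank K u + 1) pos) b pos := by
  have hru := rank_le_self K u
  have hlt : ∀ x ∈ K, x < u → rank K x + 1 ≤ rank K u := fun x hx hxu => rank_lt_rank hx hxu
  refine ⟨hl.pos_le, ?_, ?_, ?_, hl.nbr_eq, ?_⟩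
  · rw [Function.update_of_ne (by omega), h.zero]
  · rw [rank_succ, if_pos hK, Function.update_self]
  · intro i hi hin
    rw [Function.update_of_ne (by omega), h.off_eq i (by omega) hin]
  · intro x hx hxu
    rcases Nat.lt_succ_iff_lt_or_eq.1 hxu with hxu | rfl
    · have := hlt x hx hxu
      rw [Function.update_of_ne (by omega), Function.update_of_ne (by omega)]
      obtain ⟨h1, h2, h3⟩ := h.lists x hx hxu
      refine ⟨h1, h2.trans hl.le_pos, h3.congr fun i hi => (hl.old_eq i ?_).symm⟩
      exact lt_of_lt_of_le hi.2 h2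
    · rw [Function.update_of_ne (by omega), Function.update_self, h.last]
      refine ⟨hl.le_pos, le_rfl, ?_⟩
      convert hl.bijOn using 4 with y
      rw [hadj.adj_iff hu]

theorem Building.drop (h : Building G off nbr K n u o b pos) (hadj : AdjArrays G n off nbr)
    (hu : u < n) (hK : u ∉ K) : Building G off nbr K n (u + 1) o b pos := by
  have hle := hadj.off_le u hu
  refine ⟨h.pos_le.trans hle, h.zero, ?_, fun i hi => h.off_eq i (by omega),
    fun i hi => h.nbr_eq i (hle.trans hi), ?_⟩
  · rw [rank_succ, if_neg hK, h.last]
  · intro x hx hxu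
    rcases Nat.lt_succ_iff_lt_or_eq.1 hxu with hxu | rfl
    · exact h.lists x hx hxu
    · exact absurd hx hK

theorem exists_embedding_rank (K : Finset ℕ) :
    ∃ e : Fin K.card ↪ ℕ, Finset.univ.map e = K ∧ ∀ a, rank K (e a) = a := by
  have himg : K.image (rank K) = Finset.range K.card := by
    refine Finset.eq_of_subset_of_card_le (fun a ha => ?_) ?_
    · obtain ⟨x, hx, rfl⟩ := Finset.mem_image.1 ha
      exact Finset.mem_range.2 (rank_lt_card hx)
    · rw [Finset.card_range, Finset.card_image_of_injOn (rank_injOn K)]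
  have hex : ∀ a : Fin K.card, ∃ x, x ∈ K ∧ rank K x = a := fun a => by
    have : (a : ℕ) ∈ K.image (rank K) := by rw [himg]; simp
    simpa using this
  choose f hfK hf using hex
  have hinj : Function.Injective f := fun a b hab => Fin.ext (by rw [← hf a, ← hf b, hab])
  refine ⟨⟨f, hinj⟩, Finset.eq_of_subset_of_card_le (fun x hx => ?_) (by simp), hf⟩
  obtain ⟨a, -, rfl⟩ := Finset.mem_map.1 hx
  exact hfK a

/-- The completed arrays are adjacency lists of the induced subgraph. -/
theorem Building.exists_isAdjacencyList (h : Building G off nbr K n n o b pos)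
    (hK : K ⊆ Finset.range n) :
    ∃ G' : SimpleGraph (Fin K.card), IsAdjacencyList G' o b ∧
      ∀ k, IsKEquistable G' k ↔ KEquistableOn G K k := by
  obtain ⟨e, he, hrank⟩ := exists_embedding_rank K
  have heK : ∀ a, e a ∈ K := fun a => by
    have : e a ∈ Finset.univ.map e := Finset.mem_map_of_mem e (Finset.mem_univ a)
    rwa [he] at this
  have hlists := fun a => h.lists (e a) (heK a) (Finset.mem_range.1 (hK (heK a)))
  simp only [hrank] at hlists
  refine ⟨G.comap e, ⟨h.zero, fun v => (hlists v).1, fun v => ?_⟩, fun k => ?_⟩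
  · convert (hlists v).2.2 using 1
    ext z
    simp only [Set.mem_image, SimpleGraph.mem_neighborSet, SimpleGraph.comap_adj,
      Set.mem_ofPred_eq]
    constructor
    · rintro ⟨a, ha, rfl⟩
      exact ⟨e a, ⟨heK a, ha⟩, hrank a⟩
    · rintro ⟨y, ⟨hy, hvy⟩, rfl⟩
      rw [← he] at hy
      obtain ⟨a, -, rfl⟩ := Finset.mem_map.1 hy
      exact ⟨a, hvy, (hrank a).symm⟩
  · rw [isKEquistable_comap_iff, he]

end

theorem runs_build {G : SimpleGraph ℕ} {W n : ℕ} {K : Finset ℕ} {s : Store} {off nbr : ℕ → ℕ}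
    (hadj : AdjArrays G n off nbr) (hn : s.reg 0 = n) (hoff : s.arr 0 = off)
    (hnbr : s.arr 1 = nbr) (hK : K ⊆ Finset.range n) (hq : s.reg 9 = K.card)
    (hidx : ∀ x < n, s.arr 7 x = if x ∈ K then rank K x + 1 else 0)
    (hW : 2 * n + 2 * off n + 2 < W) :
    Runs W build s (100 * (n + off n + 1)) (fun s' => s'.reg 0 = K.card ∧
      ∃ pos, Building G off nbr K n n (s'.arr 0) (s'.arr 1) pos) := by
  refine Runs.wp_seq (T₂ := 80 * (n + off n + 1)) ?_ (by simp [Prog.size, Expr.cost]; omega)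
  simp only [Prog.wp]
  refine ⟨by simp, by simp, by simp, fun _ => ?_⟩
  set s₁ := ((s.setReg 10 _).setReg 3 _).setReg 2 _ with hs₁
  have h0 : s₁.reg 0 = n := by simp [hs₁, hn]
  have h9 : s₁.reg 9 = K.card := by simp [hs₁, hq]
  have ha7 : s₁.arr 7 = s.arr 7 := by simp [hs₁]
  have hKn : K.card ≤ n := by simpa using Finset.card_le_card hK
  have hrank : ∀ x, rank K x ≤ n := fun x => (rank_le_card K x).trans hKn
  refine Runs.seq (T₁ := 70 * (n + off n + 1)) (T₂ := 2) (Runs.upTo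
      (fun u s' => s'.reg 3 = off u ∧
        Building G off nbr K n u (s'.arr 0) (s'.arr 1) (s'.reg 10))
      0 n (fun u => 30 + 30 * (off (u + 1) - off u))
      (Nat.zero_le n) (by simp [hs₁]) ?_ rfl (by omega) ?_ ?_ ?_) ?_ (by omega)
  · refine ⟨by simp [hs₁, hadj.off_zero], by simp [hs₁], ?_, ?_, ?_, ?_, by simp⟩
    · simp [hs₁, hoff, hadj.off_zero]
    · simp [hs₁, hoff, rank, hadj.off_zero]
    · simp [hs₁, hoff]
    · simp [hs₁, hnbr]
  · intro i s' hf _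
    have := (hf.reg 0 rfl).trans h0
    simp [this]; omega
  · rintro u _ hu s' hf h2 ⟨h3, hI⟩
    have h0' := (hf.reg 0 rfl).trans h0
    have ha7' := (hf.arr 7 rfl).trans ha7
    have hoff' := hI.off_eq (u + 1) (Nat.lt_succ_self u) hu
    have hle := hadj.off_le u hu
    have hle' := hadj.off_mono (u := u + 1) hu le_rfl
    refine Runs.wp_seq (T₂ := 24 + 30 * (off (u + 1) - off u)) ?_
      (by simp [Prog.size, Expr.cost]; omega)
    simp only [Prog.wp]
    refine ⟨by simp [h2, hoff']; omega, fun _ => ?_⟩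
    set s₂ := s'.setReg 7 _ with hs₂
    have h7₂ : s₂.reg 7 = off (u + 1) := by simp [hs₂, h2, hoff']
    have h2₂ : s₂.reg 2 = u := by simp [hs₂, h2]
    have ha7₂ : s₂.arr 7 = s.arr 7 := by simp [hs₂, ha7']
    have hidxu := hidx u hu
    refine Runs.branch (T₁ := 20 + 30 * (off (u + 1) - off u)) ?_ (fun hne => ?_) (fun heq => ?_)
      (by simp [Expr.cost]; omega)
    · have := hrank u
      simp [h2₂, ha7₂, hidxu]
      split_ifs <;> omega
    · have hKu : u ∈ K := by
        by_contra h'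
        simp [h2₂, ha7₂, hidxu, h'] at hne
      rw [if_pos hKu] at hidxu
      refine Runs.seq (T₁ := 10 + 30 * (off (u + 1) - off u)) (T₂ := 10) (Runs.upTo_const
        (fun j t => BuildingList nbr K (off u) (s'.reg 10) j (s'.arr 1) (t.arr 1) (t.reg 10))
        (off u) (off (u + 1)) 20 hle (by simp [hs₂, h3]) ?_ rfl (by omega) ?_ ?_ ?_) ?_ (by omega)
      · refine ⟨by simp [hs₂], by simpa [hs₂] using hI.pos_le, by simpa [hs₂] using hI.nbr_eq,
          by simp [hs₂], ?_⟩
        have hemp : {y | y ∈ K ∧ ∃ i, off u ≤ i ∧ i < off u ∧ nbr i = y} = ∅ := by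
          ext y
          simp only [Set.mem_ofPred_eq, Set.mem_empty_iff_false, iff_false]
          rintro ⟨-, i, h1, h2, -⟩
          omega
        rw [hemp]
        simp [hs₂]
      · intro i t hft _
        have := (hft.reg 7 rfl).trans h7₂
        simp [this]; omega
      · intro j hj hj' t hft h3t hJ
        have ha7t := (hft.arr 7 rfl).trans ha7₂
        have hadjj := hadj.adj_nbr hu hj hj'
        have hjn := hadj.adj_lt _ _ hadjj
        have hbj := hJ.nbr_eq j le_rfl
        have hidxj := hidx _ hjn
        have hpj := hJ.pos_le
        have hrj := hrank (nbr j)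
        refine (Runs.of_wp ?_).mono (R := fun t' => BuildingList nbr K (off u) (s'.reg 10)
          (j + 1) (s'.arr 1) (t'.arr 1) (t'.reg 10)) (by decide) fun _ _ h _ => by simpa using h
        by_cases hKj : nbr j ∈ K
        · rw [if_pos hKj] at hidxj
          simp [h3t, ha7t, hbj, hidxj]
          refine ⟨by omega, by omega, by omega, by omega, ?_⟩
          have := hJ.keep hj hKj fun i h1 h2 h' => by
            have := hadj.nbr_inj hu h1 (h2.trans hj') hj hj' h'
            omega
          simpa [Store.setArr_arr] using this
        · rw [if_neg hKj] at hidxj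
          simp [h3t, ha7t, hbj, hidxj]
          exact ⟨by omega, hJ.drop hKj⟩
      · simp [Expr.cost]; omega
      · rintro t hft ⟨h3t, hJ⟩
        have h2t := (hft.reg 2 rfl).trans h2₂
        have ha7t := (hft.arr 7 rfl).trans ha7₂
        have ha0t : t.arr 0 = s'.arr 0 := (hft.arr 0 rfl).trans (by simp [hs₂])
        have hrj := hrank u
        have hpj := hJ.pos_le
        refine (Runs.of_wp ?_).mono (R := fun t' => t'.reg 3 = off (u + 1) ∧
          Building G off nbr K n (u + 1) (t'.arr 0) (t'.arr 1) (t'.reg 10)) (by decide)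
          fun _ _ h _ => by simpa using h
        simp [h2t, ha7t, hidxu, h3t]
        refine ⟨by omega, ?_⟩
        simpa [Store.setArr_arr, ha0t] using hI.keep hadj hu hKu hJ
    · have hKu : u ∉ K := by
        intro h'
        simp [h2₂, ha7₂, hidxu, h'] at heq
      refine (Runs.of_wp ?_).mono (R := fun t' => t'.reg 3 = off (u + 1) ∧
          Building G off nbr K n (u + 1) (t'.arr 0) (t'.arr 1) (t'.reg 10))
          ?_ fun _ _ h _ => by simpa using h
      · simp [h7₂]
        refine ⟨by omega, ?_⟩
        simpa [hs₂] using hI.drop hadj hu hKu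
      · simp [Prog.size, Expr.cost]
        omega
  · have := hadj.sum_off_sub
    simp only [Expr.cost, Finset.sum_add_distrib, ← Finset.mul_sum, this]
    simp; omega
  · rintro s' hf ⟨-, -, h'⟩
    have h9' := (hf.reg 9 rfl).trans h9
    refine (Runs.of_wp (Q := fun s' => s'.reg 0 = K.card ∧
      ∃ pos, Building G off nbr K n n (s'.arr 0) (s'.arr 1) pos) ?_).mono (by decide)
      fun _ _ h => h
    simp [h9']
    exact ⟨by omega, _, h'⟩

/-- Overwrite the instance by the path with three vertices and the parameter `1`, which serves as
the output when there are too many twin classes. -/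
def writePath : Prog :=
  .assign 0 3 ⨾ .assign 1 1 ⨾
  .write 0 0 0 ⨾ .write 0 1 1 ⨾ .write 0 2 3 ⨾ .write 0 3 4 ⨾
  .write 1 0 1 ⨾ .write 1 1 0 ⨾ .write 1 2 2 ⨾ .write 1 3 1

/-- The middle vertex alone and the two end vertices are maximal stable sets of different size. -/
theorem not_isKEquistable_path : ¬ IsKEquistable (SimpleGraph.pathGraph 3) 1 := by
  rintro ⟨w, t, h, hw⟩
  have hw1 : ∀ v, w v = 1 := fun v => le_antisymm (hw v) (h.weight_pos v)
  have h1 : IsMaximalStable (SimpleGraph.pathGraph 3) (({1} : Finset (Fin 3)) : Set (Fin 3)) := by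
    rw [isMaximalStable_iff]
    simp only [Finset.mem_coe, SimpleGraph.pathGraph_adj]
    decide
  have h2 : IsMaximalStable (SimpleGraph.pathGraph 3)
      (({0, 2} : Finset (Fin 3)) : Set (Fin 3)) := by
    rw [isMaximalStable_iff]
    simp only [Finset.mem_coe, SimpleGraph.pathGraph_adj]
    decide
  rw [h.maximal_iff] at h1 h2
  simp [hw1] at h1 h2
  omega

theorem isAdjacencyList_path {off nbr : ℕ → ℕ} (h0 : off 0 = 0) (h1 : off 1 = 1) (h2 : off 2 = 3)
    (h3 : off 3 = 4) (g0 : nbr 0 = 1) (g1 : nbr 1 = 0) (g2 : nbr 2 = 2) (g3 : nbr 3 = 1) :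
    IsAdjacencyList (SimpleGraph.pathGraph 3) off nbr := by
  have key : ∀ v : Fin 3, Fin.val '' (SimpleGraph.pathGraph 3).neighborSet v =
      ((Finset.univ.filter fun u : Fin 3 => v.val + 1 = u.val ∨ u.val + 1 = v.val).image
        Fin.val : Finset ℕ) := by
    intro v
    ext x
    simp [SimpleGraph.pathGraph_adj]
  have hbij : ∀ (lo hi a c : ℕ) (S : Finset ℕ), off lo = a → off hi = c →
      (∀ x y, a ≤ x → x < c → a ≤ y → y < c → nbr x = nbr y → x = y) →
      (Finset.Ico a c).image nbr = S → Set.BijOn nbr (Set.Ico (off lo) (off hi)) S := by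
    rintro lo hi a c S rfl rfl hinj rfl
    rw [Finset.coe_image, Finset.coe_Ico]
    exact Set.InjOn.bijOn_image fun x hx y hy => hinj x y hx.1 hx.2 hy.1 hy.2
  refine ⟨h0, fun v => ?_, fun v => ?_⟩
  · fin_cases v <;> simp [h0, h1, h2, h3]
  · rw [key]
    fin_cases v
    · refine hbij _ _ 0 1 _ h0 h1 (fun x y _ _ _ _ _ => by omega) ?_
      simp [g0]; decide
    · refine hbij _ _ 1 3 _ h1 h2 (fun x y _ _ _ _ _ => ?_) ?_
      · interval_cases x <;> interval_cases y <;> simp_all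
      · simp [show Finset.Ico 1 3 = {1, 2} from rfl, g1, g2]; decide
    · refine hbij _ _ 3 4 _ h2 h3 (fun x y _ _ _ _ _ => by omega) ?_
      simp [g3]; decide

/-- The kernelization. -/
def kernel : Prog :=
  refine ⨾ select ⨾ .branch (.bin .lt (2 * .reg 8 * .reg 1) (.reg 9)) writePath build

theorem runs_kernel {W n k : ℕ} {G : SimpleGraph (Fin n)} {s : Store} (h : Holds s G k)
    (hk : 0 < k) (hW : 2 * n + 2 * (2 * numEdges G) + 3 < W) (hkW : 6 * k ^ 4 < W) :
    Runs W kernel s (1000 * (n + numEdges G + 1)) (fun s' =>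
      ∃ (n' : ℕ) (G' : SimpleGraph (Fin n')) (k' : ℕ), Holds s' G' k' ∧ 0 < k' ∧ k' ≤ k ∧
        n' ≤ 6 * k ^ 4 ∧ (IsKEquistable G' k' ↔ IsKEquistable G k)) := by
  have hadj := h.adj.adjArrays
  have hoff := h.adj.off_eq
  have hp1 : 1 ≤ k ^ 4 := Nat.one_le_pow _ _ hk
  have hk2 : k ≤ k * k := Nat.le_mul_self k
  have hk3 : k * k ≤ k * k * k := Nat.le_mul_of_pos_right _ hk
  have hk4 : k * k * k ≤ k ^ 4 := by
    rw [show k ^ 4 = k * k * k * k by ring]; exact Nat.le_mul_of_pos_right _ hk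
  have hB : 3 * k * k * k = 3 * (k * k * k) := by ring
  have hB2 : 3 * k * k = 3 * (k * k) := by ring
  have hBk : 2 * (3 * k * k * k) * k = 6 * k ^ 4 := by ring
  generalize hL : 2 * n + 2 * s.arr 0 n + 2 = L
  refine Runs.seq (T₁ := 200 * (n + s.arr 0 n + 1)) (T₂ := 300 * (n + s.arr 0 n + 1))
    (runs_refine hadj h.reg_zero rfl rfl hL.symm (by omega)) (fun s₁ hf₁ h₁ => ?_) (by omega)
  refine Runs.seq (T₁ := 100 * (n + 1)) (T₂ := 150 * (n + s.arr 0 n + 1))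
    (runs_select ((hf₁.reg 0 rfl).trans h.reg_zero) ((hf₁.reg 1 rfl).trans h.reg_one)
      h₁.1.cls_lt h₁.2 rfl (by omega) (by omega) (by omega) (by omega) (by omega) (by omega)
      (by omega)) (fun s₂ hf₂ h₂ => ?_) (by omega)
  obtain ⟨h8, K, hK⟩ := h₂
  have h0₂ : s₂.reg 0 = n := (hf₂.reg 0 rfl).trans ((hf₁.reg 0 rfl).trans h.reg_zero)
  have h1₂ : s₂.reg 1 = k := (hf₂.reg 1 rfl).trans ((hf₁.reg 1 rfl).trans h.reg_one)
  have ha0₂ : s₂.arr 0 = s.arr 0 := (hf₂.arr 0 rfl).trans (hf₁.arr 0 rfl)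
  have ha1₂ : s₂.arr 1 = s.arr 1 := (hf₂.arr 1 rfl).trans (hf₁.arr 1 rfl)
  have hKn : K.card ≤ n := by simpa using Finset.card_le_card hK.subset
  have hq := hK.card
  rw [isKEquistable_iff_natGraph]
  refine Runs.branch (T₁ := 100 * (n + s.arr 0 n + 1) + 40) ?_ (fun hlt => ?_) (fun hge => ?_)
    (by simp [Expr.cost]; omega)
  · simp [h8, h1₂]
    split_ifs <;> omega
  · replace hlt : 6 * k ^ 4 < K.card := by
      simp [h8, h1₂] at hlt
      omega
    refine (Runs.of_wp (Q := fun s' => Holds s' (SimpleGraph.pathGraph 3) 1) ?_).mono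
      (Nat.le_add_left_of_le (by decide)) fun s' _ h' => ⟨3, _, 1, h', one_pos, hk, by omega, ?_⟩
    · simp [writePath]
      refine ⟨by omega, by omega, by omega, by omega, by omega, by omega, by omega, ?_⟩
      refine ⟨by simp, by simp, ?_⟩
      apply isAdjacencyList_path <;> simp
    · refine iff_of_false not_isKEquistable_path fun heq => ?_
      have := hK.card_le h₁.1 hadj.adj_lt heq
      omega
  · replace hge : K.card ≤ 6 * k ^ 4 := by
      simp [h8, h1₂] at hge
      omega
    refine (runs_build hadj h0₂ ha0₂ ha1₂ hK.subset hq hK.idx_eq (by omega)).mono (by omega) ?_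
    rintro s' hf ⟨h0, pos, hb⟩
    obtain ⟨G', hG', hiff⟩ := hb.exists_isAdjacencyList hK.subset
    refine ⟨K.card, G', k, ⟨h0, (hf.reg 1 rfl).trans h1₂, hG'⟩, hk, le_rfl, hge, ?_⟩
    rw [hiff, kEquistableOn_iff_of_twinDense hK.subset hk ?_ (hK.twinDense h₁.1)]
    have h1 : k * (2 * k * k) = 2 * (k * k * k) := by ring
    have h2 := Nat.mul_pos (Nat.mul_pos hk hk) hk
    omega

/-! ### Running through all digit vectors -/

theorem digit_zero_right (b m : ℕ) : digit b m 0 = m % b := by simp [digit]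

theorem digit_succ_right (b m i : ℕ) : digit b m (i + 1) = digit b (m / b) i := by
  rw [digit, digit, pow_succ', Nat.div_div_eq_div_mul]

theorem digit_eq_zero {b m k : ℕ} (h : m < b ^ k) : digit b m k = 0 := by
  rw [digit, Nat.div_eq_of_lt h, Nat.zero_mod]

theorem digit_pow_self {b : ℕ} (hb : 2 ≤ b) (k : ℕ) : digit b (b ^ k) k = 1 := by
  rw [digit, Nat.div_self (by positivity), Nat.mod_eq_of_lt (by omega)]

/-- Adding one increments the first digit that is not maximal and clears the digits before it. -/
theorem digit_succ {b : ℕ} (hb : 2 ≤ b) (i : ℕ) : ∀ m, (∀ l < i, digit b m l = b - 1) →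
    digit b m i ≠ b - 1 → ∀ l, digit b (m + 1) l =
      if l < i then 0 else if l = i then digit b m i + 1 else digit b m l := by
  induction i with
  | zero =>
    intro m _ hi l
    rw [digit_zero_right] at hi
    have hlt := Nat.mod_lt m (show 0 < b by omega)
    have hmod := Nat.div_add_mod m b
    have h1 : (m + 1) / b = m / b := by
      rw [Nat.div_eq_iff (by omega)]
      constructor
      · have := Nat.div_mul_le_self m b; omega
      · have : m / b * b = b * (m / b) := mul_comm _ _
        omega
    rcases l with _ | l
    · have h2 := Nat.div_add_mod (m + 1) b
      rw [h1] at h2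
      simp only [lt_self_iff_false, if_false, if_true, digit_zero_right]
      omega
    · simp [digit_succ_right, h1]
  | succ i ih =>
    intro m hlt hi l
    have h0 := hlt 0 (Nat.succ_pos i)
    rw [digit_zero_right] at h0
    have hmod := Nat.div_add_mod m b
    have hm : m + 1 = b * (m / b + 1) := by
      rw [mul_add, mul_one]; omega
    have h1 : (m + 1) / b = m / b + 1 := by
      rw [hm, Nat.mul_div_cancel_left _ (by omega)]
    rcases l with _ | l
    · rw [digit_zero_right, hm, Nat.mul_mod_right, if_pos (Nat.succ_pos i)]
    · simp only [digit_succ_right, h1, Nat.add_lt_add_iff_right, Nat.add_right_cancel_iff] at hi ⊢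
      refine ih (m / b) (fun l hl => ?_) hi l
      rw [← digit_succ_right]
      exact hlt (l + 1) (by omega)

/-- Increment the number whose digits are stored in the array `a`; the maximal digit is in
register `0`. -/
def increment (a : ℕ) : Prog :=
  .assign 16 0 ⨾
  .loop (.bin .eq (.get a (.reg 16)) (.reg 0)) (.write a (.reg 16) 0 ⨾ .assign 16 (.reg 16 + 1)) ⨾
  .write a (.reg 16) (.get a (.reg 16) + 1)

/-- Repeat the body for all digit vectors. The digits are stored in the first cells of the array
`a`, their number is in register `1`, and the maximal digit is in register `0`. One more digit
signals the overflow. -/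
def odometer (a : ℕ) (body : Prog) : Prog :=
  .assign 16 0 ⨾
  .upTo 16 (.reg 1 + 1) (.write a (.reg 16) 0) ⨾
  .loop (.bin .eq (.get a (.reg 1)) 0) (body ⨾ increment a)

theorem runs_increment {W a n k m : ℕ} {s : Store} (hn : s.reg 0 = n) (hn0 : 0 < n)
    (hnW : n + 1 ≤ W) (hkW : k + 2 ≤ W) (hm : m < (n + 1) ^ k)
    (hdig : ∀ i ≤ k, s.arr a i = digit (n + 1) m i) :
    Runs W (increment a) s (14 * k + 30)
      (fun s' => ∀ i ≤ k, s'.arr a i = digit (n + 1) (m + 1) i) := by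
  have hex : ∃ i, digit (n + 1) m i ≠ n := ⟨k, by rw [digit_eq_zero hm]; omega⟩
  classical
  obtain ⟨i, hi, hmin⟩ : ∃ i, digit (n + 1) m i ≠ n ∧ ∀ l < i, digit (n + 1) m l = n :=
    ⟨Nat.find hex, Nat.find_spec hex, fun l hl => not_not.1 (Nat.find_min hex hl)⟩
  have hik : i ≤ k := by
    by_contra h
    have := hmin k (by omega)
    rw [digit_eq_zero hm] at this
    omega
  have hle : ∀ l, digit (n + 1) m l ≤ n := fun l =>
    Nat.le_of_lt_succ (Nat.mod_lt _ (Nat.succ_pos n))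
  have hsucc := digit_succ (b := n + 1) (by omega) i m (by simpa using hmin) (by simpa using hi)
  refine Runs.wp_seq (T₂ := 14 * k + 28) ?_ (by simp [Prog.size, Expr.cost]; omega)
  simp only [Prog.wp]
  refine ⟨by simp, fun _ => ?_⟩
  set s₁ := s.setReg 16 _ with hs₁
  refine Runs.seq (T₁ := 14 * k + 14) (T₂ := 10) (Runs.loop
    (fun j s' => s'.reg 16 = j ∧ (∀ l < j, s'.arr a l = 0) ∧
      ∀ l, j ≤ l → l ≤ k → s'.arr a l = digit (n + 1) m l) i (fun _ => 8) ?_ ?_ ?_ ?_) ?_ (by omega)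
  · exact ⟨by simp [hs₁], by simp, fun l _ hl => by simpa [hs₁] using hdig l hl⟩
  · rintro j hj s' hf ⟨h16, hz, hd⟩
    have h0 : s'.reg 0 = n := (hf.reg 0 rfl).trans (by simp [hs₁, hn])
    have hdj := hd j le_rfl (by omega)
    rw [hmin j hj] at hdj
    refine ⟨by simp [h16, hdj, h0]; omega, by simp [h16, hdj, h0], ?_⟩
    refine (Runs.of_wp ?_).mono (R := fun s'' => s''.reg 16 = j + 1 ∧
      (∀ l < j + 1, s''.arr a l = 0) ∧ ∀ l, j + 1 ≤ l → l ≤ k → s''.arr a l = digit (n + 1) m l)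
      (by simp [Prog.size, Expr.cost]) fun _ _ h => h
    simp [h16]
    refine ⟨by omega, by omega, fun l hl hlj => hz l (by omega), fun l hl hlk => ?_⟩
    rw [if_neg (by omega)]
    exact hd l (by omega) hlk
  · rintro s' hf ⟨h16, hz, hd⟩
    have h0 : s'.reg 0 = n := (hf.reg 0 rfl).trans (by simp [hs₁, hn])
    have hdi := hd i le_rfl hik
    have := hle i
    simp [h16, hdi, h0, hi]
    omega
  · simp [Expr.cost]
    omega
  · rintro s' hf ⟨h16, hz, hd⟩
    have hdi := hd i le_rfl hik
    have := hle i
    refine (Runs.of_wp (Q := fun s'' => ∀ l ≤ k, s''.arr a l = digit (n + 1) (m + 1) l) ?_).mono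
      (by simp [Prog.size, Expr.cost]) fun _ _ h => h
    simp [h16, hdi]
    refine ⟨by omega, fun l hl => ?_⟩
    rw [hsucc l]
    rcases lt_trichotomy l i with h | h | h
    · rw [if_neg h.ne, if_pos h, hz l h]
    · simp [h]
    · rw [if_neg h.ne', if_neg (by omega), if_neg h.ne', hd l h.le hl]

/-- The rule for `odometer`: the invariant `J` may depend neither on the digits nor on the register
that is used to increment them. -/
theorem Runs.odometer {W a n k c T : ℕ} {s : Store} {body : Prog} (J : ℕ → Store → Prop)
    (hn : s.reg 0 = n) (hk : s.reg 1 = k) (hn0 : 0 < n) (hnW : n + 1 ≤ W) (hkW : k + 2 ≤ W)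
    (hb0 : body.modReg 0 = false) (hb1 : body.modReg 1 = false) (hba : body.modArr a = false)
    (hJ : ∀ m s₁ s₂, (∀ r, r ≠ 16 → s₂.reg r = s₁.reg r) →
      (∀ a', a' ≠ a → s₂.arr a' = s₁.arr a') → J m s₁ → J m s₂)
    (h0 : J 0 s)
    (hbody : ∀ m < (n + 1) ^ k, ∀ s', Frame (odometer a body) s s' →
      (∀ i ≤ k, s'.arr a i = digit (n + 1) m i) → J m s' → Runs W body s' c (J (m + 1)))
    (hT : (n + 1) ^ k * (c + 40 * (k + 1)) + 40 * (k + 1) ≤ T) :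
    Runs W (odometer a body) s T (J ((n + 1) ^ k)) := by
  refine Runs.wp_seq (T₂ := (n + 1) ^ k * (c + 40 * (k + 1)) + 38 * (k + 1)) ?_
    (by simp [Prog.size, Expr.cost]; omega)
  simp only [Prog.wp]
  refine ⟨by simp, fun hf₁ => ?_⟩
  set s₁ := s.setReg 16 _ with hs₁
  have h1 : s₁.reg 1 = k := by simp [hs₁, hk]
  have hinit : ∀ {p : Prog} {s s' : Store}, Frame p s s' → (∀ r, r ≠ 16 → p.modReg r = false) →
      (∀ a', a' ≠ a → p.modArr a' = false) → ∀ m, J m s → J m s' :=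
    fun hf hr ha m h => hJ m _ _ (fun r h' => hf.reg r (hr r h')) (fun a' h' => hf.arr a' (ha a' h')) h
  have hodo : ∀ {p : Prog} {s s' : Store}, Frame p s s' → (∀ r, r ≠ 16 → p.modReg r = false) →
      (∀ a', a' ≠ a → p.modArr a' = false) → Frame (Equistability.odometer a body) s s' :=
    fun hf hr ha => hf.mono (fun r h => hr r (by rintro rfl; simp [Equistability.odometer, Prog.modReg] at h))
      fun a' h => ha a' (by rintro rfl; simp [Equistability.odometer, increment, Prog.upTo, Prog.modArr] at h)
  refine Runs.seq (T₁ := 15 * (k + 1) + 5) (T₂ := (n + 1) ^ k * (c + 40 * (k + 1)) + 5)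
    (Runs.upTo_const (fun j s' => ∀ i < j, s'.arr a i = 0) 0 (k + 1) 3 (Nat.zero_le _)
      (by simp [hs₁]) (by simp) rfl hkW ?_ ?_ ?_) (fun s₂ hf₂ h₂ => ?_) (by omega)
  · intro i s' hf _
    have := (hf.reg 1 rfl).trans h1
    simp [this]; omega
  · intro i _ hi s' hf h16 hI
    refine (Runs.of_wp ?_).mono (R := fun s'' => ∀ j < i + 1, s''.arr a j = 0)
      (by simp [Prog.size, Expr.cost]) fun _ _ h _ => by simpa using h
    simp [h16]
    refine ⟨by omega, fun j hj hji => hI j (by omega)⟩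
  · simp [Expr.cost]; omega
  have hfr₂ : Frame (Equistability.odometer a body) s s₂ :=
    (hodo hf₁ (fun r hr => by simp [Prog.modReg, hr.symm]) (by simp [Prog.modArr])).trans
      (hodo hf₂ (fun r hr => by simp [Prog.upTo, Prog.modReg, hr.symm])
        (fun r hr => by simp [Prog.upTo, Prog.modArr, hr.symm]))
  have hJ₂ : J 0 s₂ := hinit hf₂ (fun r hr => by simp [Prog.upTo, Prog.modReg, hr.symm])
    (fun r hr => by simp [Prog.upTo, Prog.modArr, hr.symm]) 0
    (hinit hf₁ (fun r hr => by simp [Prog.modReg, hr.symm]) (by simp [Prog.modArr]) 0 h0)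
  have h0₂ : s₂.reg 0 = n := by
    rw [hf₂.reg 0 (by simp [Prog.upTo, Prog.modReg])]; simp [hs₁, hn]
  have h1₂ : s₂.reg 1 = k := by
    rw [hf₂.reg 1 (by simp [Prog.upTo, Prog.modReg])]; exact h1
  have hcond : ∀ m ≤ (n + 1) ^ k, ∀ s', Frame (body ⨾ increment a) s₂ s' →
      (∀ i ≤ k, s'.arr a i = digit (n + 1) m i) →
      s'.reg 0 = n ∧ s'.reg 1 = k ∧ s'.arr a k = digit (n + 1) m k ∧ digit (n + 1) m k ≤ n := by
    intro m _ s' hf hd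
    exact ⟨(hf.reg 0 (by simp [Prog.modReg, increment, hb0])).trans h0₂,
      (hf.reg 1 (by simp [Prog.modReg, increment, hb1])).trans h1₂, hd k le_rfl,
      Nat.le_of_lt_succ (Nat.mod_lt _ (Nat.succ_pos n))⟩
  refine (Runs.loop (fun m s' => (∀ i ≤ k, s'.arr a i = digit (n + 1) m i) ∧ J m s')
    ((n + 1) ^ k) (fun _ => c + (14 * k + 30)) ⟨?_, hJ₂⟩ ?_ ?_ ?_).mono le_rfl fun _ _ h => h.2
  · intro i hi
    rw [h₂.2 i (by omega)]
    simp [digit]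
  · rintro m hm s' hf ⟨hd, hJm⟩
    obtain ⟨h0', h1', hak, hle⟩ := hcond m hm.le s' hf hd
    rw [digit_eq_zero hm] at hak
    refine ⟨by simp [h1', hak]; omega, by simp [h1', hak], ?_⟩
    have hfs : Frame (Equistability.odometer a body) s s' := hfr₂.trans
      (hf.mono (by simp [Equistability.odometer, Prog.modReg])
        (by simp [Equistability.odometer, Prog.modArr]))
    refine Runs.seq (hbody m hm s' hfs hd hJm) (fun s₃ hf₃ h₃ => ?_) le_rfl
    refine (runs_increment ((hf₃.reg 0 hb0).trans h0') hn0 hnW hkW hm ?_).mono le_rfl ?_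
    · rw [hf₃.arr a hba]
      exact hd
    · exact fun s₄ hf₄ h₄ => ⟨h₄, hinit hf₄ (fun r hr => by simp [increment, Prog.modReg, hr.symm])
        (fun r hr => by simp [increment, Prog.modArr, hr.symm]) _ h₃⟩
  · rintro s' hf ⟨hd, hJm⟩
    obtain ⟨h0', h1', hak, hle⟩ := hcond _ le_rfl s' hf hd
    rw [digit_pow_self (by omega)] at hak
    simp [h1', hak]
    omega
  · simp only [Finset.sum_const, Finset.card_range, smul_eq_mul, Expr.cost]
    refine Nat.add_le_add (Nat.mul_le_mul_left _ (by omega)) (by omega)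

/-! ### Exhaustive search -/

open Classical in
/-- The truth value of a proposition as a number. -/
noncomputable def ind (p : Prop) : ℕ := if p then 1 else 0

theorem ind_of_true {p : Prop} (h : p) : ind p = 1 := if_pos h

theorem ind_of_false {p : Prop} (h : ¬ p) : ind p = 0 := if_neg h

theorem ind_le_one (p : Prop) : ind p ≤ 1 := by
  unfold ind; split_ifs <;> simp

/-- Test one vertex set. Array `9` holds the weights and array `10` the bounds that describe the set
as in `cutSet`. Array `11` receives the indicator function of the set, register `17` its weight, and
register `18` whether it is maximal stable. Register `12` is cleared if the set is maximal stable but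
its weight differs from the target in register `13`, or vice versa. -/
def testSet : Prog :=
  (.assign 17 0 ⨾ .assign 2 0) ⨾
  .upTo 2 (.reg 0)
    (.write 11 (.reg 2) (.bin .lt (.reg 2) (.get 10 (.get 9 (.reg 2) - 1))) ⨾
     .assign 17 (.reg 17 + .get 11 (.reg 2) * .get 9 (.reg 2))) ⨾
  (.assign 18 1 ⨾ .assign 2 0) ⨾
  .upTo 2 (.reg 0)
    ((.assign 19 0 ⨾ .assign 3 (.get 0 (.reg 2)) ⨾ .assign 7 (.get 0 (.reg 2 + 1))) ⨾
     .upTo 3 (.reg 7) (.assign 19 (.reg 19 + .get 11 (.get 1 (.reg 3)))) ⨾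
     .branch (.bin .eq (.get 11 (.reg 2)) (.bin .lt 0 (.reg 19))) (.assign 18 0) .nop) ⨾
  .branch (.bin .eq (.bin .eq (.reg 17) (.reg 13)) (.reg 18)) .nop (.assign 12 0)

theorem mem_cutSet {n v : ℕ} {w d : ℕ → ℕ} (hv : v < n) :
    v ∈ cutSet n w d ↔ v < d (w v - 1) := by
  simp [cutSet, hv]

theorem runs_testSet {G : SimpleGraph ℕ} {W n k t : ℕ} {s : Store} {off nbr w d : ℕ → ℕ}
    (hadj : AdjArrays G n off nbr) (hn : s.reg 0 = n) (hk : 0 < k) (ht : s.reg 13 = t)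
    (htW : t ≤ W) (hoff : s.arr 0 = off) (hnbr : s.arr 1 = nbr)
    (hw : ∀ v < n, s.arr 9 v = w v) (hwk : ∀ v, w v ≤ k)
    (hd : ∀ i < k, s.arr 10 i = d i) (hdn : ∀ i, d i ≤ n)
    (hW : k * n + n + k + 3 < W) (hoffW : off n + 3 < W) :
    Runs W testSet s (150 * (n + off n + 1)) (fun s' =>
      ((MaxStableOn G (Finset.range n) (cutSet n w d) ↔ ∑ x ∈ cutSet n w d, w x = t) →
        s'.reg 12 = s.reg 12) ∧
      (¬ (MaxStableOn G (Finset.range n) (cutSet n w d) ↔ ∑ x ∈ cutSet n w d, w x = t) →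
        s'.reg 12 = 0)) := by
  have hmem : ∀ v < n, (v ∈ cutSet n w d ↔ v < d (w v - 1)) := fun v hv => mem_cutSet hv
  generalize hC : cutSet n w d = C at *
  have hCn : C ⊆ Finset.range n := by rw [← hC]; exact Finset.filter_subset _ _
  have hmulle : ∀ u ≤ n, u * k ≤ k * n := fun u hu => by
    rw [mul_comm]; exact Nat.mul_le_mul_left k hu
  refine Runs.wp_seq (T₂ := 140 * (n + off n + 1)) ?_ (by simp [Prog.size, Expr.cost]; omega)
  simp only [Prog.wp]
  refine ⟨by simp, by simp, fun hf₁ => ?_⟩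
  set s₁ := (s.setReg 17 _).setReg 2 _ with hs₁
  have h0₁ : s₁.reg 0 = n := by simp [hs₁, hn]
  have h9₁ : ∀ v < n, s₁.arr 9 v = w v := by simpa [hs₁] using hw
  have h10₁ : ∀ i < k, s₁.arr 10 i = d i := by simpa [hs₁] using hd
  refine Runs.seq (T₁ := 30 * (n + 1)) (T₂ := 100 * (n + off n + 1)) (Runs.upTo_const
    (fun u s' => (∀ x < u, s'.arr 11 x = ind (x ∈ C)) ∧
      s'.reg 17 = ∑ x ∈ Finset.range u, ind (x ∈ C) * w x ∧ s'.reg 17 ≤ u * k) 0 n 18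
    (Nat.zero_le n) (by simp [hs₁]) (by simp [hs₁]) rfl (by omega) ?_ ?_ ?_)
    (fun s₂ hf₂ h₂ => ?_) (by omega)
  · intro i s' hf _
    have := (hf.reg 0 rfl).trans h0₁
    simp [this]; omega
  · rintro u _ hu s' hf h2 ⟨hI, hsum, hle⟩
    have h9u := (congrFun (hf.arr 9 rfl) u).trans (h9₁ u hu)
    have hwu := hwk u
    have h10u := (congrFun (hf.arr 10 rfl) (w u - 1)).trans (h10₁ (w u - 1) (by omega))
    have hdu := hdn (w u - 1)
    have hmu := hmem u hu
    have hmul := hmulle (u + 1) hu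
    rw [Nat.succ_mul] at hmul
    have hif : (if u < d (w u - 1) then 1 else 0) = ind (u ∈ C) := by
      unfold ind; simp only [hmu]
    have hind := ind_le_one (u ∈ C)
    have hprod : ind (u ∈ C) * w u ≤ w u := by
      calc ind (u ∈ C) * w u ≤ 1 * w u := Nat.mul_le_mul_right _ hind
        _ = w u := one_mul _
    refine (Runs.of_wp ?_).mono (R := fun s'' => (∀ x < u + 1, s''.arr 11 x = ind (x ∈ C)) ∧
      s''.reg 17 = ∑ x ∈ Finset.range (u + 1), ind (x ∈ C) * w x ∧ s''.reg 17 ≤ (u + 1) * k)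
      (by decide) fun _ _ h _ => by simpa using h
    simp [h2, h9u, h10u, hif, Finset.sum_range_succ, hsum]
    rw [hsum] at hle
    refine ⟨by omega, by omega, fun x hx => ?_, ?_⟩
    · split_ifs with hxu
      · rw [hxu]
      · exact hI x (by omega)
    · rw [Nat.succ_mul]
      omega
  · simp [Expr.cost]; omega
  obtain ⟨-, h11₂, h17₂, hle₂⟩ := h₂
  have hsumC : s₂.reg 17 = ∑ x ∈ C, w x := by
    classical
    have hfilter : (Finset.range n).filter (· ∈ C) = C := by
      rw [Finset.filter_mem_eq_inter, Finset.inter_eq_right.2 hCn]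
    rw [h17₂]
    conv_rhs => rw [← hfilter]
    rw [Finset.sum_filter]
    refine Finset.sum_congr rfl fun x _ => ?_
    unfold ind
    split_ifs <;> simp
  have h0₂ := (hf₂.reg 0 rfl).trans h0₁
  have h12₂ : s₂.reg 12 = s.reg 12 := (hf₂.reg 12 rfl).trans (by simp [hs₁])
  have h13₂ : s₂.reg 13 = t := (hf₂.reg 13 rfl).trans (by simp [hs₁, ht])
  have ha0₂ : s₂.arr 0 = off := (hf₂.arr 0 rfl).trans (by simp [hs₁, hoff])
  have ha1₂ : s₂.arr 1 = nbr := (hf₂.arr 1 rfl).trans (by simp [hs₁, hnbr])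
  refine Runs.wp_seq (T₂ := 90 * (n + off n + 1)) ?_ (by simp [Prog.size, Expr.cost]; omega)
  simp only [Prog.wp]
  refine ⟨by simp; omega, by simp, fun hf₃ => ?_⟩
  set s₃ := (s₂.setReg 18 _).setReg 2 _ with hs₃
  have h0₃ : s₃.reg 0 = n := by simp [hs₃, h0₂]
  have ha0₃ : s₃.arr 0 = off := by simp [hs₃, ha0₂]
  have ha1₃ : s₃.arr 1 = nbr := by simp [hs₃, ha1₂]
  have h11₃ : ∀ x < n, s₃.arr 11 x = ind (x ∈ C) := by simpa [hs₃] using h11₂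
  have h12₃ : s₃.reg 12 = s.reg 12 := by simp [hs₃, h12₂]
  have h13₃ : s₃.reg 13 = t := by simp [hs₃, h13₂]
  have h17₃ : s₃.reg 17 = ∑ x ∈ C, w x := by simp [hs₃, hsumC]
  refine Runs.seq (T₁ := 70 * (n + off n + 1)) (T₂ := 10) (Runs.upTo
    (fun u s' => s'.reg 18 = ind (∀ v < u, (v ∈ C ↔ ∀ x ∈ C, ¬ G.Adj v x))) 0 n
    (fun v => 40 + 20 * (off (v + 1) - off v))
    (Nat.zero_le n) (by simp [hs₃]) ?_ rfl (by omega) ?_ ?_ ?_) ?_ (by omega)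
  · rw [ind_of_true (by simp)]; simp [hs₃]
  · intro i s' hf _
    have := (hf.reg 0 rfl).trans h0₃
    simp [this]; omega
  · intro v _ hv s' hf h2 hI
    have hle := hadj.off_le v hv
    have hlen := hadj.off_mono (u := v + 1) hv le_rfl
    have ha0' := (hf.arr 0 rfl).trans ha0₃
    have ha1' := (hf.arr 1 rfl).trans ha1₃
    have h11' : ∀ x < n, s'.arr 11 x = ind (x ∈ C) := by rw [hf.arr 11 rfl]; exact h11₃
    refine Runs.wp_seq (T₂ := 29 + 20 * (off (v + 1) - off v)) ?_
      (by simp [Prog.size, Expr.cost]; omega)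
    simp only [Prog.wp]
    refine ⟨by simp, by simp [h2, ha0']; omega, by simp [h2, ha0']; omega, fun hf₄ => ?_⟩
    set s₄ := ((s'.setReg 19 _).setReg 3 _).setReg 7 _ with hs₄
    have h7₄ : s₄.reg 7 = off (v + 1) := by simp [hs₄, ha0', h2]
    have h2₄ : s₄.reg 2 = v := by simp [hs₄, h2]
    have ha1₄ : s₄.arr 1 = nbr := by simp [hs₄, ha1']
    have h11₄ : ∀ x < n, s₄.arr 11 x = ind (x ∈ C) := by simpa [hs₄] using h11'
    have h18₄ : s₄.reg 18 = ind (∀ u < v, (u ∈ C ↔ ∀ x ∈ C, ¬ G.Adj u x)) := by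
      simpa [hs₄] using hI
    refine Runs.seq (T₁ := 7 + 20 * (off (v + 1) - off v)) (T₂ := 20) (Runs.upTo_const
      (fun j s' => s'.reg 19 + off v ≤ j ∧
        (0 < s'.reg 19 ↔ ∃ i, off v ≤ i ∧ i < j ∧ nbr i ∈ C)) (off v) (off (v + 1)) 6
      hle (by simp [hs₄, ha0', h2]) ?_ rfl (by omega) ?_ ?_ ?_) ?_ (by omega)
    · refine ⟨by simp [hs₄], iff_of_false (by simp [hs₄]) ?_⟩
      rintro ⟨i, h1, h2, -⟩
      omega
    · intro i t' hf _
      have := (hf.reg 7 rfl).trans h7₄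
      simp [this]; omega
    · rintro j hj hj' t' hft h3t ⟨hJ1, hJ2⟩
      have hjn := hadj.adj_lt _ _ (hadj.adj_nbr hv hj hj')
      have ha1t := (hft.arr 1 rfl).trans ha1₄
      have h11t := (congrFun (hft.arr 11 rfl) (nbr j)).trans (h11₄ _ hjn)
      have hind := ind_le_one (nbr j ∈ C)
      refine (Runs.of_wp ?_).mono (R := fun s' => s'.reg 19 + off v ≤ j + 1 ∧
        (0 < s'.reg 19 ↔ ∃ i, off v ≤ i ∧ i < j + 1 ∧ nbr i ∈ C)) (by decide)
        fun _ _ h _ => by simpa using h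
      simp [h3t, ha1t, h11t]
      refine ⟨by omega, by omega, ?_⟩
      by_cases hjC : nbr j ∈ C
      · rw [ind_of_true hjC]
        exact iff_of_true (Or.inr one_pos) ⟨j, hj, le_rfl, hjC⟩
      · rw [ind_of_false hjC, hJ2]
        simp only [lt_self_iff_false, or_false]
        constructor
        · rintro ⟨i, h1, h2, h3⟩
          exact ⟨i, h1, by omega, h3⟩
        · rintro ⟨i, h1, h2, h3⟩
          rcases Nat.lt_or_eq_of_le h2 with h2 | rfl
          · exact ⟨i, h1, h2, h3⟩
          · exact absurd h3 hjC
    · simp [Expr.cost]; omega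
    · rintro t' hft ⟨-, hJ1, hJ2⟩
      have h2t := (hft.reg 2 rfl).trans h2₄
      have h18t := (hft.reg 18 rfl).trans h18₄
      have h11t := (congrFun (hft.arr 11 rfl) v).trans (h11₄ v hv)
      have hJ3 : 0 < t'.reg 19 ↔ ¬ ∀ x ∈ C, ¬ G.Adj v x := by
        rw [hJ2]
        push Not
        constructor
        · rintro ⟨i, h1, h2, h3⟩
          exact ⟨_, h3, hadj.adj_nbr hv h1 h2⟩
        · rintro ⟨x, hx, hvx⟩
          obtain ⟨i, h1, h2, rfl⟩ := (hadj.adj_iff hv).1 hvx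
          exact ⟨i, h1, h2, hx⟩
      refine (Runs.of_wp ?_).mono
        (R := fun s' => s'.reg 18 = ind (∀ u < v + 1, (u ∈ C ↔ ∀ x ∈ C, ¬ G.Adj u x)))
        (by decide) fun _ _ h _ => by simpa using h
      have hsucc : (∀ u < v + 1, (u ∈ C ↔ ∀ x ∈ C, ¬ G.Adj u x)) ↔
          (∀ u < v, (u ∈ C ↔ ∀ x ∈ C, ¬ G.Adj u x)) ∧ (v ∈ C ↔ ∀ x ∈ C, ¬ G.Adj v x) := by
        rw [Nat.forall_lt_succ_right]
      rw [hsucc]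
      by_cases hvC : v ∈ C <;> by_cases hcnt : 0 < t'.reg 19
      · have hfin : ¬ (v ∈ C ↔ ∀ x ∈ C, ¬ G.Adj v x) := fun h' => hJ3.1 hcnt (h'.1 hvC)
        rw [ind_of_true hvC] at h11t
        rw [ind_of_false fun h' => hfin h'.2]
        simp [h2t, h11t, hcnt]
        omega
      · have hfin : (v ∈ C ↔ ∀ x ∈ C, ¬ G.Adj v x) :=
          iff_of_true hvC (by_contra fun h' => hcnt (hJ3.2 h'))
        rw [ind_of_true hvC] at h11t
        simp only [hfin, and_true]
        simp [h2t, h11t, hcnt, h18t]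
        omega
      · have hfin : (v ∈ C ↔ ∀ x ∈ C, ¬ G.Adj v x) := iff_of_false hvC (hJ3.1 hcnt)
        rw [ind_of_false hvC] at h11t
        simp only [hfin, and_true]
        simp [h2t, h11t, hcnt, h18t]
        omega
      · have hfin : ¬ (v ∈ C ↔ ∀ x ∈ C, ¬ G.Adj v x) := fun h' =>
          hcnt (hJ3.2 fun h'' => hvC (h'.2 h''))
        rw [ind_of_false hvC] at h11t
        rw [ind_of_false fun h' => hfin h'.2]
        simp [h2t, h11t, hcnt]
        omega
  · have := hadj.sum_off_sub
    simp only [Expr.cost, Finset.sum_add_distrib, ← Finset.mul_sum, this]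
    simp; omega
  · rintro s₅ hf₅ ⟨-, h18⟩
    have h12 := (hf₅.reg 12 rfl).trans h12₃
    have h13 := (hf₅.reg 13 rfl).trans h13₃
    have h17 := (hf₅.reg 17 rfl).trans h17₃
    have hle : ∑ x ∈ C, w x ≤ k * n := by
      have := hmulle n le_rfl
      omega
    have hMS : MaxStableOn G (Finset.range n) C ↔
        ∀ v < n, (v ∈ C ↔ ∀ x ∈ C, ¬ G.Adj v x) := by
      simp [MaxStableOn, hCn]
    rw [← hMS] at h18
    refine (Runs.of_wp (Q := fun s' => ((MaxStableOn G (Finset.range n) C ↔ ∑ x ∈ C, w x = t) →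
        s'.reg 12 = s.reg 12) ∧ (¬ (MaxStableOn G (Finset.range n) C ↔ ∑ x ∈ C, w x = t) →
        s'.reg 12 = 0)) ?_).mono (by decide) fun _ _ h => h
    by_cases h1 : MaxStableOn G (Finset.range n) C <;> by_cases h2 : ∑ x ∈ C, w x = t
    · rw [ind_of_true h1] at h18
      simp [h1, h2, h12, h13, h17, h18]; omega
    · rw [ind_of_true h1] at h18
      simp [h1, h2, h13, h17, h18]; omega
    · rw [ind_of_false h1] at h18
      simp [h1, h2, h13, h17, h18]; omega
    · rw [ind_of_false h1] at h18
      simp [h1, h2, h12, h13, h17, h18]; omega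

theorem weightOf_zero (G : SimpleGraph ℕ) (H : ℕ → ℕ) (v : ℕ) : weightOf G 0 H v = 0 := rfl

theorem weightOf_succ_of_cond {G : SimpleGraph ℕ} {k v : ℕ} {H : ℕ → ℕ}
    (h0 : weightOf G k H v = 0) (h1 : v < H k) (h2 : Twin G (H k - 1) v) :
    weightOf G (k + 1) H v = k + 1 := by
  classical
  unfold weightOf at h0 ⊢
  rw [firstIndex, if_pos ⟨h0, h1, h2⟩]

theorem weightOf_succ_of_not {G : SimpleGraph ℕ} {k v : ℕ} {H : ℕ → ℕ}
    (h : ¬ (weightOf G k H v = 0 ∧ v < H k ∧ Twin G (H k - 1) v)) :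
    weightOf G (k + 1) H v = weightOf G k H v := by
  classical
  unfold weightOf at h ⊢
  rw [firstIndex, if_neg h]

theorem weightOf_le (G : SimpleGraph ℕ) (k : ℕ) (H : ℕ → ℕ) (v : ℕ) : weightOf G k H v ≤ k := by
  classical
  exact firstIndex_le _ _

/-- Write the weight function that array `8` describes to array `9`. Array `2` holds the twin
classes. -/
def assignWeights : Prog :=
  .assign 2 0 ⨾
  .upTo 2 (.reg 0)
    ((.write 9 (.reg 2) 0 ⨾ .assign 3 0) ⨾
     .upTo 3 (.reg 1)
      (.branch (.bin .eq (.get 9 (.reg 2)) 0 * .bin .lt (.reg 2) (.get 8 (.reg 3)) *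
          (.bin .eq (.get 2 (.get 8 (.reg 3) - 1)) (.get 2 (.reg 2)) +
           .bin .eq (.get 2 (.reg 0 + (.get 8 (.reg 3) - 1))) (.get 2 (.reg 0 + .reg 2))))
        (.write 9 (.reg 2) (.reg 3 + 1)) .nop))

theorem runs_assignWeights {G : SimpleGraph ℕ} {W n k L : ℕ} {s : Store} {H : ℕ → ℕ}
    (hn : s.reg 0 = n) (hk : s.reg 1 = k) (hcls : TwinLabels G n L (s.arr 2))
    (hH : ∀ i < k, s.arr 8 i = H i) (hHn : ∀ i, H i ≤ n) (hLW : L < W) (hnW : 2 * n + 2 < W)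
    (hkW : k + 1 < W) :
    Runs W assignWeights s (80 * ((n + 1) * (k + 1)))
      (fun s' => ∀ v < n, s'.arr 9 v = weightOf G k H v) := by
  have hT : (n + 1) * (k + 1) = n * (k + 1) + (k + 1) := by ring
  refine Runs.wp_seq (T₂ := 80 * (n * (k + 1)) + 10) ?_ (by simp [Prog.size, Expr.cost]; omega)
  simp only [Prog.wp]
  refine ⟨by simp, fun hf₁ => ?_⟩
  set s₁ := s.setReg 2 _ with hs₁
  have h0₁ : s₁.reg 0 = n := by simp [hs₁, hn]
  have h1₁ : s₁.reg 1 = k := by simp [hs₁, hk]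
  refine (Runs.upTo_const (fun v s' => ∀ x < v, s'.arr 9 x = weightOf G k H x) 0 n
    (55 * (k + 1)) (Nat.zero_le n) (by simp [hs₁]) (by simp) rfl (by omega) ?_ ?_ ?_).mono
    le_rfl fun _ _ h => h.2
  · intro i s' hf _
    have := (hf.reg 0 rfl).trans h0₁
    simp [this]; omega
  · intro v _ hv s' hf h2 hI
    have h0' := (hf.reg 0 rfl).trans h0₁
    have h1' := (hf.reg 1 rfl).trans h1₁
    have ha2' : s'.arr 2 = s.arr 2 := (hf.arr 2 rfl).trans (by simp [hs₁])
    have h8' : ∀ i < k, s'.arr 8 i = H i := fun i hi =>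
      (congrFun (hf.arr 8 rfl) i).trans (by simpa [hs₁] using hH i hi)
    refine Runs.wp_seq (T₂ := 52 * k + 30) ?_ (by simp [Prog.size, Expr.cost]; omega)
    simp only [Prog.wp]
    refine ⟨by simp [h2]; omega, by simp, fun hf₂ => ?_⟩
    set s₂ := (s'.setArr 9 _ _).setReg 3 _ with hs₂
    refine (Runs.upTo_const (fun i t => (∀ x < v, t.arr 9 x = weightOf G k H x) ∧
      t.arr 9 v = weightOf G i H v) 0 k 42 (Nat.zero_le k) (by simp [hs₂]) ?_ rfl (by omega)
      ?_ ?_ ?_).mono le_rfl ?_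
    · refine ⟨fun x hx => ?_, by simp [hs₂, h2, weightOf_zero]⟩
      simpa [hs₂, h2, hx.ne] using hI x hx
    · intro i t hft _
      have : t.reg 1 = k := (hft.reg 1 rfl).trans (by simp [hs₂, h1'])
      simp [this]; omega
    · rintro i _ hi t hft h3t ⟨hJ1, hJ2⟩
      have h0t : t.reg 0 = n := (hft.reg 0 rfl).trans (by simp [hs₂, h0'])
      have h2t : t.reg 2 = v := (hft.reg 2 rfl).trans (by simp [hs₂, h2])
      have ha2t : t.arr 2 = s.arr 2 := (hft.arr 2 rfl).trans (by simp [hs₂, Store.setArr_arr, ha2'])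
      have h8t : t.arr 8 i = H i :=
        (congrFun (hft.arr 8 rfl) i).trans (by simpa [hs₂] using h8' i hi)
      have hHi := hHn i
      have hl1 := hcls.cls_lt (H i - 1) (by omega)
      have hl2 := hcls.cls_lt v (by omega)
      have hl3 := hcls.cls_lt (n + (H i - 1)) (by omega)
      have hl4 := hcls.cls_lt (n + v) (by omega)
      have hF := hcls.falseTwin_iff (H i - 1) (by omega) v hv
      have hT := hcls.trueTwin_iff (H i - 1) (by omega) v hv
      have htw : s.arr 2 (H i - 1) = s.arr 2 v ∨ s.arr 2 (n + (H i - 1)) = s.arr 2 (n + v) ↔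
          Twin G (H i - 1) v := by rw [twin_iff, hF, hT]
      have hle := weightOf_le G i H v
      refine (Runs.of_wp ?_).mono (R := fun t => (∀ x < v, t.arr 9 x = weightOf G k H x) ∧
        t.arr 9 v = weightOf G (i + 1) H v) (by decide) fun _ _ h _ => by simpa using h
      by_cases hc : weightOf G i H v = 0 ∧ v < H i ∧ Twin G (H i - 1) v
      · obtain ⟨hc1, hc2, hc3⟩ := hc
        have hres := weightOf_succ_of_cond hc1 hc2 hc3
        rw [← htw] at hc3
        have hfin : ∀ x < v, (if x = v then i + 1 else t.arr 9 x) = weightOf G k H x :=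
          fun x hx => by rw [if_neg hx.ne]; exact hJ1 x hx
        by_cases h1 : s.arr 2 (H i - 1) = s.arr 2 v <;>
          by_cases h2 : s.arr 2 (n + (H i - 1)) = s.arr 2 (n + v) <;>
          simp [h0t, h2t, h3t, ha2t, h8t, hJ2, hc1, hc2, h1, h2, hres]
        · exact ⟨by omega, by omega, hfin⟩
        · exact ⟨by omega, by omega, hfin⟩
        · exact ⟨by omega, by omega, hfin⟩
        · exact absurd hc3 (not_or.2 ⟨h1, h2⟩)
      · have hres := weightOf_succ_of_not hc
        rw [← htw] at hc
        by_cases h0 : weightOf G i H v = 0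
        · by_cases hvH : v < H i
          · have h1 : s.arr 2 (H i - 1) ≠ s.arr 2 v := fun h' => hc ⟨h0, hvH, Or.inl h'⟩
            have h2 : s.arr 2 (n + (H i - 1)) ≠ s.arr 2 (n + v) :=
              fun h' => hc ⟨h0, hvH, Or.inr h'⟩
            simp [h0t, h2t, h3t, ha2t, h8t, hJ2, h0, hvH, h1, h2, hres]
            exact ⟨by omega, hJ1⟩
          · by_cases h1 : s.arr 2 (H i - 1) = s.arr 2 v <;>
              by_cases h2 : s.arr 2 (n + (H i - 1)) = s.arr 2 (n + v) <;>
              simp [h0t, h2t, h3t, ha2t, h8t, hJ2, h0, hvH, h1, h2, hres] <;>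
              exact ⟨by omega, hJ1⟩
        · by_cases hvH : v < H i <;> by_cases h1 : s.arr 2 (H i - 1) = s.arr 2 v <;>
            by_cases h2 : s.arr 2 (n + (H i - 1)) = s.arr 2 (n + v) <;>
            simp [h0t, h2t, h3t, ha2t, h8t, hJ2, h0, hvH, h1, h2, hres] <;>
            exact ⟨by omega, hJ1⟩
    · simp [Expr.cost]; omega
    · rintro t hft ⟨-, hJ1, hJ2⟩ -
      intro x hx
      rcases Nat.lt_succ_iff_lt_or_eq.1 hx with hx | rfl
      · simpa using hJ1 x hx
      · simpa using hJ2
  · have h1 : n * (55 * (k + 1) + 8) ≤ 63 * (n * (k + 1)) := by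
      calc n * (55 * (k + 1) + 8) ≤ n * (63 * (k + 1)) := Nat.mul_le_mul_left n (by omega)
        _ = 63 * (n * (k + 1)) := by ring
    simp [Expr.cost]
    omega

/-- The number `t` and the positive weights `w` pass the tests for all sets in normal form. -/
def IsTarget (G : SimpleGraph ℕ) (n k : ℕ) (w : ℕ → ℕ) (t : ℕ) : Prop :=
  (∀ v < n, 0 < w v) ∧ ∀ m < (n + 1) ^ k,
    (MaxStableOn G (Finset.range n) (cutSet n w (digit (n + 1) m)) ↔
      ∑ x ∈ cutSet n w (digit (n + 1) m), w x = t)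

/-- Test the target in register `13` for the weights in array `9`; set register `11` if it passes. -/
def testTarget : Prog :=
  (.assign 12 1 ⨾ .assign 2 0) ⨾
  .upTo 2 (.reg 0) (.branch (.get 9 (.reg 2)) .nop (.assign 12 0)) ⨾
  odometer 10 testSet ⨾
  .branch (.reg 12) (.assign 11 1) .nop

/-- The time for testing one target. -/
def targetTime (n k e : ℕ) : ℕ :=
  (n + 1) ^ k * (150 * (n + e + 1) + 40 * (k + 1)) + 40 * (k + 1) + 20 * (n + 1)

theorem runs_testTarget {G : SimpleGraph ℕ} {W n k t : ℕ} {s : Store} {off nbr w : ℕ → ℕ}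
    {P : Prop} (hadj : AdjArrays G n off nbr) (hn : s.reg 0 = n) (hk : s.reg 1 = k)
    (hn0 : 0 < n) (hk0 : 0 < k) (ht : s.reg 13 = t) (htW : t ≤ W) (hoff : s.arr 0 = off)
    (hnbr : s.arr 1 = nbr) (hw : ∀ v < n, s.arr 9 v = w v) (hwk : ∀ v, w v ≤ k)
    (hW : k * n + n + k + 3 < W) (hoffW : off n + 3 < W) (hP : s.reg 11 = ind P) :
    Runs W testTarget s (targetTime n k (off n))
      (fun s' => s'.reg 11 = ind (P ∨ IsTarget G n k w t)) := by
  refine Runs.wp_seq (T₂ := (n + 1) ^ k * (150 * (n + off n + 1) + 40 * (k + 1)) +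
    40 * (k + 1) + 20 * n + 16) ?_ (by simp [Prog.size, Expr.cost, targetTime]; omega)
  simp only [Prog.wp]
  refine ⟨by simp; omega, by simp, fun hf₁ => ?_⟩
  set s₁ := (s.setReg 12 _).setReg 2 _ with hs₁
  have h0₁ : s₁.reg 0 = n := by simp [hs₁, hn]
  have h9₁ : ∀ v < n, s₁.arr 9 v = w v := by simpa [hs₁] using hw
  refine Runs.seq (T₁ := 20 * n + 4)
    (T₂ := (n + 1) ^ k * (150 * (n + off n + 1) + 40 * (k + 1)) + 40 * (k + 1) + 6)
    (Runs.upTo_const (fun u s' => s'.reg 12 = ind (∀ v < u, 0 < w v)) 0 n 12 (Nat.zero_le n)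
    (by simp [hs₁]) ?_ rfl (by omega) ?_ ?_ ?_) (fun s₂ hf₂ h₂ => ?_) (by omega)
  · rw [ind_of_true (by simp)]; simp [hs₁]
  · intro i s' hf _
    have := (hf.reg 0 rfl).trans h0₁
    simp [this]; omega
  · intro u _ hu s' hf h2 hI
    have h9u := (congrFun (hf.arr 9 rfl) u).trans (h9₁ u hu)
    have hwu := hwk u
    refine (Runs.of_wp ?_).mono (R := fun s' => s'.reg 12 = ind (∀ v < u + 1, 0 < w v))
      (by decide) fun _ _ h _ => by simpa using h
    have hsucc : (∀ v < u + 1, 0 < w v) ↔ (∀ v < u, 0 < w v) ∧ 0 < w u := by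
      rw [Nat.forall_lt_succ_right]
    rw [hsucc]
    by_cases h0 : w u = 0
    · rw [ind_of_false (fun h' => by omega)]
      simp [h2, h9u, h0]; omega
    · simp only [Nat.pos_of_ne_zero h0, and_true]
      simp [h2, h9u, h0, hI]; omega
  · simp [Expr.cost]; omega
  have hfr : Frame testTarget s s₂ := (hf₁.mono (by simp +contextual [testTarget, Prog.modReg])
    (by simp +contextual [testTarget, Prog.modArr])).trans
      (hf₂.mono (by simp +contextual [testTarget, Prog.modReg])
    (by simp +contextual [testTarget, Prog.modArr]))
  have h0₂ := (hf₂.reg 0 rfl).trans h0₁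
  have h1₂ : s₂.reg 1 = k := (hf₂.reg 1 rfl).trans (by simp [hs₁, hk])
  have h11₂ : s₂.reg 11 = ind P := (hf₂.reg 11 rfl).trans (by simp [hs₁, hP])
  have h13₂ : s₂.reg 13 = t := (hf₂.reg 13 rfl).trans (by simp [hs₁, ht])
  have ha0₂ : s₂.arr 0 = off := (hf₂.arr 0 rfl).trans (by simp [hs₁, hoff])
  have ha1₂ : s₂.arr 1 = nbr := (hf₂.arr 1 rfl).trans (by simp [hs₁, hnbr])
  have h9₂ : ∀ v < n, s₂.arr 9 v = w v := by rw [hf₂.arr 9 rfl]; exact h9₁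
  have hdn : ∀ m i, digit (n + 1) m i ≤ n := fun m i =>
    Nat.le_of_lt_succ (Nat.mod_lt _ (Nat.succ_pos n))
  refine Runs.seq (T₁ := (n + 1) ^ k * (150 * (n + off n + 1) + 40 * (k + 1)) + 40 * (k + 1))
    (T₂ := 6) (Runs.odometer (fun m s' => s'.reg 12 = ind ((∀ v < n, 0 < w v) ∧ ∀ m' < m,
      (MaxStableOn G (Finset.range n) (cutSet n w (digit (n + 1) m')) ↔
        ∑ x ∈ cutSet n w (digit (n + 1) m'), w x = t))) h0₂ h1₂ hn0 (by omega) (by omega)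
      rfl rfl rfl ?_ ?_ ?_ le_rfl) ?_ (by omega)
  · intro m s₃ s₄ hr _ h
    rw [hr 12 (by omega), h]
  · rw [h₂.2]
    simp
  · intro m hm s₃ hf₃ hdig hJ
    refine (runs_testSet (d := digit (n + 1) m) hadj ((hf₃.reg 0 rfl).trans h0₂) hk0
      ((hf₃.reg 13 rfl).trans h13₂) htW ((hf₃.arr 0 rfl).trans ha0₂)
      ((hf₃.arr 1 rfl).trans ha1₂) (by rw [hf₃.arr 9 rfl]; exact h9₂) hwk
      (fun i hi => hdig i hi.le) (hdn m) hW hoffW).mono le_rfl ?_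
    rintro s₄ - ⟨h1, h2⟩
    simp only [Nat.forall_lt_succ_right, ← and_assoc]
    by_cases hok : MaxStableOn G (Finset.range n) (cutSet n w (digit (n + 1) m)) ↔
        ∑ x ∈ cutSet n w (digit (n + 1) m), w x = t
    · rw [h1 hok, hJ]
      simp only [hok, and_true]
    · rw [h2 hok, ind_of_false fun h' => hok h'.2]
  · intro s₃ hf₃ h₃
    have h11₃ := (hf₃.reg 11 rfl).trans h11₂
    refine (Runs.of_wp (Q := fun s' => s'.reg 11 = ind (P ∨ IsTarget G n k w t)) ?_).mono
      (by decide) fun _ _ h => h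
    by_cases hT : IsTarget G n k w t
    · rw [ind_of_true (Or.inr hT)]
      have h12 : s₃.reg 12 = 1 := h₃.trans (ind_of_true hT)
      simp [h12]; omega
    · have h12 : s₃.reg 12 = 0 := h₃.trans (ind_of_false hT)
      simp [h12, h11₃, hT]

/-- Test all targets for the weights that array `8` describes. -/
def tryWeights : Prog :=
  assignWeights ⨾ .assign 13 1 ⨾ .upTo 13 (.reg 1 * .reg 0 + 1) testTarget

/-- The time for testing one weight function. -/
def weightsTime (n k e : ℕ) : ℕ :=
  80 * ((n + 1) * (k + 1)) + k * n * (targetTime n k e + 12) + 12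

theorem runs_tryWeights {G : SimpleGraph ℕ} {W n k L : ℕ} {s : Store} {off nbr H : ℕ → ℕ}
    {P : Prop} (hadj : AdjArrays G n off nbr) (hn : s.reg 0 = n) (hk : s.reg 1 = k)
    (hn0 : 0 < n) (hk0 : 0 < k) (hoff : s.arr 0 = off)
    (hnbr : s.arr 1 = nbr) (hcls : TwinLabels G n L (s.arr 2))
    (hH : ∀ i < k, s.arr 8 i = H i) (hHn : ∀ i, H i ≤ n) (hLW : L < W) (hnW : 2 * n + 2 < W)
    (hW : k * n + n + k + 3 < W) (hoffW : off n + 3 < W) (hP : s.reg 11 = ind P) :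
    Runs W tryWeights s (weightsTime n k (off n)) (fun s' => s'.reg 11 =
      ind (P ∨ ∃ t, 0 < t ∧ t ≤ k * n ∧ IsTarget G n k (weightOf G k H) t)) := by
  refine Runs.seq (runs_assignWeights hn hk hcls hH hHn hLW hnW (by omega))
    (T₂ := k * n * (targetTime n k (off n) + 12) + 12) (fun s₁ hf₁ h₁ => ?_)
    (by unfold weightsTime; omega)
  refine Runs.wp_seq (T₂ := k * n * (targetTime n k (off n) + 12) + 10) ?_
    (by simp [Prog.size, Expr.cost]; omega)
  simp only [Prog.wp]
  refine ⟨by simp; omega, fun hf₂ => ?_⟩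
  set s₂ := s₁.setReg 13 _ with hs₂
  have h0₂ : s₂.reg 0 = n := by simp [hs₂, (hf₁.reg 0 rfl).trans hn]
  have h1₂ : s₂.reg 1 = k := by simp [hs₂, (hf₁.reg 1 rfl).trans hk]
  have h11₂ : s₂.reg 11 = ind P := by simp [hs₂, (hf₁.reg 11 rfl).trans hP]
  have ha0₂ : s₂.arr 0 = off := by simp [hs₂, (hf₁.arr 0 rfl).trans hoff]
  have ha1₂ : s₂.arr 1 = nbr := by simp [hs₂, (hf₁.arr 1 rfl).trans hnbr]
  have h9₂ : ∀ v < n, s₂.arr 9 v = weightOf G k H v := by simpa [hs₂] using h₁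
  refine (Runs.upTo_const (fun t s' => s'.reg 11 =
    ind (P ∨ ∃ t', 0 < t' ∧ t' < t ∧ IsTarget G n k (weightOf G k H) t')) 1 (k * n + 1)
    (targetTime n k (off n)) (by omega) (by simp [hs₂]) ?_ rfl (by omega) ?_ ?_ ?_).mono le_rfl ?_
  · rw [h11₂]
    congr 1
    refine propext ⟨Or.inl, fun h => h.resolve_right ?_⟩
    rintro ⟨t', h1, h2, -⟩
    omega
  · intro i s' hf _
    have h0 := (hf.reg 0 rfl).trans h0₂
    have h1 := (hf.reg 1 rfl).trans h1₂
    simp [h0, h1]; omega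
  · intro t ht ht' s' hf h13 hI
    refine (runs_testTarget (w := weightOf G k H) hadj ((hf.reg 0 rfl).trans h0₂)
      ((hf.reg 1 rfl).trans h1₂) hn0 hk0 h13 (by omega) ((hf.arr 0 rfl).trans ha0₂)
      ((hf.arr 1 rfl).trans ha1₂) (by rw [hf.arr 9 rfl]; exact h9₂) (weightOf_le G k H) hW hoffW
      hI).mono le_rfl ?_
    rintro s'' - h'' -
    simp only [Store.setReg_reg]
    rw [if_neg (by omega), h'', or_assoc]
    congr 2
    refine propext ⟨?_, ?_⟩
    · rintro (⟨t', h1, h2, h3⟩ | h)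
      · exact ⟨t', h1, by omega, h3⟩
      · exact ⟨t, ht, Nat.lt_succ_self t, h⟩
    · rintro ⟨t', h1, h2, h3⟩
      rcases Nat.lt_succ_iff_lt_or_eq.1 h2 with h2 | rfl
      · exact Or.inl ⟨t', h1, h2, h3⟩
      · exact Or.inr h3
  · simp [Expr.cost]
  · rintro s' - ⟨-, h⟩
    rw [h]
    simp only [Nat.lt_succ_iff]

/-! ### Deciding the problem -/

/-- Decide whether the stored graph, which has a vertex, is equistable for the stored parameter. -/
def search : Prog :=
  refine ⨾ .assign 11 0 ⨾ odometer 8 tryWeights ⨾ .assign 0 (.reg 11)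

/-- The time for the search. -/
def searchTime (n k e : ℕ) : ℕ :=
  200 * (n + e + 1) + ((n + 1) ^ k * (weightsTime n k e + 40 * (k + 1)) + 40 * (k + 1)) + 4

theorem runs_search {G : SimpleGraph ℕ} {W n k : ℕ} {s : Store} {off nbr : ℕ → ℕ}
    (hadj : AdjArrays G n off nbr) (hn : s.reg 0 = n) (hk : s.reg 1 = k)
    (hn0 : 0 < n) (hk0 : 0 < k) (hoff : s.arr 0 = off) (hnbr : s.arr 1 = nbr)
    (hLW : 2 * n + 2 * off n + 2 < W) (hW : k * n + n + k + 3 < W) (hoffW : off n + 3 < W) :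
    Runs W search s (searchTime n k (off n))
      (fun s' => s'.reg 0 = ind (KEquistableOn G (Finset.range n) k)) := by
  refine Runs.seq (runs_refine hadj hn hoff hnbr rfl hLW)
    (T₂ := (n + 1) ^ k * (weightsTime n k (off n) + 40 * (k + 1)) + 40 * (k + 1) + 4)
    (fun s₁ hf₁ h₁ => ?_) (by unfold searchTime; omega)
  refine Runs.wp_seq (T₂ := (n + 1) ^ k * (weightsTime n k (off n) + 40 * (k + 1)) +
    40 * (k + 1) + 2) ?_ (by simp [Prog.size, Expr.cost]; omega)
  simp only [Prog.wp]
  refine ⟨by simp, fun hf₂ => ?_⟩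
  set s₂ := s₁.setReg 11 _ with hs₂
  have h0₂ : s₂.reg 0 = n := by simp [hs₂, (hf₁.reg 0 rfl).trans hn]
  have h1₂ : s₂.reg 1 = k := by simp [hs₂, (hf₁.reg 1 rfl).trans hk]
  have ha0₂ : s₂.arr 0 = off := by simp [hs₂, (hf₁.arr 0 rfl).trans hoff]
  have ha1₂ : s₂.arr 1 = nbr := by simp [hs₂, (hf₁.arr 1 rfl).trans hnbr]
  have ha2₂ : TwinLabels G n (2 * n + 2 * off n + 2) (s₂.arr 2) := by simpa [hs₂] using h₁.1
  have hdn : ∀ m i, digit (n + 1) m i ≤ n := fun m i =>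
    Nat.le_of_lt_succ (Nat.mod_lt _ (Nat.succ_pos n))
  refine Runs.seq (T₂ := 2) (Runs.odometer (fun m s' => s'.reg 11 = ind (∃ m' < m, ∃ t, 0 < t ∧
    t ≤ k * n ∧ IsTarget G n k (weightOf G k (digit (n + 1) m')) t)) h0₂ h1₂ hn0 (by omega)
    (by omega) rfl rfl rfl ?_ ?_ ?_ le_rfl) ?_ le_rfl
  · intro m s₃ s₄ hr _ h
    rw [hr 11 (by omega), h]
  · rw [ind_of_false (by simp)]
    simp [hs₂]
  · intro m _ s₃ hf₃ hdig hJ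
    refine (runs_tryWeights (H := digit (n + 1) m) hadj ((hf₃.reg 0 rfl).trans h0₂)
      ((hf₃.reg 1 rfl).trans h1₂) hn0 hk0 ((hf₃.arr 0 rfl).trans ha0₂)
      ((hf₃.arr 1 rfl).trans ha1₂) (by rw [hf₃.arr 2 rfl]; exact ha2₂) (fun i hi => hdig i hi.le)
      (hdn m) hLW (by omega) hW hoffW hJ).mono le_rfl ?_
    intro s₄ _ h₄
    rw [h₄]
    congr 1
    refine propext ⟨?_, ?_⟩
    · rintro (⟨m', hm', h⟩ | h)
      · exact ⟨m', by omega, h⟩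
      · exact ⟨m, Nat.lt_succ_self m, h⟩
    · rintro ⟨m', hm', h⟩
      rcases Nat.lt_succ_iff_lt_or_eq.1 hm' with hm' | rfl
      · exact Or.inl ⟨m', hm', h⟩
      · exact Or.inr h
  · intro s₃ _ h₃
    have hle := ind_le_one (∃ m' < (n + 1) ^ k, ∃ t, 0 < t ∧
      t ≤ k * n ∧ IsTarget G n k (weightOf G k (digit (n + 1) m')) t)
    refine (Runs.of_wp (Q := fun s' => s'.reg 0 = ind (KEquistableOn G (Finset.range n) k)) ?_).mono
      (by decide) fun _ _ h => h
    rw [kEquistableOn_range_iff (fun x y h => hadj.adj_lt x y h) hk0]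
    simp only [Prog.wp]
    refine ⟨?_, ?_⟩
    · simp [h₃]; omega
    · simpa [IsTarget] using h₃

/-- Kernelize, then search. If the kernel has no vertices, register `0` already holds the answer
`0`: the empty set is a maximal stable set of the empty graph, and its weight is not positive. -/
def solve : Prog := kernel ⨾ .branch (.reg 0) search .nop

theorem not_isKEquistable_of_isEmpty {V : Type*} [IsEmpty V] (G : SimpleGraph V) (k : ℕ) :
    ¬ IsKEquistable G k := by
  rintro ⟨w, t, hw, -⟩
  have h := (hw.maximal_iff ∅).1 ⟨by simp, fun T _ _ => by
    rw [Set.eq_empty_of_isEmpty T]; simp⟩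
  have := hw.target_pos
  simp at h
  omega

theorem searchTime_le {n k e : ℕ} (he : e ≤ n * n) :
    searchTime n k e ≤ 1000 * ((n + 1) ^ (2 * k + 3) * (k + 1) ^ 2) := by
  obtain ⟨M, hM⟩ : ∃ M, M = n + 1 := ⟨_, rfl⟩
  obtain ⟨K, hK⟩ : ∃ K, K = k + 1 := ⟨_, rfl⟩
  obtain ⟨A, hA⟩ : ∃ A, A = (n + 1) ^ k := ⟨_, rfl⟩
  have hM1 : 1 ≤ M := by omega
  have hK1 : 1 ≤ K := by omega
  have hA1 : 1 ≤ A := hA ▸ Nat.one_le_pow _ _ (Nat.succ_pos n)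
  have hMM : n + e + 1 ≤ M ^ 2 := by rw [hM]; nlinarith
  have hkn : k * n ≤ K * M := Nat.mul_le_mul (by omega) (by omega)
  have h1 : targetTime n k e ≤ 250 * (A * M ^ 2 * K) := by
    rw [targetTime, ← hA, ← hM, ← hK]
    calc A * (150 * (n + e + 1) + 40 * K) + 40 * K + 20 * M
        ≤ A * (150 * (M ^ 2 * K) + 40 * (M ^ 2 * K)) + 40 * (A * M ^ 2 * K) +
            20 * (A * M ^ 2 * K) := by
          gcongr
          · exact hMM.trans (Nat.le_mul_of_pos_right _ hK1)
          · exact Nat.le_mul_of_pos_left _ (by positivity)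
          · exact Nat.le_mul_of_pos_left _ (by positivity)
          · calc M ≤ M ^ 2 := Nat.le_self_pow (by omega) M
              _ ≤ A * M ^ 2 := Nat.le_mul_of_pos_left _ hA1
              _ ≤ A * M ^ 2 * K := Nat.le_mul_of_pos_right _ hK1
      _ = 250 * (A * M ^ 2 * K) := by ring
  have h2 : weightsTime n k e ≤ 354 * (A * M ^ 3 * K ^ 2) := by
    rw [weightsTime, ← hM, ← hK]
    have hAMK : 1 ≤ A * M ^ 2 * K := Nat.one_le_iff_ne_zero.2 (by positivity)
    calc 80 * (M * K) + k * n * (targetTime n k e + 12) + 12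
        ≤ 80 * ((M * K) * (A * M ^ 2 * K)) +
            K * M * (250 * (A * M ^ 2 * K) + 12 * (A * M ^ 2 * K)) +
            12 * ((A * M ^ 2 * K) * (M * K)) := by
          refine Nat.add_le_add (Nat.add_le_add ?_ (Nat.mul_le_mul hkn (by omega))) ?_
          · exact Nat.mul_le_mul_left _ (Nat.le_mul_of_pos_right (M * K) hAMK)
          · exact Nat.le_mul_of_pos_right 12 (Nat.mul_pos hAMK (by positivity))
      _ = 354 * (A * M ^ 3 * K ^ 2) := by ring
  rw [searchTime, ← hA, ← hM, ← hK]
  have hX : (M : ℕ) ^ (2 * k + 3) * K ^ 2 = A * (A * M ^ 3 * K ^ 2) := by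
    rw [hA, hM]; ring
  rw [hX]
  have hY1 : K ≤ A * M ^ 3 * K ^ 2 :=
    (Nat.le_self_pow (by omega) K).trans (Nat.le_mul_of_pos_left _ (by positivity))
  have hY2 : M ^ 2 ≤ A * M ^ 3 * K ^ 2 :=
    (Nat.pow_le_pow_right hM1 (by omega)).trans
      ((Nat.le_mul_of_pos_left _ hA1).trans (Nat.le_mul_of_pos_right _ (by positivity)))
  generalize A * M ^ 3 * K ^ 2 = Y at *
  have hAY : Y ≤ A * Y := Nat.le_mul_of_pos_left _ hA1
  have h3 : A * (weightsTime n k e + 40 * K) ≤ A * (394 * Y) := Nat.mul_le_mul_left A (by omega)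
  have h4 : A * (394 * Y) = 394 * (A * Y) := by ring
  omega

theorem pow_le_pow_self_mul {a k : ℕ} (ha : 0 < a) : a ^ k ≤ a ^ a * k ^ k := by
  rcases le_total a k with h | h
  · exact (Nat.pow_le_pow_left h k).trans (Nat.le_mul_of_pos_left _ (by positivity))
  · rcases Nat.eq_zero_or_pos k with rfl | hk
    · simpa using Nat.one_le_pow _ _ ha
    · exact (Nat.pow_le_pow_right ha h).trans (Nat.le_mul_of_pos_right _ (by positivity))

/-- The search on a kernel takes time `O(k ^ (9 * k + 1))`: the factor `k ^ k` absorbs the powers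
of constants. -/
theorem exists_searchTime_le : ∃ C, ∀ k, 0 < k → ∀ n k' e, k' ≤ k → n ≤ 6 * k ^ 4 → e ≤ n * n →
    searchTime n k' e ≤ C * k ^ (9 * k + 1) := by
  obtain ⟨a, ha⟩ : ∃ a, a = 7 ^ 2 * 2 ^ 13 := ⟨_, rfl⟩
  refine ⟨1000 * 7 ^ 3 * 2 ^ 2 * a ^ a, fun k hk n k' e hk' hn he => ?_⟩
  have hM : n + 1 ≤ 7 * k ^ 4 := by
    have := Nat.one_le_pow 4 k hk
    omega
  have h13 : k ^ 13 ≤ (2 ^ k) ^ 13 := Nat.pow_le_pow_left Nat.lt_two_pow_self.le 13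
  calc searchTime n k' e ≤ 1000 * ((n + 1) ^ (2 * k' + 3) * (k' + 1) ^ 2) := searchTime_le he
    _ ≤ 1000 * ((7 * k ^ 4) ^ (2 * k + 3) * (2 * k) ^ 2) := by
      refine Nat.mul_le_mul_left _ (Nat.mul_le_mul ?_ (Nat.pow_le_pow_left (by omega) 2))
      exact (Nat.pow_le_pow_left hM _).trans (Nat.pow_le_pow_right (by positivity) (by omega))
    _ = 1000 * 7 ^ 3 * 2 ^ 2 * ((7 ^ 2) ^ k * k ^ 13) * k ^ (8 * k + 1) := by
      rw [mul_pow, mul_pow, ← pow_mul, ← pow_mul]; ring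
    _ ≤ 1000 * 7 ^ 3 * 2 ^ 2 * ((7 ^ 2) ^ k * (2 ^ k) ^ 13) * k ^ (8 * k + 1) := by gcongr
    _ = 1000 * 7 ^ 3 * 2 ^ 2 * a ^ k * k ^ (8 * k + 1) := by
      rw [ha, mul_pow, pow_right_comm 2 k 13]
    _ ≤ 1000 * 7 ^ 3 * 2 ^ 2 * (a ^ a * k ^ k) * k ^ (8 * k + 1) := by
      gcongr
      exact pow_le_pow_self_mul (by omega)
    _ = 1000 * 7 ^ 3 * 2 ^ 2 * a ^ a * k ^ (9 * k + 1) := by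
      rw [show 9 * k + 1 = k + (8 * k + 1) by ring, pow_add k k]; ring
theorem runs_solve {W n k T : ℕ} {G : SimpleGraph (Fin n)} {s : Store} (h : Holds s G k)
    (hk : 0 < k) (hW : 2 * n + 2 * (2 * numEdges G) + 3 < W) (hkW : 100 * k ^ 8 < W)
    (hT : ∀ n' k' e, k' ≤ k → n' ≤ 6 * k ^ 4 → e ≤ n' * n' → searchTime n' k' e ≤ T) :
    Runs W solve s (1000 * (n + numEdges G + 1) + (T + 2))
      (fun s' => s'.reg 0 = ind (IsKEquistable G k)) := by
  have hp1 : 1 ≤ k ^ 4 := Nat.one_le_pow _ _ hk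
  have hp4 : k ^ 8 = k ^ 4 * k ^ 4 := by ring
  have hp5 : k ≤ k ^ 4 := Nat.le_self_pow (by omega) k
  have hp8 : k ^ 4 ≤ k ^ 8 := by rw [hp4]; exact Nat.le_mul_of_pos_right _ hp1
  refine Runs.seq (runs_kernel h hk hW (by omega)) (fun s₁ _ h₁ => ?_) le_rfl
  obtain ⟨n', G', k', hs, hk'0, hk', hn', hiff⟩ := h₁
  have hadj := hs.adj.adjArrays
  have hsq := hadj.off_le_sq
  have hn2 : n' * n' ≤ 36 * k ^ 8 := by
    calc n' * n' ≤ (6 * k ^ 4) * (6 * k ^ 4) := Nat.mul_le_mul hn' hn'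
      _ = 36 * k ^ 8 := by ring
  have hkn : k' * n' ≤ 6 * k ^ 8 := by
    calc k' * n' ≤ k ^ 4 * (6 * k ^ 4) := Nat.mul_le_mul (hk'.trans hp5) hn'
      _ = 6 * k ^ 8 := by ring
  refine Runs.branch ?_ (fun hne => ?_) (fun he => ?_) (T₁ := T) (by simp [Expr.cost]; omega)
  · simp [Expr.Fits, hs.reg_zero]; omega
  · simp only [Expr.eval, hs.reg_zero] at hne
    refine (runs_search hadj hs.reg_zero hs.reg_one (Nat.pos_of_ne_zero hne) hk'0 rfl rfl
      (by omega) (by omega) (by omega)).mono (hT _ _ _ hk' hn' hsq) fun s₂ _ h₂ => ?_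
    rw [h₂, ← isKEquistable_iff_natGraph, hiff]
  · simp only [Expr.eval, hs.reg_zero] at he
    subst he
    refine (Runs.of_wp (p := .nop) (W := W) (s := s₁)
      (Q := fun s' => s'.reg 0 = ind (IsKEquistable G k)) ?_).mono ?_ fun _ _ h => h
    · rw [ind_of_false (hiff.not.1 (not_isKEquistable_of_isEmpty G' k'))]
      exact hs.reg_zero
    · refine le_trans ?_ (hT 0 0 0 (Nat.zero_le _) (Nat.zero_le _) le_rfl)
      simp [Prog.size, searchTime]

theorem wordBound_bounds (n m k : ℕ) (hk : 0 < k) :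
    2 * n + 2 * (2 * m) + 3 < wordBound 16 n m k ∧ 6 * k ^ 4 < wordBound 16 n m k ∧
      100 * k ^ 8 < wordBound 16 n m k := by
  obtain ⟨N, hN⟩ : ∃ N, N = n + m + k + 2 := ⟨_, rfl⟩
  rw [wordBound, ← hN]
  have h8 : 6561 ≤ N ^ 8 :=
    le_trans (by norm_num) (Nat.pow_le_pow_left (show 3 ≤ N by omega) 8)
  have h16 : 6561 * N ^ 8 ≤ N ^ 16 := by
    calc 6561 * N ^ 8 ≤ N ^ 8 * N ^ 8 := Nat.mul_le_mul_right _ h8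
      _ = N ^ 16 := by ring
  have hN8 : N ≤ N ^ 8 := Nat.le_self_pow (by omega) N
  have hk8 : k ^ 8 ≤ N ^ 8 := Nat.pow_le_pow_left (by omega) 8
  have hk4 : k ^ 4 ≤ k ^ 8 := Nat.pow_le_pow_right hk (by omega)
  generalize N ^ 8 = X at *
  generalize N ^ 16 = Y at *
  generalize k ^ 8 = Z at *
  generalize k ^ 4 = U at *
  exact ⟨by omega, by omega, by omega⟩

theorem hasLinearTimeKernel_kEquistability :
    HasLinearTimeKernel kEquistability (fun k => 6 * k ^ 5) := by
  refine ⟨kernel, 16, 1000, id, fun n G k hk s hs => ?_⟩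
  obtain ⟨hW, hkW, -⟩ := wordBound_bounds n (numEdges G) k hk
  obtain ⟨t, s', he, ht, n', G', k', hs', hk0, hk', hn', hiff⟩ :=
    runs_kernel hs.toHolds hk hW hkW
  exact ⟨t, s', n', G', k', he, ht, hs', hk0, hiff,
    hn'.trans (Nat.mul_le_mul_left 6 (Nat.pow_le_pow_right hk (by omega))), hk'⟩

theorem exists_decidableInTime_kEquistability :
    ∃ C, DecidableInTime kEquistability (fun n m k => C * (k ^ (9 * k + 1) + m + n)) := by
  obtain ⟨C, hC⟩ := exists_searchTime_le
  refine ⟨C + 1002, solve, 16, fun n G k hk s hs => ?_⟩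
  obtain ⟨hW, -, hkW⟩ := wordBound_bounds n (numEdges G) k hk
  obtain ⟨t, s', he, ht, h⟩ := runs_solve hs.toHolds hk hW hkW (hC k hk)
  have hp : 1 ≤ k ^ (9 * k + 1) := Nat.one_le_pow _ _ hk
  refine ⟨t, s', he, ht.trans ?_, fun hP => h.trans (ind_of_true hP),
    fun hP => h.trans (ind_of_false hP)⟩
  nlinarith [Nat.zero_le (C * (numEdges G + n))]

theorem DecidableInTime.mono {P : GraphProblem} {T T' : ℕ → ℕ → ℕ → ℕ} (h : DecidableInTime P T)
    (hT : ∀ n m k, T n m k ≤ T' n m k) : DecidableInTime P T' := by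
  obtain ⟨p, c, hp⟩ := h
  refine ⟨p, c, fun n G k hk s hs => ?_⟩
  obtain ⟨t, s', he, ht, h⟩ := hp n G k hk s hs
  exact ⟨t, s', he, ht.trans (hT _ _ _), h⟩

theorem fixedParameterTractable_kEquistability : FixedParameterTractable kEquistability := by
  obtain ⟨C, hC⟩ := exists_decidableInTime_kEquistability
  refine ⟨fun k => C * (k ^ (9 * k + 1) + 1), 1, hC.mono fun n m k => ?_⟩
  rw [pow_one, mul_assoc]
  refine Nat.mul_le_mul_left C ?_
  nlinarith [Nat.zero_le (k ^ (9 * k + 1) * (n + m))]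

end Equistability

theorem mainTheorem1 :
    (∃ C : ℕ, Equistability.HasLinearTimeKernel Equistability.kEquistability
      (fun k => C * k ^ 5)) ∧
    (∃ C : ℕ, Equistability.DecidableInTime Equistability.kEquistability
      (fun n m k => C * (k ^ (9 * k + 1) + m + n))) ∧
    Equistability.FixedParameterTractable Equistability.kEquistability :=
  ⟨⟨6, Equistability.hasLinearTimeKernel_kEquistability⟩,
    Equistability.exists_decidableInTime_kEquistability,
    Equistability.fixedParameterTractable_kEquistability⟩
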